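/- Let $W$ be a finite Coxeter group with set of simple generators $S$, set of reflections $T=\{wsw^{-1}: w\in W, s\in S\}$ and length function $l$, and let $c$ be a Coxeter element of $W$, that is, an element with a reduced word $a_1a_2\cdots a_n$ in which every element of $S$ occurs exactly once. Fix such a word and let $c^\infty=a_1\cdots a_n|a_1\cdots a_n|a_1\cdots a_n|\cdots$ be its infinite repetition. The $c$-sorting word for $w\in W$ is the lexicographically first (as a sequence of positions in $c^\infty$) subword of $c^\infty$ that is a reduced word for $w$, and $w$ is $c$-sortable if the sets $K_1,K_2,\ldots\subseteq S$, where $K_j$ consists of the letters of the $c$-sorting word for $w$ taken from the $j$-th copy of $a_1\cdots a_n$, satisfy $K_1\supseteq K_2\supseteq\cdots$. A descent of $w$ is an $s\in S$ with $l(ws)<l(w)$, and a cover reflection of $w$ is a $t\in T$ with $tw=ws$ for some descent $s$ of $w$. If $w$ is $c$-sortable with $c$-sorting word $b_1b_2\cdots b_k$, order the inversions of $w$ so that the $i$-th one is $b_1\cdots b_{i-1}b_ib_{i-1}\cdots b_1$, let $t_1,\ldots,t_m$ be the cover reflections of $w$ listed in this order, and put $\operatorname{nc}_c(w)=t_1t_2\cdots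 t_m$. A reduced $T$-word for $x\in W$ is a word in the alphabet $T$ with product $x$ of minimal length; this length is the absolute length of $x$. Write $x\le_T y$ if some reduced $T$-word for $x$ is a prefix of some reduced $T$-word for $y$. The noncrossing partitions with respect to $c$ are the elements of the interval $[1,c]_T=\{x\in W: 1\le_T x\le_T c\}$, and the rank of a noncrossing partition is its absolute length. Theorem. Neither the set of $c$-sortable elements nor the map $\operatorname{nc}_c$ on it depends on the choice of the reduced word $a_1\cdots a_n$ for $c$. The map $w\mapsto\operatorname{nc}_c(w)$ is a bijection from the set of $c$-sortable elements of $W$ to the set $[1,c]_T$ of noncrossing partitions with respect to $c$. Furthermore, $\operatorname{nc}_c$ maps $c$-sortable elements with $k$ descents to noncrossing partitions of rank $k$. -/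

import Mathlib

namespace CoxeterSortable

variable {B W : Type*} [Group W] {M : CoxeterMatrix B} (cs : CoxeterSystem M W)

/-- `a` is a reduced word for `c` which is a permutation of the set of simple generators
(each generator occurs in `a` exactly once). The Coxeter elements are the elements `c` which have
such a word. -/
structure IsCoxeterWord (c : W) (a : List B) : Prop where
  nodup : a.Nodup
  mem : ∀ i : B, i ∈ a
  isReduced : cs.IsReduced a
  wordProd_eq : cs.wordProd a = c

/-- The positions of the half-infinite word `c^∞ = a | a | a | ⋯`: the position `(k, i)` is the
`i`-th letter of the `k`-th copy of `a` (counted from `0`), and positions are ordered from left to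
right, that is, lexicographically. -/
abbrev Position (a : List B) : Type := ℕ ×ₗ Fin a.length

/-- The letter of `c^∞` in a given position. -/
def letter (a : List B) (p : Position a) : B := a.get (ofLex p).2

/-- The word spelled by a sequence of positions of `c^∞`. -/
def wordAt (a : List B) (ps : List (Position a)) : List B := ps.map (letter a)

/-- `ps` is (the sequence of positions of) a subword of `c^∞` which is a reduced word for `w`. -/
structure IsReducedSubword (a : List B) (w : W) (ps : List (Position a)) : Prop where
  increasing : ps.Pairwise (· < ·)
  isReduced : cs.IsReduced (wordAt a ps)
  wordProd_eq : cs.wordProd (wordAt a ps) = w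

/-- `ps` is the lexicographically first sequence of positions of `c^∞` which gives a reduced word
for `w`; the order on lists is the lexicographic one. -/
def IsSortingSequence (a : List B) (w : W) (ps : List (Position a)) : Prop :=
  IsReducedSubword cs a w ps ∧ ∀ qs : List (Position a), IsReducedSubword cs a w qs → ps ≤ qs

/-- There is at most one sorting sequence. -/
theorem IsSortingSequence.unique {a : List B} {w : W} {ps qs : List (Position a)}
    (hp : IsSortingSequence cs a w ps) (hq : IsSortingSequence cs a w qs) : ps = qs :=
  le_antisymm (hp.2 qs hq.1) (hq.2 ps hp.1)

/-- Every element has a sorting sequence, as soon as every simple generator occurs in `a`. -/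
theorem exists_isSortingSequence {a : List B} (ha : ∀ i : B, i ∈ a) (w : W) :
    ∃ ps : List (Position a), IsSortingSequence cs a w ps := by
  have hlen : ∀ ps, IsReducedSubword cs a w ps → ps.length = cs.length w := by
    intro ps h
    have := h.isReduced.eq
    rw [h.wordProd_eq] at this
    simpa [wordAt] using this.symm
  have hne : ∃ ps, IsReducedSubword cs a w ps := by
    obtain ⟨ω, hω, rfl⟩ := cs.exists_isReduced w
    have key : ∀ (ω : List B) (k : ℕ), ∃ ps : List (Position a),
        ps.Pairwise (· < ·) ∧ wordAt a ps = ω ∧ ∀ p ∈ ps, k ≤ (ofLex p).1 := by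
      intro ω
      induction ω with
      | nil => intro k; exact ⟨[], by simp [wordAt]⟩
      | cons s ω ih =>
        intro k
        obtain ⟨ps, h1, h2, h3⟩ := ih (k + 1)
        obtain ⟨i, hi⟩ := List.get_of_mem (ha s)
        refine ⟨toLex (k, i) :: ps, ?_, ?_, ?_⟩
        · refine List.pairwise_cons.2 ⟨fun p hp => ?_, h1⟩
          rw [Prod.Lex.lt_iff]
          exact Or.inl (h3 p hp)
        · have h2' : ps.map (letter a) = ω := h2
          simp [wordAt, letter, h2'] at hi ⊢
          exact hi
        · intro p hp
          rcases List.mem_cons.1 hp with rfl | hp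
          · simp
          · exact (Nat.le_succ k).trans (h3 p hp)
    obtain ⟨ps, h1, h2, -⟩ := key ω 0
    exact ⟨ps, h1, by rw [h2]; exact hω, by rw [h2]⟩
  have wf : WellFounded (List.Shortlex (α := Position a) (· < ·)) :=
    List.Shortlex.wf wellFounded_lt
  obtain ⟨ps, hps, hmin⟩ := wf.has_min {ps | IsReducedSubword cs a w ps} hne
  refine ⟨ps, hps, fun qs hqs => not_lt.1 fun hlt => hmin qs hqs ?_⟩
  exact List.Shortlex.of_lex (by rw [hlen _ hqs, hlen _ hps]) hlt

open Classical in
/-- The sequence of positions of the `c`-sorting word for `w`. It is characterized by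
`IsSortingSequence` whenever `a` is a reduced word for a Coxeter element. -/
noncomputable def sortingSequence (a : List B) (w : W) : List (Position a) :=
  if h : ∃ ps : List (Position a), IsSortingSequence cs a w ps then h.choose else []

theorem sortingSequence_spec {a : List B} (ha : ∀ i : B, i ∈ a) (w : W) :
    IsSortingSequence cs a w (sortingSequence cs a w) := by
  have h := exists_isSortingSequence cs ha w
  rw [sortingSequence, dif_pos h]
  exact h.choose_spec

/-- The `c`-sorting word for `w`. -/
noncomputable def sortingWord (a : List B) (w : W) : List B :=
  wordAt a (sortingSequence cs a w)

/-- The set of letters of the `c`-sorting word for `w` that lie in the `k`-th copy of `a`, that is,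
between two adjacent dividers of `c^∞ = a | a | a | ⋯`. -/
def block (a : List B) (w : W) (k : ℕ) : Set B :=
  {s | ∃ i : Fin a.length, toLex (k, i) ∈ sortingSequence cs a w ∧ a.get i = s}

/-- `w` is `c`-sortable: the subsets defined by its `c`-sorting word decrease under inclusion. -/
def IsSortable (a : List B) (w : W) : Prop := Antitone (block cs a w)

/-- A cover reflection of `w`: a reflection `t` with `t w = w s` for some descent `s` of `w`. -/
def IsCoverReflection (w t : W) : Prop :=
  cs.IsReflection t ∧ ∃ i : B, cs.IsRightDescent w i ∧ t * w = w * cs.simple i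

open Classical in
/-- The map `nc_c`: the product of the cover reflections of `w`, in the order in which they occur
among the inversions `a₁ ⋯ aᵢ₋₁ aᵢ aᵢ₋₁ ⋯ a₁` of the `c`-sorting word `a₁ a₂ ⋯ aₖ` for `w`. -/
noncomputable def nc (a : List B) (w : W) : W :=
  ((cs.leftInvSeq (sortingWord cs a w)).filter (fun t => decide (IsCoverReflection cs w t))).prod

/-- `l` is a `T`-word for `x`: a list of reflections with product `x`. -/
def IsTWord (x : W) (l : List W) : Prop := (∀ t ∈ l, cs.IsReflection t) ∧ l.prod = x

/-- A reduced `T`-word for `x`: one of minimal length. -/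
def IsReducedTWord (x : W) (l : List W) : Prop :=
  IsTWord cs x l ∧ ∀ l' : List W, IsTWord cs x l' → l.length ≤ l'.length

/-- The absolute length of `x`: the minimal length of a `T`-word for `x`. -/
noncomputable def absLength (x : W) : ℕ := sInf {n | ∃ l : List W, IsTWord cs x l ∧ l.length = n}

/-- The absolute order: `x ≤_T y` if some reduced `T`-word for `x` is a prefix of some reduced
`T`-word for `y`. -/
def AbsLE (x y : W) : Prop :=
  ∃ l l' : List W, IsReducedTWord cs x l ∧ IsReducedTWord cs y (l ++ l')

/-- The noncrossing partitions with respect to `c`: the interval `[1, c]_T`. -/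
def noncrossingPartitions (c : W) : Set W := {x | AbsLE cs 1 x ∧ AbsLE cs x c}

end CoxeterSortable

set_option linter.unusedSectionVars false

namespace CoxeterSortable

open Module Real Polynomial.Chebyshev

variable {B W : Type*} [Group W] {M : CoxeterMatrix B} (cs : CoxeterSystem M W)

/-! ### The geometric representation -/

section Geometry

variable [Fintype B] [DecidableEq B]

/-! Let `W` act on `ℝ^B` by the geometric representation. Every root is nonnegative or nonpositive,
and finiteness of `W` makes the invariant form positive definite. Sortability is replaced by the
recursion `Sorting` on words of distinct letters. The first letter `s` of `s :: a` is either skipped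
for good, leaving `a`, or used, leaving the rotated word `a ++ [s]`. If the letter `r` is skipped
for the first time after the prefix `u`, this skip has the root `u(e r)`. A skip thus adds the root
`e s` in front, and a use applies `s` to all later roots.

The skip reflections, in order, multiply to `c` (`Sorting.prod_skipRefl`). The nonpositive skip
roots are exactly the nonpositive `w(e r)`, hence the negatives of the roots of the cover
reflections (`Sorting.mem_skipRoots_iff`), and the product of the negative skips is `nc`
(`Sorting.prod_filter_leftInvSeq`). The tool behind this is the Euler form `E` of the word. It is a
triangular bilinear form whose symmetrization is the invariant form, and it is carried along by
rotation (`euler_rotate`). It vanishes on a skip root followed by a later one, and on a positive one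
followed by a negative one (`Sorting.euler_eq_zero`). So a negative skip is orthogonal to every
later positive skip, and commuting them gives `c = (positive skips) * nc`. A dimension count in the
style of Carter shows that `c` is no shorter product of reflections (`HasTLength.length_le`). Hence
`nc` lies below `c` and its rank is the number of negative skips, that is, of descents.

Injectivity: triangularity makes the fixed space of `nc` the orthogonal complement of the cover
roots, so `nc` determines their span. This span shows whether the first letter is used, and, if it
is, whether it is a cover reflection. Induction does the rest.

Surjectivity: let `x` lie below the product of `s :: a`. If `x` lies below the product of `a`, skip
`s`. If `s` splits off from `x`, rotate the remaining factor, whose rank is smaller. Otherwise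
rotate `x` itself. Here it is essential that a last letter which is a left descent is a cover
reflection (`Sorting.neg_e_mem_skipRoots`); this follows because the negatives of the inversions lie
in the cone of the skips. Rotation stops: if the root of a factor complementary to `x` never became
the simple root of the first letter, its orbit under `c⁻¹` would stay positive and sum to a nonzero
fixed vector.

Independence: reduced words of `c` differ by commutations of adjacent letters, which only swap
adjacent orthogonal skips. -/

/-- The Gram matrix of the simple roots, normalized so that every root has square length `2`. -/
noncomputable def gram (M : CoxeterMatrix B) : Matrix B B ℝ :=
  .of fun i j => -2 * Real.cos (π / M i j)

/-- The canonical bilinear form of a Coxeter matrix. -/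
noncomputable def form (M : CoxeterMatrix B) : LinearMap.BilinForm ℝ (B → ℝ) :=
  Matrix.toBilin' (gram M)

/-- The simple root of index `i`. -/
def e (i : B) : B → ℝ := Pi.single i 1

theorem e_same (i : B) : e i i = 1 := by simp [e]

theorem e_ne {i j : B} (h : j ≠ i) : e i j = 0 := by simp [e, h]

theorem e_nonneg (i : B) : 0 ≤ e i := by simp [e]

theorem sum_smul_e (x : B → ℝ) : ∑ i, x i • e i = x := by
  ext j
  simp [e, Finset.sum_apply, Pi.single_apply]

theorem form_e_e (i j : B) : form M (e i) (e j) = -2 * Real.cos (π / M i j) := by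
  simp [form, e, Matrix.toBilin'_single, gram]

theorem form_e_self (i : B) : form M (e i) (e i) = 2 := by simp [form_e_e]

theorem form_e_nonpos {i j : B} (h : i ≠ j) : form M (e i) (e j) ≤ 0 := by
  rw [form_e_e]
  have h1 : M i j ≠ 1 := M.off_diagonal i j h
  have : 0 ≤ Real.cos (π / M i j) := by
    apply Real.cos_nonneg_of_mem_Icc
    rcases Nat.eq_zero_or_pos (M i j) with h0 | h0
    · rw [h0]; simp; positivity
    · have h2 : (2 : ℝ) ≤ M i j := by exact_mod_cast (by omega : 2 ≤ M i j)
      constructor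
      · have : 0 ≤ π / M i j := by positivity
        have := Real.pi_pos
        linarith
      · exact div_le_div_of_nonneg_left Real.pi_pos.le (by norm_num) h2
  linarith

theorem form_expand (x y : B → ℝ) :
    form M x y = ∑ i, ∑ j, x i * y j * form M (e i) (e j) := by
  conv_lhs => rw [← sum_smul_e x, ← sum_smul_e y]
  simp only [map_sum, LinearMap.sum_apply, map_smul, LinearMap.smul_apply, smul_eq_mul,
    Finset.mul_sum]
  rw [Finset.sum_comm]
  exact Finset.sum_congr rfl fun i _ => Finset.sum_congr rfl fun j _ => by ring

theorem form_symm (x y : B → ℝ) : form M x y = form M y x := by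
  rw [form_expand x y, form_expand y x, Finset.sum_comm]
  refine Finset.sum_congr rfl fun i _ => Finset.sum_congr rfl fun j _ => ?_
  rw [form_e_e, form_e_e, M.symmetric]
  ring

/-- The reflection in the simple root of index `i`. -/
noncomputable def simpleRefl (M : CoxeterMatrix B) (i : B) : (B → ℝ) ≃ₗ[ℝ] (B → ℝ) :=
  Module.reflection (x := e i) (f := form M (e i)) (form_e_self i)

theorem simpleRefl_apply (i : B) (x : B → ℝ) :
    simpleRefl M i x = x - form M x (e i) • e i := by
  rw [simpleRefl, Module.reflection_apply, form_symm]


/-- Powers of a product of two reflections have coefficients given by Chebyshev polynomials `S` at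
the value `4 cos² θ - 2 = 2 cos 2θ`. With `θ = π / m` the relevant ones vanish, because `S_n(2 cos
2θ) sin 2θ = sin((n + 1) 2θ)`. -/
theorem isLiftable_simpleRefl : M.IsLiftable (simpleRefl M) := by
  intro i j
  rcases eq_or_ne i j with rfl | hij
  · rw [M.diagonal, pow_one]
    ext1 x
    exact Module.involutive_reflection (form_e_self i) x
  rcases Nat.eq_zero_or_pos (M i j) with h0 | h0
  · rw [h0, pow_zero]
  have h1 : M i j ≠ 1 := M.off_diagonal i j hij
  have hpi := Real.pi_pos
  set m := M i j with hm
  have hm0 : (m : ℝ) ≠ 0 := by positivity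
  set θ : ℝ := π / m with hθ
  have hmθ : m * θ = π := by rw [hθ]; field_simp
  have ht : (2 * Real.cos (2 * θ) : ℝ) =
      form M (e i) (e j) * form M (e j) (e i) - 2 := by
    rw [form_symm (e j), form_e_e, ← hm, ← hθ, Real.cos_two_mul]
    ring
  have hS := fun n : ℤ => S_two_mul_real_cos (2 * θ) n
  ext1 z
  have key := Module.reflection_mul_reflection_pow_apply (form_e_self (M := M) i)
    (form_e_self (M := M) j) m z _ ht
  refine key.trans ?_
  change _ = z
  -- For `m = 2` one has `sin 2θ = 0`, so the division below is impossible; the two roots are then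
  -- orthogonal.
  rcases (by omega : m = 2 ∨ 3 ≤ m) with h2 | h3
  · have hc : form M (e i) (e j) = 0 := by
      rw [form_e_e, ← hm, h2]; simp
    have hc' : form M (e j) (e i) = 0 := by rw [form_symm, hc]
    rw [hc, hc'] at ht ⊢
    have ht2 : 2 * Real.cos (2 * θ) = -2 := by linarith
    rw [h2, ht2]
    norm_num
    module
  have hs : Real.sin (2 * θ) ≠ 0 := by
    have h3' : (3 : ℝ) ≤ m := by exact_mod_cast h3
    have hθ0 : 0 < θ := by rw [hθ]; positivity
    refine (Real.sin_pos_of_pos_of_lt_pi (by linarith) ?_).ne'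
    nlinarith
  rcases Nat.even_or_odd' m with ⟨p, hp | hp⟩
  · have hz : (S ℝ ((p : ℤ) - 1)).eval (2 * Real.cos (2 * θ)) = 0 := by
      have := hS (p - 1)
      rw [show (((p - 1 : ℤ) : ℝ) + 1) * (2 * θ) = m * θ by rw [hp]; push_cast; ring, hmθ,
        Real.sin_pi] at this
      exact (mul_eq_zero.1 this).resolve_right hs
    rw [show ((m : ℤ) - 2) / 2 = p - 1 by omega, show ((m : ℤ) - 1) / 2 = p - 1 by omega, hz]
    simp
  · have hz : (S ℝ (p : ℤ)).eval (2 * Real.cos (2 * θ)) +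
        (S ℝ ((p : ℤ) - 1)).eval (2 * Real.cos (2 * θ)) = 0 := by
      have h1 := hS p
      have h2 := hS (p - 1)
      have e1 : (((p : ℤ) : ℝ) + 1) * (2 * θ) = π + θ := by
        rw [← hmθ, hp]; push_cast; ring
      have e2 : (((p - 1 : ℤ) : ℝ) + 1) * (2 * θ) = π - θ := by
        rw [← hmθ, hp]; push_cast; ring
      rw [e1, Real.sin_add] at h1
      rw [e2, Real.sin_sub] at h2
      simp only [Real.sin_pi, Real.cos_pi] at h1 h2
      have : ((S ℝ (p : ℤ)).eval (2 * Real.cos (2 * θ)) +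
        (S ℝ ((p : ℤ) - 1)).eval (2 * Real.cos (2 * θ))) * Real.sin (2 * θ) = 0 := by
        rw [add_mul, h1, h2]; ring
      exact (mul_eq_zero.1 this).resolve_right hs
    rw [show ((m : ℤ) - 2) / 2 = p - 1 by omega, show ((m : ℤ) - 1) / 2 = p by omega,
      show ((m : ℤ) - 3) / 2 = p - 1 by omega, show (m : ℤ) / 2 = p by omega, hz]
    simp

/-- The geometric representation of a Coxeter group. -/
noncomputable def geom : W →* ((B → ℝ) ≃ₗ[ℝ] (B → ℝ)) :=
  cs.lift ⟨simpleRefl M, isLiftable_simpleRefl⟩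

theorem geom_simple (i : B) : geom cs (cs.simple i) = simpleRefl M i :=
  cs.lift_apply_simple isLiftable_simpleRefl i

theorem geom_simple_apply (i : B) (x : B → ℝ) :
    geom cs (cs.simple i) x = x - form M x (e i) • e i := by
  rw [geom_simple, simpleRefl_apply]

theorem geom_mul_apply (u v : W) (x : B → ℝ) : geom cs (u * v) x = geom cs u (geom cs v x) := by
  rw [map_mul]; rfl

theorem geom_one_apply (x : B → ℝ) : geom cs 1 x = x := by
  rw [map_one]; rfl

theorem geom_inv_apply_self (w : W) (x : B → ℝ) : geom cs w⁻¹ (geom cs w x) = x := by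
  rw [← geom_mul_apply, inv_mul_cancel, geom_one_apply]

theorem geom_apply_inv_self (w : W) (x : B → ℝ) : geom cs w (geom cs w⁻¹ x) = x := by
  rw [← geom_mul_apply, mul_inv_cancel, geom_one_apply]

theorem geom_simple_e (i : B) : geom cs (cs.simple i) (e i) = -e i := by
  rw [geom_simple_apply, form_e_self]; module

theorem geom_simple_simple (i : B) (x : B → ℝ) :
    geom cs (cs.simple i) (geom cs (cs.simple i) x) = x := by
  rw [← geom_mul_apply, cs.simple_mul_simple_self, geom_one_apply]

theorem form_simple (i : B) (x y : B → ℝ) :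
    form M (geom cs (cs.simple i) x) (geom cs (cs.simple i) y) = form M x y := by
  simp only [geom_simple_apply, map_sub, LinearMap.sub_apply, map_smul, LinearMap.smul_apply,
    smul_eq_mul, form_e_self, form_symm (e i) y]
  ring

theorem form_geom (w : W) (x y : B → ℝ) :
    form M (geom cs w x) (geom cs w y) = form M x y := by
  induction w using cs.simple_induction_left with
  | one => simp only [geom_one_apply]
  | mul_simple_left w i ih => simp only [geom_mul_apply, form_simple, ih]

/-- Applying one more letter is the recurrence `S_{k+1} = 2 cos θ S_k - S_{k-1}`. -/
theorem geom_alternatingWord (i j : B) (k : ℕ) :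
    geom cs (cs.wordProd (CoxeterSystem.alternatingWord i j k)) (e i) =
      if Even k then
        (S ℝ (k : ℤ)).eval (2 * Real.cos (π / M i j)) • e i +
          (S ℝ ((k : ℤ) - 1)).eval (2 * Real.cos (π / M i j)) • e j
      else
        (S ℝ (k : ℤ)).eval (2 * Real.cos (π / M i j)) • e j +
          (S ℝ ((k : ℤ) - 1)).eval (2 * Real.cos (π / M i j)) • e i := by
  induction k with
  | zero => simp [CoxeterSystem.alternatingWord]
  | succ k ih =>
    rw [CoxeterSystem.alternatingWord_succ', cs.wordProd_cons, geom_mul_apply, ih]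
    have hrec : (S ℝ ((k : ℤ) + 1)).eval (2 * Real.cos (π / M i j)) =
        2 * Real.cos (π / M i j) * (S ℝ (k : ℤ)).eval (2 * Real.cos (π / M i j)) -
          (S ℝ ((k : ℤ) - 1)).eval (2 * Real.cos (π / M i j)) := by
      rw [S_add_one]; simp
    have hij := form_e_e (M := M) i j
    have hji : form M (e j) (e i) = _ := (form_symm _ _).trans hij
    by_cases hk : Even k
    · have hk' : ¬ Even (k + 1) := by simpa [parity_simps] using hk
      simp only [hk, hk', if_true, if_false]
      push_cast
      rw [add_sub_cancel_right, geom_simple_apply, hrec]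
      simp only [map_add, map_smul, LinearMap.add_apply, LinearMap.smul_apply, smul_eq_mul, hij,
        form_e_self]
      module
    · have hk' : Even (k + 1) := by simpa [parity_simps] using hk
      simp only [hk, hk', if_true, if_false]
      push_cast
      rw [add_sub_cancel_right, geom_simple_apply, hrec]
      simp only [map_add, map_smul, LinearMap.add_apply, LinearMap.smul_apply, smul_eq_mul, hji,
        form_e_self]
      module

/-- The value is `sin((k + 1)θ) / sin θ` with `(k + 1)θ ≤ π`. If `M i j = 0`, then `π / 0 = 0` and
the value is `S_k(2) = k + 1`. -/
theorem eval_S_nonneg {i j : B} (hij : i ≠ j) {k : ℤ} (hk0 : -1 ≤ k)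
    (hk : M i j = 0 ∨ k < M i j) : 0 ≤ (S ℝ k).eval (2 * Real.cos (π / M i j)) := by
  have h1 : M i j ≠ 1 := M.off_diagonal i j hij
  have hk0' : (-1 : ℝ) ≤ k := by exact_mod_cast hk0
  rcases Nat.eq_zero_or_pos (M i j) with h0 | h0
  · rw [h0]
    simp only [CharP.cast_eq_zero, div_zero, Real.cos_zero, mul_one]
    rw [S_eval_two]
    linarith
  have h2 : (2 : ℝ) ≤ M i j := by exact_mod_cast (by omega : 2 ≤ M i j)
  have hk' : (k : ℝ) + 1 ≤ M i j := by
    have : k + 1 ≤ (M i j : ℤ) := by omega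
    exact_mod_cast this
  have hpi := Real.pi_pos
  have hθ : 0 < π / M i j := by positivity
  have hs : 0 < Real.sin (π / M i j) := by
    refine Real.sin_pos_of_pos_of_lt_pi hθ ?_
    rw [div_lt_iff₀ (by linarith)]
    nlinarith
  have key := S_two_mul_real_cos (π / M i j) k
  have : 0 ≤ Real.sin ((k + 1) * (π / M i j)) := by
    refine Real.sin_nonneg_of_nonneg_of_le_pi (by nlinarith) ?_
    rw [← mul_div_assoc, div_le_iff₀ (by linarith)]
    nlinarith
  rw [← key] at this
  exact nonneg_of_mul_nonneg_left this hs

theorem exists_geom_alternatingWord {i j : B} (hij : i ≠ j) {k : ℕ}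
    (hk : M i j = 0 ∨ k < M i j) : ∃ a b : ℝ, 0 ≤ a ∧ 0 ≤ b ∧
      geom cs (cs.wordProd (CoxeterSystem.alternatingWord i j k)) (e i) = a • e i + b • e j := by
  have h1 : 0 ≤ (S ℝ (k : ℤ)).eval (2 * Real.cos (π / M i j)) :=
    eval_S_nonneg hij (by omega) (by omega)
  have h2 : 0 ≤ (S ℝ ((k : ℤ) - 1)).eval (2 * Real.cos (π / M i j)) :=
    eval_S_nonneg hij (by omega) (by omega)
  rw [geom_alternatingWord]
  split_ifs
  · exact ⟨_, _, h1, h2, rfl⟩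
  · exact ⟨_, _, h2, h1, add_comm _ _⟩

/-- Split off from `w` the longest possible alternating suffix in `i` and a right descent `j`. The
remaining prefix `v` is shorter and has neither `i` nor `j` as a descent, so by induction it keeps
both simple roots nonnegative; the suffix sends `e i` to a nonnegative combination of the two. -/
theorem geom_e_nonneg_of_not_isRightDescent {w : W} {i : B} (h : ¬ cs.IsRightDescent w i) :
    0 ≤ geom cs w (e i) := by
  induction hn : cs.length w using Nat.strong_induction_on generalizing w i with
  | _ n ih =>
  by_cases hw : w = 1
  · rw [hw, geom_one_apply]; exact e_nonneg i
  obtain ⟨j, hj⟩ := cs.exists_rightDescent_of_ne_one hw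
  have hij : i ≠ j := by rintro rfl; exact h hj
  let P : ℕ → Prop := fun k =>
    ∃ v, w = v * cs.wordProd (CoxeterSystem.alternatingWord i j k) ∧ cs.length w = cs.length v + k
  have hP1 : P 1 := by
    refine ⟨w * cs.simple j, ?_, ?_⟩
    · simp [CoxeterSystem.alternatingWord]
    · rw [cs.isRightDescent_iff] at hj; omega
  classical
  have hb : ∀ k, P k → k ≤ n := by rintro k ⟨v, -, h2⟩; omega
  have hk1 := Nat.le_findGreatest (hb 1 hP1) hP1
  have hPk : P (Nat.findGreatest P n) := Nat.findGreatest_spec (hb 1 hP1) hP1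
  have hmax : ¬ P (Nat.findGreatest P n + 1) := fun hP => by
    have := Nat.le_findGreatest (hb _ hP) hP
    omega
  generalize Nat.findGreatest P n = k at hk1 hPk hmax
  obtain ⟨v, hv, hlv⟩ := hPk
  -- A longer suffix would not be reduced, and one of length exactly `M i j` could be rewritten by
  -- the braid relation to end in `i`, making `i` a descent.
  have hkM : M i j = 0 ∨ k < M i j := by
    by_contra! hcon
    obtain ⟨hM0, hMk⟩ := hcon
    rcases hMk.lt_or_eq with hlt | heq
    · have h1 := cs.length_mul_le v (cs.wordProd (CoxeterSystem.alternatingWord i j k))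
      rw [← hv] at h1
      have h2 := cs.length_wordProd_le (CoxeterSystem.alternatingWord i j k)
      have h3 := cs.not_isReduced_alternatingWord i j hM0 hlt
      rw [CoxeterSystem.IsReduced] at h3
      rw [CoxeterSystem.length_alternatingWord] at h2 h3
      omega
    · apply h
      have hbr : cs.wordProd (CoxeterSystem.alternatingWord i j k) =
          cs.wordProd (CoxeterSystem.alternatingWord j i k) := by
        have := cs.wordProd_braidWord_eq i j
        rw [CoxeterSystem.braidWord, CoxeterSystem.braidWord, M.symmetric j i, heq] at this
        exact this
      obtain ⟨l, rfl⟩ : ∃ l, k = l + 1 := ⟨k - 1, by omega⟩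
      have hw' : w * cs.simple i = v * cs.wordProd (CoxeterSystem.alternatingWord i j l) := by
        rw [hv, hbr, CoxeterSystem.alternatingWord_succ, cs.wordProd_concat, mul_assoc, mul_assoc,
          cs.simple_mul_simple_self, mul_one]
      rw [CoxeterSystem.IsRightDescent, hw']
      have h1 := cs.length_mul_le v (cs.wordProd (CoxeterSystem.alternatingWord i j l))
      have h2 := cs.length_wordProd_le (CoxeterSystem.alternatingWord i j l)
      rw [CoxeterSystem.length_alternatingWord] at h2
      omega
  have hnext : ¬ cs.IsRightDescent v (if Even k then j else i) := by
    intro hd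
    apply hmax
    refine ⟨v * cs.simple (if Even k then j else i), ?_, ?_⟩
    · rw [CoxeterSystem.alternatingWord_succ', cs.wordProd_cons, mul_assoc,
        cs.simple_mul_simple_cancel_left, hv]
    · rw [cs.isRightDescent_iff] at hd; omega
  have hprev : ¬ cs.IsRightDescent v (if Even k then i else j) := by
    intro hd
    obtain ⟨l, rfl⟩ : ∃ l, k = l + 1 := ⟨k - 1, by omega⟩
    rw [CoxeterSystem.alternatingWord_succ', cs.wordProd_cons] at hv
    have hpar : (if Even (l + 1) then i else j) = if Even l then j else i := by
      by_cases hl : Even l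
      · have : ¬ Even (l + 1) := by simpa [parity_simps] using hl
        simp [hl, this]
      · have : Even (l + 1) := by simpa [parity_simps] using hl
        simp [hl, this]
    rw [hpar, cs.isRightDescent_iff] at hd
    have h1 := cs.length_mul_le (v * cs.simple (if Even l then j else i))
      (cs.wordProd (CoxeterSystem.alternatingWord i j l))
    have h2 := cs.length_wordProd_le (CoxeterSystem.alternatingWord i j l)
    rw [CoxeterSystem.length_alternatingWord] at h2
    rw [mul_assoc, ← hv] at h1
    omega
  have hvi : ¬ cs.IsRightDescent v i ∧ ¬ cs.IsRightDescent v j := by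
    by_cases hk : Even k
    · simp only [hk, if_true] at hnext hprev; exact ⟨hprev, hnext⟩
    · simp only [hk, if_false] at hnext hprev; exact ⟨hnext, hprev⟩
  obtain ⟨a, b, ha, hb', hab⟩ := exists_geom_alternatingWord cs hij hkM
  have hi := ih (cs.length v) (by omega) hvi.1 rfl
  have hj := ih (cs.length v) (by omega) hvi.2 rfl
  rw [hv, geom_mul_apply, hab, map_add, map_smul, map_smul]
  exact add_nonneg (smul_nonneg ha hi) (smul_nonneg hb' hj)

theorem geom_e_ne_zero (w : W) (i : B) : geom cs w (e i) ≠ 0 := by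
  intro h
  have : e i = (0 : B → ℝ) := by rw [← geom_inv_apply_self cs w (e i), h, map_zero]
  have h2 := congrFun this i
  simp [e] at h2

theorem isRightDescent_iff_geom_nonpos {w : W} {i : B} :
    cs.IsRightDescent w i ↔ geom cs w (e i) ≤ 0 := by
  constructor
  · intro h
    have h1 := geom_e_nonneg_of_not_isRightDescent cs
      ((cs.isRightDescent_iff_not_isRightDescent_mul).1 h)
    rw [geom_mul_apply, geom_simple_e, map_neg] at h1
    exact neg_nonneg.1 h1
  · intro h
    by_contra hcon
    exact geom_e_ne_zero cs w i (le_antisymm h (geom_e_nonneg_of_not_isRightDescent cs hcon))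

theorem geom_injective : Function.Injective (geom cs) := by
  rw [injective_iff_map_eq_one]
  intro w hw
  by_contra hne
  obtain ⟨i, hi⟩ := cs.exists_rightDescent_of_ne_one hne
  rw [isRightDescent_iff_geom_nonpos, hw] at hi
  have := hi i
  simp [e] at this
  linarith

end Geometry
end CoxeterSortable

namespace CoxeterSortable

variable {B W : Type*} [Group W] {M : CoxeterMatrix B} (cs : CoxeterSystem M W)

/-! ### Positive definiteness of the form and signs of roots. -/

section Roots

variable [Fintype B] [DecidableEq B]

/-- Averaging the standard inner product over `W` gives an invariant inner product `A`. Invariance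
under a simple reflection forces `A x (e i) = d i * form M x (e i)`, and symmetry makes `d` agree at
any two non-orthogonal simple roots. So the form is `A` after rescaling the simple roots. -/
theorem form_self_pos (cs : CoxeterSystem M W) [Finite W] {x : B → ℝ} (hx : x ≠ 0) : 0 < form M x x := by
  have := Fintype.ofFinite W
  let A : (B → ℝ) → (B → ℝ) → ℝ := fun x y => ∑ w : W, geom cs w x ⬝ᵥ geom cs w y
  have hinv : ∀ i x y, A (geom cs (cs.simple i) x) (geom cs (cs.simple i) y) = A x y := by
    intro i x y
    simp only [A, ← geom_mul_apply]
    exact Fintype.sum_equiv (Equiv.mulRight (cs.simple i)) _ _ fun w => rfl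
  have hadd : ∀ x y z, A (x - y) z = A x z - A y z := by
    intro x y z; simp [A, sub_dotProduct, Finset.sum_sub_distrib]
  have hsmul : ∀ (r : ℝ) x z, A (r • x) z = r * A x z := by
    intro r x z; simp [A, Finset.mul_sum]
  have hcomm : ∀ x y, A x y = A y x := by
    intro x y; simp [A, dotProduct_comm]
  have hpos : ∀ x, x ≠ 0 → 0 < A x x := by
    intro x hx
    refine Finset.sum_pos (fun w _ => ?_) ⟨1, Finset.mem_univ _⟩
    have h0 : geom cs w x ≠ 0 := (LinearEquiv.map_ne_zero_iff _).2 hx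
    have h1 : 0 ≤ geom cs w x ⬝ᵥ geom cs w x :=
      Finset.sum_nonneg fun i _ => mul_self_nonneg _
    exact lt_of_le_of_ne h1 fun h => h0 (dotProduct_self_eq_zero.1 h.symm)
  have hsum : ∀ f : B → ℝ, A (∑ i, f i • e i) (∑ i, f i • e i) =
      ∑ i, ∑ j, f i * f j * A (e i) (e j) := by
    intro f
    have h1 : ∀ (s : Finset B) (g : B → B → ℝ) z, A (∑ i ∈ s, f i • e i) z =
        ∑ i ∈ s, f i * A (e i) z := by
      intro s g z
      induction s using Finset.induction_on with
      | empty => simp [A]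
      | insert i s hi ih =>
        rw [Finset.sum_insert hi, Finset.sum_insert hi, ← ih, ← hsmul]
        have := hadd (f i • e i + ∑ j ∈ s, f j • e j) (∑ j ∈ s, f j • e j) z
        rw [add_sub_cancel_right] at this
        linarith
    rw [h1 _ 0]
    refine Finset.sum_congr rfl fun i _ => ?_
    rw [hcomm, h1 _ 0, Finset.mul_sum]
    refine Finset.sum_congr rfl fun j _ => ?_
    rw [hcomm]; ring
  let d : B → ℝ := fun i => A (e i) (e i) / 2
  have he : ∀ i : B, (e i : B → ℝ) ≠ 0 := fun i h => by simpa [e] using congrFun h i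
  have hd : ∀ i, 0 < d i := fun i => half_pos (hpos _ (he i))
  have hAi : ∀ x i, A x (e i) = d i * form M x (e i) := by
    intro x i
    have h1 := hinv i x (e i)
    rw [geom_simple_e, geom_simple_apply, hadd, hsmul] at h1
    have h2 : ∀ x y, A x (-y) = - A x y := by intro x y; simp [A]
    rw [h2, h2] at h1
    simp only [d]
    linarith
  have hdd : ∀ i j, A (e i) (e j) = Real.sqrt (d i) * Real.sqrt (d j) * form M (e i) (e j) := by
    intro i j
    have h1 := hAi (e i) j
    have h2 := hAi (e j) i
    rw [hcomm, form_symm] at h2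
    rcases eq_or_ne (form M (e i) (e j)) 0 with h0 | h0
    · rw [h1, h0]; ring
    · have hij : d i = d j := by
        have : d j * form M (e i) (e j) = d i * form M (e i) (e j) := by rw [← h1, h2]
        exact (mul_right_cancel₀ h0 this).symm
      rw [h1, hij, Real.mul_self_sqrt (hd j).le]
  let y : B → ℝ := ∑ i, (x i / Real.sqrt (d i)) • e i
  have hs : ∀ i, Real.sqrt (d i) ≠ 0 := fun i => (Real.sqrt_pos.2 (hd i)).ne'
  have hform : form M x x = A y y := by
    rw [hsum, form_expand]
    refine Finset.sum_congr rfl fun i _ => Finset.sum_congr rfl fun j _ => ?_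
    rw [hdd]
    have := hs i
    have := hs j
    field_simp
  rw [hform]
  apply hpos
  intro hy
  apply hx
  ext i
  have h1 : y = fun i => x i / Real.sqrt (d i) := sum_smul_e _
  have h2 := congrFun (h1.symm.trans hy) i
  simpa [hs i] using h2

theorem form_self_eq_zero (cs : CoxeterSystem M W) [Finite W] {x : B → ℝ} (h : form M x x = 0) : x = 0 := by
  by_contra hx
  exact (form_self_pos cs hx).ne' h

theorem form_geom_e_self (w : W) (i : B) : form M (geom cs w (e i)) (geom cs w (e i)) = 2 := by
  rw [form_geom, form_e_self]

/-- The roots: the images of the simple roots under the group. -/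
def IsRoot (x : B → ℝ) : Prop := ∃ (w : W) (i : B), geom cs w (e i) = x

variable {cs}

theorem isRoot_e (i : B) : IsRoot cs (e i) := ⟨1, i, geom_one_apply cs _⟩

theorem IsRoot.geom {x : B → ℝ} (hx : IsRoot cs x) (w : W) : IsRoot cs (geom cs w x) := by
  obtain ⟨v, i, rfl⟩ := hx
  exact ⟨w * v, i, geom_mul_apply cs w v _⟩

theorem IsRoot.neg {x : B → ℝ} (hx : IsRoot cs x) : IsRoot cs (-x) := by
  obtain ⟨v, i, rfl⟩ := hx
  exact ⟨v * cs.simple i, i, by rw [geom_mul_apply, geom_simple_e, map_neg]⟩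

theorem IsRoot.form_self {x : B → ℝ} (hx : IsRoot cs x) : form M x x = 2 := by
  obtain ⟨v, i, rfl⟩ := hx
  exact form_geom_e_self cs v i

theorem IsRoot.ne_zero {x : B → ℝ} (hx : IsRoot cs x) : x ≠ 0 := by
  obtain ⟨v, i, rfl⟩ := hx
  exact geom_e_ne_zero cs v i

theorem IsRoot.nonneg_or_nonpos {x : B → ℝ} (hx : IsRoot cs x) : 0 ≤ x ∨ x ≤ 0 := by
  obtain ⟨w, i, rfl⟩ := hx
  by_cases h : cs.IsRightDescent w i
  · exact Or.inr ((isRightDescent_iff_geom_nonpos cs).1 h)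
  · exact Or.inl (geom_e_nonneg_of_not_isRightDescent cs h)

theorem IsRoot.not_nonneg_iff {x : B → ℝ} (hx : IsRoot cs x) : ¬ 0 ≤ x ↔ x ≤ 0 :=
  ⟨hx.nonneg_or_nonpos.resolve_left, fun h h' => hx.ne_zero (le_antisymm h h')⟩

theorem IsRoot.not_nonpos_iff {x : B → ℝ} (hx : IsRoot cs x) : ¬ x ≤ 0 ↔ 0 ≤ x :=
  ⟨hx.nonneg_or_nonpos.resolve_right, fun h h' => hx.ne_zero (le_antisymm h' h)⟩

theorem geom_simple_apply_ne (cs : CoxeterSystem M W) (i : B) (x : B → ℝ) {j : B} (h : j ≠ i) :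
    CoxeterSortable.geom cs (cs.simple i) x j = x j := by
  rw [geom_simple_apply]
  simp [e_ne h]

/-- A nonnegative root which is a multiple of a simple root is that simple root. -/
theorem IsRoot.eq_e {x : B → ℝ} (hx : IsRoot cs x) (h0 : 0 ≤ x) {i : B}
    (h : ∀ j, j ≠ i → x j = 0) : x = e i := by
  have hxi : x = x i • e i := by
    ext j
    by_cases hj : j = i
    · subst hj; simp [e_same]
    · simp [h j hj, e_ne hj]
  have h2 := hx.form_self
  rw [hxi] at h2
  simp only [map_smul, LinearMap.smul_apply, form_e_self, smul_eq_mul] at h2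
  have h3 : 0 ≤ x i := h0 i
  have : x i = 1 := by nlinarith
  rw [hxi, this, one_smul]

/-- A simple reflection permutes the positive roots other than its own. -/
theorem IsRoot.simple_nonneg {x : B → ℝ} (hx : IsRoot cs x) (h0 : 0 ≤ x) {i : B}
    (h : x ≠ e i) : 0 ≤ CoxeterSortable.geom cs (cs.simple i) x := by
  rw [← (hx.geom _).not_nonpos_iff]
  intro h1
  apply h
  refine hx.eq_e h0 fun j hj => le_antisymm ?_ (h0 j)
  rw [← geom_simple_apply_ne cs i x hj]
  exact h1 j

theorem IsRoot.simple_nonpos {x : B → ℝ} (hx : IsRoot cs x) (h0 : x ≤ 0) {i : B}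
    (h : x ≠ -e i) : CoxeterSortable.geom cs (cs.simple i) x ≤ 0 := by
  have := hx.neg.simple_nonneg (i := i) (neg_nonneg.2 h0) fun h' => h (by rw [← h', neg_neg])
  rw [map_neg] at this
  exact neg_nonneg.1 this

theorem isLeftDescent_iff_geom_inv_nonpos {w : W} {i : B} :
    cs.IsLeftDescent w i ↔ CoxeterSortable.geom cs w⁻¹ (e i) ≤ 0 := by
  rw [← cs.isRightDescent_inv_iff, isRightDescent_iff_geom_nonpos]

theorem not_isLeftDescent_iff_geom_inv_nonneg {w : W} {i : B} :
    ¬ cs.IsLeftDescent w i ↔ 0 ≤ CoxeterSortable.geom cs w⁻¹ (e i) := by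
  rw [isLeftDescent_iff_geom_inv_nonpos, ((isRoot_e i).geom _).not_nonpos_iff]

/-- The reflection in a root. -/
theorem geom_conj_simple (w : W) (i : B) (x : B → ℝ) :
    CoxeterSortable.geom cs (w * cs.simple i * w⁻¹) x =
      x - form M x (CoxeterSortable.geom cs w (e i)) • CoxeterSortable.geom cs w (e i) := by
  rw [geom_mul_apply, geom_mul_apply, geom_simple_apply, map_sub, map_smul, geom_apply_inv_self]
  congr 2
  rw [← form_geom cs w, geom_apply_inv_self]

theorem conj_simple_eq_of_geom_eq {v w : W} {i j : B}
    (h : CoxeterSortable.geom cs v (e i) = CoxeterSortable.geom cs w (e j)) :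
    v * cs.simple i * v⁻¹ = w * cs.simple j * w⁻¹ := by
  apply geom_injective cs
  ext1 x
  rw [geom_conj_simple, geom_conj_simple, h]

theorem geom_eq_or_eq_neg_of_conj_simple_eq {v w : W} {i j : B}
    (h : v * cs.simple i * v⁻¹ = w * cs.simple j * w⁻¹) :
    CoxeterSortable.geom cs v (e i) = CoxeterSortable.geom cs w (e j) ∨
      CoxeterSortable.geom cs v (e i) = -CoxeterSortable.geom cs w (e j) := by
  set x := CoxeterSortable.geom cs v (e i) with hx
  set y := CoxeterSortable.geom cs w (e j) with hy
  have h1 : CoxeterSortable.geom cs (v * cs.simple i * v⁻¹) x = -x := by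
    rw [geom_conj_simple, ← hx, hx, form_geom_e_self]; module
  rw [h, geom_conj_simple, ← hy] at h1
  have h2 : (2 : ℝ) • x = form M x y • y := by
    have : (2 : ℝ) • x = x - -x := by module
    rw [this, ← h1]; module
  have h3 : form M x y * form M x y = 4 := by
    have := congrArg (fun z => form M z x) h2
    simp only [map_smul, LinearMap.smul_apply, smul_eq_mul] at this
    rw [form_symm y x, hx, form_geom_e_self, ← hx] at this
    linarith
  have h4 : form M x y = 2 ∨ form M x y = -2 := by
    have : (form M x y - 2) * (form M x y + 2) = 0 := by linarith
    rcases mul_eq_zero.1 this with h | h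
    · left; linarith
    · right; linarith
  rcases h4 with h4 | h4
  · left
    rw [h4] at h2
    exact smul_right_injective _ (two_ne_zero (α := ℝ)) h2
  · right
    rw [h4] at h2
    apply smul_right_injective _ (two_ne_zero (α := ℝ))
    change (2 : ℝ) • x = (2 : ℝ) • -y
    rw [h2]; module

theorem mul_simple_comm_of_form_eq_zero {i j : B} (h : form M (e i) (e j) = 0) :
    cs.simple i * cs.simple j = cs.simple j * cs.simple i := by
  have h1 : CoxeterSortable.geom cs (cs.simple i) (e j) = e j := by
    rw [geom_simple_apply, form_symm, h]; module
  have := conj_simple_eq_of_geom_eq (cs := cs) (v := cs.simple i) (w := 1) (i := j) (j := j)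
    (by rw [h1, geom_one_apply])
  simp only [cs.inv_simple, one_mul, inv_one, mul_one] at this
  conv_rhs => rw [← this]
  simp [mul_assoc]

/-- The coordinates outside the letters of a word are unchanged by the word. -/
theorem geom_wordProd_apply_of_notMem {ω : List B} {j : B} (h : j ∉ ω) (x : B → ℝ) :
    CoxeterSortable.geom cs (cs.wordProd ω) x j = x j := by
  induction ω with
  | nil => rw [cs.wordProd_nil, geom_one_apply]
  | cons i ω ih =>
    rw [List.mem_cons, not_or] at h
    rw [cs.wordProd_cons, geom_mul_apply, geom_simple_apply_ne cs i _ h.1, ih h.2]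

theorem geom_wordProd_inv_apply_of_notMem {ω : List B} {j : B} (h : j ∉ ω) (x : B → ℝ) :
    CoxeterSortable.geom cs (cs.wordProd ω)⁻¹ x j = x j := by
  rw [← cs.wordProd_reverse]
  exact geom_wordProd_apply_of_notMem (by simpa using h) x

/-- The letters of `ω` leave coordinate `j` equal to `1`, and one positive coordinate decides the
sign of a root. -/
theorem geom_wordProd_e_nonneg {ω : List B} {j : B} (h : j ∉ ω) :
    0 ≤ CoxeterSortable.geom cs (cs.wordProd ω) (e j) := by
  rw [← ((isRoot_e j).geom _).not_nonpos_iff]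
  intro h0
  have := h0 j
  rw [geom_wordProd_apply_of_notMem h, e_same] at this
  simp at this
  linarith

theorem not_isLeftDescent_of_notMem {ω : List B} {j : B} (h : j ∉ ω) :
    ¬ cs.IsLeftDescent (cs.wordProd ω) j := by
  rw [not_isLeftDescent_iff_geom_inv_nonneg, ← cs.wordProd_reverse]
  exact geom_wordProd_e_nonneg (by simpa using h)

theorem mem_of_isRightDescent {ω : List B} {j : B} (h : cs.IsRightDescent (cs.wordProd ω) j) :
    j ∈ ω := by
  by_contra hj
  rw [isRightDescent_iff_geom_nonpos] at h
  exact (((isRoot_e j).geom _).not_nonneg_iff.2 h) (geom_wordProd_e_nonneg hj)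

/-- The letters of a reduced word occur in every word for the same element. -/
theorem _root_.CoxeterSystem.IsReduced.subset {ω ω' : List B} (hω : cs.IsReduced ω)
    (h : cs.wordProd ω = cs.wordProd ω') : ω ⊆ ω' := by
  induction ω using List.reverseRecOn generalizing ω' with
  | nil => simp
  | append_singleton ω i ih =>
    have hdesc : cs.IsRightDescent (cs.wordProd (ω ++ [i])) i := by
      rw [CoxeterSystem.IsRightDescent, hω.eq, cs.wordProd_append, cs.wordProd_singleton,
        cs.simple_mul_simple_cancel_right]
      have := cs.length_wordProd_le ω
      simp; omega
    have hi : i ∈ ω' := by rw [h] at hdesc; exact mem_of_isRightDescent hdesc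
    have hω' : cs.IsReduced ω := by simpa using hω.take ω.length
    have h2 := ih hω' (ω' := ω' ++ [i]) (by
      rw [cs.wordProd_append, ← h, cs.wordProd_append, cs.wordProd_singleton,
        cs.simple_mul_simple_cancel_right])
    intro j hj
    rw [List.mem_append, List.mem_singleton] at hj
    rcases hj with hj | rfl
    · have := h2 hj
      rw [List.mem_append, List.mem_singleton] at this
      rcases this with h | rfl
      · exact h
      · exact hi
    · exact hi

end Roots
end CoxeterSortable

namespace CoxeterSortable

variable {B W : Type*} [Group W] {M : CoxeterMatrix B} (cs : CoxeterSystem M W)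

/-! ### The Euler form of a word -/

section Euler

variable [Fintype B] [DecidableEq B]

/-- The vectors supported in the letters of a word. -/
def supp (a : List B) : Submodule ℝ (B → ℝ) where
  carrier := {x | ∀ j, j ∉ a → x j = 0}
  zero_mem' := fun _ _ => rfl
  add_mem' := fun hx hy j hj => by simp [hx j hj, hy j hj]
  smul_mem' := fun r _ hx j hj => by simp [hx j hj]

theorem mem_supp {a : List B} {x : B → ℝ} : x ∈ supp a ↔ ∀ j, j ∉ a → x j = 0 := Iff.rfl

theorem e_mem_supp {a : List B} {i : B} (h : i ∈ a) : e i ∈ supp a := fun _ hj =>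
  e_ne fun hji => hj (hji ▸ h)

theorem supp_mono {a b : List B} (h : a ⊆ b) : supp a ≤ supp b :=
  fun _ hx j hj => hx j fun hj' => hj (h hj')

theorem mem_supp_append_singleton {a : List B} {s : B} {x : B → ℝ} :
    x ∈ supp (a ++ [s]) ↔ x ∈ supp (s :: a) := by
  simp [mem_supp, or_comm]

theorem geom_simple_mem_supp {a : List B} {s : B} (h : s ∈ a) {x : B → ℝ} (hx : x ∈ supp a) :
    geom cs (cs.simple s) x ∈ supp a := by
  rw [geom_simple_apply]
  exact sub_mem hx (Submodule.smul_mem _ _ (e_mem_supp h))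

theorem geom_wordProd_mem_supp {a ω : List B} (h : ω ⊆ a) {x : B → ℝ} (hx : x ∈ supp a) :
    geom cs (cs.wordProd ω) x ∈ supp a := by
  induction ω with
  | nil => rwa [cs.wordProd_nil, geom_one_apply]
  | cons i ω ih =>
    rw [List.cons_subset] at h
    rw [cs.wordProd_cons, geom_mul_apply]
    exact geom_simple_mem_supp cs h.1 (ih h.2)

theorem sub_smul_e_mem_supp {a : List B} {s : B} {x : B → ℝ} (hx : x ∈ supp (s :: a)) :
    x - x s • e s ∈ supp a := by
  intro j hj
  by_cases hjs : j = s
  · subst hjs; simp [e_same]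
  · simp [e_ne hjs, hx j (by simp [hj, hjs])]

/-- The form of a nonnegative vector with a simple root outside its support. -/
theorem form_e_nonpos_of_nonneg {x : B → ℝ} (hx : 0 ≤ x) {s : B} (hs : x s = 0) :
    form M x (e s) ≤ 0 := by
  conv_lhs => rw [← sum_smul_e x]
  simp only [map_sum, LinearMap.sum_apply, map_smul, LinearMap.smul_apply, smul_eq_mul]
  refine Finset.sum_nonpos fun i _ => ?_
  by_cases h : i = s
  · subst h; simp [hs]
  · exact mul_nonpos_of_nonneg_of_nonpos (hx i) (form_e_nonpos h)

/-- The Euler form of the word `a`, meaningful for vectors supported in the letters of `a`. -/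
noncomputable def euler (M : CoxeterMatrix B) : List B → LinearMap.BilinForm ℝ (B → ℝ)
  | [] => 0
  | s :: a => ((form M).flip (e s) - LinearMap.proj s).smulRight (LinearMap.proj s) +
      (euler M a) ∘ₗ (LinearMap.id - (LinearMap.proj s).smulRight (e s))

/-- For distinct letters the form is triangular on simple roots: `E(e i, e j)` is `1` if `i = j`,
`0` if `i` precedes `j` in the word, and `form M (e i) (e j)` if `i` follows `j`. Hence pairing with
the first letter on the left, or with the last one on the right, reads off a coordinate. -/
theorem euler_cons (s : B) (a : List B) (x y : B → ℝ) :
    euler M (s :: a) x y = (form M x (e s) - x s) * y s + euler M a (x - x s • e s) y := by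
  simp [euler]

theorem euler_congr_right {a : List B} (x : B → ℝ) {y z : B → ℝ} (h : ∀ j ∈ a, y j = z j) :
    euler M a x y = euler M a x z := by
  induction a generalizing x with
  | nil => rfl
  | cons s a ih =>
    rw [euler_cons, euler_cons, ih _ fun j hj => h j (List.mem_cons_of_mem _ hj),
      h s List.mem_cons_self]

theorem euler_cons_e (s : B) (a : List B) (y : B → ℝ) : euler M (s :: a) (e s) y = y s := by
  rw [euler_cons, form_e_self, e_same]
  simp
  ring

theorem euler_cons_of_mem {s : B} {a : List B} (hs : s ∉ a) {x y : B → ℝ} (hx : x ∈ supp a)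
    (hy : y ∈ supp a) : euler M (s :: a) x y = euler M a x y := by
  rw [euler_cons, hx s hs, hy s hs]
  simp

theorem euler_add_euler {a : List B} (ha : a.Nodup) {x y : B → ℝ} (hx : x ∈ supp a)
    (hy : y ∈ supp a) : euler M a x y + euler M a y x = form M x y := by
  induction a generalizing x y with
  | nil =>
    have : x = 0 := by ext j; exact hx j (by simp)
    simp [this, euler]
  | cons s a ih =>
    rw [List.nodup_cons] at ha
    have h : ∀ z : B → ℝ, ∀ j ∈ a, z j = (z - z s • e s) j := by
      intro z j hj
      have : j ≠ s := fun h => ha.1 (h ▸ hj)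
      simp [e_ne this]
    have h1 := ih ha.2 (sub_smul_e_mem_supp hx) (sub_smul_e_mem_supp hy)
    rw [euler_cons, euler_cons, euler_congr_right _ (h x), euler_congr_right _ (h y)]
    simp only [map_sub, LinearMap.sub_apply, map_smul, LinearMap.smul_apply, smul_eq_mul,
      form_e_self] at h1 ⊢
    rw [form_symm (e s) y] at h1
    linarith

theorem euler_self {a : List B} (ha : a.Nodup) {x : B → ℝ} (hx : x ∈ supp a) :
    euler M a x x = form M x x / 2 := by
  have := euler_add_euler (M := M) ha hx hx
  linarith

theorem euler_append_e {a : List B} {s : B} (hs : s ∉ a) {x : B → ℝ}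
    (hx : x ∈ supp (a ++ [s])) : euler M (a ++ [s]) x (e s) = x s := by
  induction a generalizing x with
  | nil =>
    have : x = x s • e s := by
      ext j
      by_cases h : j = s
      · subst h; simp [e_same]
      · simp [e_ne h, hx j (by simpa using h)]
    rw [List.nil_append, this, map_smul, LinearMap.smul_apply, euler_cons_e]
    simp
  | cons t a ih =>
    simp only [List.mem_cons, not_or] at hs
    rw [List.cons_append, euler_cons, ih hs.2 (sub_smul_e_mem_supp hx), e_ne (Ne.symm hs.1)]
    simp [e_ne hs.1]

theorem euler_append_of_mem {a : List B} {s : B} {x : B → ℝ} (hx : x ∈ supp a) (y : B → ℝ) :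
    euler M (a ++ [s]) x y = euler M a x y := by
  induction a generalizing x with
  | nil =>
    have : x = 0 := by ext j; exact hx j (by simp)
    simp [this]
  | cons t a ih =>
    rw [List.cons_append, euler_cons, euler_cons, ih (sub_smul_e_mem_supp hx)]

theorem nodup_append_singleton {a : List B} {s : B} : (a ++ [s]).Nodup ↔ (s :: a).Nodup :=
  (List.perm_append_singleton s a).nodup_iff

/-- Split `s x` into its part off `s`, on which both Euler forms reduce to that of `a`, and a
multiple of `e s`. For that multiple, symmetrization turns the pairing from the left with the last
letter `s` into one from the right, which reads off a coordinate. -/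
theorem euler_rotate {a : List B} {s : B} (ha : (s :: a).Nodup) {x y : B → ℝ}
    (hx : x ∈ supp (s :: a)) (hy : y ∈ supp (s :: a)) :
    euler M (a ++ [s]) (geom cs (cs.simple s) x) (geom cs (cs.simple s) y) =
      euler M (s :: a) x y := by
  have hs := (List.nodup_cons.1 ha).1
  have ha' := nodup_append_singleton.2 ha
  have hmem := List.mem_append_right a (List.mem_singleton_self s)
  have hsy := mem_supp_append_singleton.2 (geom_simple_mem_supp cs (List.mem_cons_self) hy)
  have h1 : geom cs (cs.simple s) x = (x - x s • e s) + (x s - form M x (e s)) • e s := by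
    rw [geom_simple_apply]; module
  have h2 := euler_add_euler (M := M) ha' (e_mem_supp hmem) hsy
  rw [euler_append_e hs hsy] at h2
  have h3 : euler M (a ++ [s]) (x - x s • e s) (geom cs (cs.simple s) y) =
      euler M a (x - x s • e s) y := by
    rw [euler_append_of_mem (sub_smul_e_mem_supp hx)]
    refine euler_congr_right _ fun j hj => geom_simple_apply_ne cs s y ?_
    rintro rfl; exact hs hj
  rw [h1, map_add, LinearMap.add_apply, h3, map_smul, LinearMap.smul_apply, smul_eq_mul,
    euler_cons]
  rw [geom_simple_apply] at h2 ⊢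
  simp only [map_sub, LinearMap.sub_apply, map_smul, LinearMap.smul_apply, smul_eq_mul,
    form_e_self, Pi.sub_apply, Pi.smul_apply, e_same, form_symm (e s) y] at h2 ⊢
  linear_combination (x s - form M x (e s)) * h2

end Euler

/-! ### Sorting words and their skips -/

/-- Multiply the prefix of a skip by a simple reflection. -/
def shift (s : B) (p : W × B) : W × B := (cs.simple s * p.1, p.2)

/-- `Sorting cs a ω L` says that the product of `ω` is sortable with respect to the word `a` of
distinct letters, that `ω` is its sorting word, and that `L` lists the letters of `a` in the order
in which they are skipped for the first time, each with the prefix of `ω` at that time. -/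
inductive Sorting : List B → List B → List (W × B) → Prop
  | nil : Sorting [] [] []
  | skip {s : B} {a ω : List B} {L : List (W × B)} : Sorting a ω L → Sorting (s :: a) ω ((1, s) :: L)
  | use {s : B} {a ω : List B} {L : List (W × B)} : Sorting (a ++ [s]) ω L →
      ¬ cs.IsLeftDescent (cs.wordProd ω) s → Sorting (s :: a) (s :: ω) (L.map (shift cs s))

/-- The reflection of a skip. -/
def skipRefl (p : W × B) : W := p.1 * cs.simple p.2 * p.1⁻¹

theorem skipRefl_shift (s : B) (p : W × B) :
    skipRefl cs (shift cs s p) = cs.simple s * skipRefl cs p * cs.simple s := by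
  simp [skipRefl, shift, mul_assoc]

theorem isReflection_skipRefl (p : W × B) : cs.IsReflection (skipRefl cs p) := ⟨p.1, p.2, rfl⟩

theorem prod_map_conj (s : B) (l : List W) :
    (l.map fun t => cs.simple s * t * cs.simple s).prod = cs.simple s * l.prod * cs.simple s := by
  induction l with
  | nil => simp
  | cons t l ih =>
    rw [List.map_cons, List.prod_cons, List.prod_cons, ih]
    simp [mul_assoc]

variable {cs}

theorem Sorting.subset {a ω : List B} {L : List (W × B)} (h : Sorting cs a ω L) : ω ⊆ a := by
  induction h with
  | nil => simp
  | skip _ ih => exact fun j hj => List.mem_cons_of_mem _ (ih hj)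
  | use _ _ ih =>
    intro j hj
    rcases List.mem_cons.1 hj with rfl | hj
    · simp
    · have := ih hj
      simp at this ⊢
      tauto

theorem Sorting.isReduced {a ω : List B} {L : List (W × B)} (h : Sorting cs a ω L) :
    cs.IsReduced ω := by
  induction h with
  | nil => simp [CoxeterSystem.IsReduced]
  | skip _ ih => exact ih
  | use _ hd ih =>
    rw [CoxeterSystem.IsReduced, cs.wordProd_cons, cs.not_isLeftDescent_iff.1 hd, ih.eq]
    simp

theorem Sorting.length_eq {a ω : List B} {L : List (W × B)} (h : Sorting cs a ω L) :
    L.length = a.length := by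
  induction h with
  | nil => rfl
  | skip _ ih => simp [ih]
  | use _ hd ih => simpa using ih

/-- A use of `s` conjugates all skip reflections by `s`, which turns the product of `a ++ [s]` into
that of `s :: a`. -/
theorem Sorting.prod_skipRefl {a ω : List B} {L : List (W × B)} (h : Sorting cs a ω L) :
    (L.map (skipRefl cs)).prod = cs.wordProd a := by
  induction h with
  | nil => simp
  | skip _ ih => simp [ih, skipRefl, cs.wordProd_cons]
  | @use s a ω L _ hd ih =>
    have : skipRefl cs ∘ shift cs s =
        (fun t => cs.simple s * t * cs.simple s) ∘ skipRefl cs := by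
      ext p; exact skipRefl_shift cs s p
    rw [List.map_map, this, ← List.map_map, prod_map_conj, ih, cs.wordProd_append,
      cs.wordProd_singleton, cs.wordProd_cons]
    simp [mul_assoc]

theorem Sorting.exists_mem {a ω : List B} {L : List (W × B)} (h : Sorting cs a ω L) {r : B}
    (hr : r ∈ a) : ∃ u, (u, r) ∈ L := by
  induction h with
  | nil => simp at hr
  | @skip s a ω L _ ih =>
    rcases List.mem_cons.1 hr with rfl | hr
    · exact ⟨1, by simp⟩
    · obtain ⟨u, hu⟩ := ih hr
      exact ⟨u, by simp [hu]⟩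
  | @use s a ω L _ hd ih =>
    obtain ⟨u, hu⟩ := ih (by simp at hr ⊢; tauto)
    exact ⟨cs.simple s * u, List.mem_map.2 ⟨_, hu, rfl⟩⟩

/-! ### Skip roots and their triangularity for the Euler form. -/

section Skips

variable [Fintype B] [DecidableEq B]

/-- The root of a skip. -/
noncomputable def skipRoot (cs : CoxeterSystem M W) (p : W × B) : B → ℝ := geom cs p.1 (e p.2)

theorem skipRoot_shift (s : B) (p : W × B) :
    skipRoot cs (shift cs s p) = geom cs (cs.simple s) (skipRoot cs p) :=
  geom_mul_apply cs _ _ _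

theorem skipRoot_one (s : B) : skipRoot cs (1, s) = e s := geom_one_apply cs _

theorem isRoot_skipRoot (p : W × B) : IsRoot cs (skipRoot cs p) := ⟨_, _, rfl⟩

theorem geom_skipRefl (p : W × B) (x : B → ℝ) :
    geom cs (skipRefl cs p) x = x - form M x (skipRoot cs p) • skipRoot cs p :=
  geom_conj_simple p.1 p.2 x

theorem skipRefl_eq_simple {p : W × B} {s : B} (h : skipRoot cs p = e s ∨ skipRoot cs p = -e s) :
    skipRefl cs p = cs.simple s := by
  apply geom_injective cs
  ext1 x
  rw [geom_skipRefl, geom_simple_apply]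
  rcases h with h | h
  · rw [h]
  · rw [h]; simp

theorem Sorting.skipRoot_mem_supp {a ω : List B} {L : List (W × B)} (h : Sorting cs a ω L) :
    ∀ p ∈ L, skipRoot cs p ∈ supp a := by
  induction h with
  | nil => simp
  | @skip s a ω L _ ih =>
    intro p hp
    rcases List.mem_cons.1 hp with rfl | hp
    · rw [skipRoot_one]; exact e_mem_supp List.mem_cons_self
    · exact supp_mono (List.subset_cons_self _ _) (ih p hp)
  | @use s a ω L _ hd ih =>
    intro p hp
    obtain ⟨q, hq, rfl⟩ := List.mem_map.1 hp
    rw [skipRoot_shift]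
    exact geom_simple_mem_supp cs List.mem_cons_self (mem_supp_append_singleton.1 (ih q hq))

/-- The roots of the skips. -/
def skipRoots (cs : CoxeterSystem M W) (L : List (W × B)) : Set (B → ℝ) := {x | ∃ p ∈ L, skipRoot cs p = x}

theorem Sorting.supp_le_span {a ω : List B} {L : List (W × B)} (h : Sorting cs a ω L) :
    supp a ≤ Submodule.span ℝ (skipRoots cs L) := by
  induction h with
  | nil =>
    intro x hx
    have : x = 0 := by ext j; exact hx j (by simp)
    rw [this]; exact zero_mem _
  | @skip s a ω L _ ih =>
    intro x hx
    have h1 := ih (sub_smul_e_mem_supp hx)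
    rw [← sub_add_cancel x (x s • e s)]
    refine add_mem (Submodule.span_mono ?_ h1) (Submodule.smul_mem _ _ (Submodule.subset_span ?_))
    · rintro y ⟨p, hp, rfl⟩; exact ⟨p, List.mem_cons_of_mem _ hp, rfl⟩
    · exact ⟨_, List.mem_cons_self, skipRoot_one s⟩
  | @use s a ω L _ hd ih =>
    intro x hx
    have h1 := ih (mem_supp_append_singleton.2 (geom_simple_mem_supp cs List.mem_cons_self hx))
    have h2 := Submodule.mem_map_of_mem (f := (geom cs (cs.simple s)).toLinearMap) h1
    rw [Submodule.map_span] at h2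
    simp only [LinearEquiv.coe_coe, geom_simple_simple] at h2
    refine Submodule.span_mono ?_ h2
    rintro _ ⟨_, ⟨p, hp, rfl⟩, rfl⟩
    exact ⟨shift cs s p, List.mem_map_of_mem hp, skipRoot_shift s p⟩

/-- At a skip, `E(e s, y)` is the coordinate `y s`, and the later roots are supported off `s`. At a
use, rotation carries the Euler form along. -/
theorem Sorting.pairwise_euler {a ω : List B} {L : List (W × B)} (h : Sorting cs a ω L)
    (ha : a.Nodup) :
    L.Pairwise fun p q => euler M a (skipRoot cs p) (skipRoot cs q) = 0 := by
  induction h with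
  | nil => simp
  | @skip s a ω L h ih =>
    have ha' := List.nodup_cons.1 ha
    rw [List.pairwise_cons]
    constructor
    · intro q hq
      rw [skipRoot_one, euler_cons_e]
      exact h.skipRoot_mem_supp q hq s ha'.1
    · refine (ih ha'.2).imp_of_mem fun {p q} hp hq hpq => ?_
      rw [euler_cons_of_mem ha'.1 (h.skipRoot_mem_supp p hp) (h.skipRoot_mem_supp q hq), hpq]
  | @use s a ω L h hd ih =>
    rw [List.pairwise_map]
    refine (ih (nodup_append_singleton.2 ha)).imp_of_mem fun {p q} hp hq hpq => ?_
    have hm : ∀ q ∈ L, geom cs (cs.simple s) (skipRoot cs q) ∈ supp (s :: a) := fun q hq =>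
      geom_simple_mem_supp cs List.mem_cons_self
        (mem_supp_append_singleton.1 (h.skipRoot_mem_supp q hq))
    rw [skipRoot_shift, skipRoot_shift, ← euler_rotate cs ha (hm p hp) (hm q hq),
      geom_simple_simple, geom_simple_simple, hpq]

/-- A repeated root `β` would have `E(β, β) = 0`, whereas it is half the square length, `1`. -/
theorem Sorting.nodup_skipRoot {a ω : List B} {L : List (W × B)} (h : Sorting cs a ω L)
    (ha : a.Nodup) : (L.map (skipRoot cs)).Nodup := by
  rw [List.Nodup, List.pairwise_map]
  refine (h.pairwise_euler ha).imp_of_mem fun {p q} hp hq hpq heq => ?_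
  rw [← heq, euler_self ha (h.skipRoot_mem_supp p hp), (isRoot_skipRoot p).form_self] at hpq
  norm_num at hpq

end Skips
end CoxeterSortable

namespace CoxeterSortable

variable {B W : Type*} [Group W] {M : CoxeterMatrix B} {cs : CoxeterSystem M W}

/-! ### Signs of skip roots, and cover reflections as negative skips. -/

section SkipSigns

variable [Fintype B] [DecidableEq B]

theorem neg_e_nonpos (s : B) : -e s ≤ 0 := neg_nonpos.2 (e_nonneg s)

theorem not_e_nonpos (s : B) : ¬ e s ≤ 0 := fun h => by
  have := h s
  rw [e_same] at this
  simp at this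
  linarith

/-- Each skip cuts the sorting word into its prefix and a word without the skipped letter; the
prefix preserves the Euler form and the positivity of the inversions of the rest. -/
theorem Sorting.exists_rest {a ω : List B} {L : List (W × B)} (h : Sorting cs a ω L)
    (ha : a.Nodup) {p : W × B} (hp : p ∈ L) : ∃ b ω' : List B, (p.2 :: b).Nodup ∧ ω' ⊆ b ∧
      cs.IsReduced ω' ∧ cs.wordProd ω = p.1 * cs.wordProd ω' ∧
      (∀ x ∈ supp (p.2 :: b), geom cs p.1 x ∈ supp a) ∧
      (∀ x ∈ supp (p.2 :: b), ∀ y ∈ supp (p.2 :: b),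
        euler M a (geom cs p.1 x) (geom cs p.1 y) = euler M (p.2 :: b) x y) ∧
      ∀ γ, IsRoot cs γ → 0 ≤ γ → geom cs (cs.wordProd ω')⁻¹ γ ≤ 0 → 0 ≤ geom cs p.1 γ := by
  induction h generalizing p with
  | nil => simp at hp
  | @skip s a ω L h ih =>
    have ha' := List.nodup_cons.1 ha
    rcases List.mem_cons.1 hp with rfl | hp
    · refine ⟨a, ω, ha, h.subset, h.isReduced, (one_mul _).symm, ?_, ?_, ?_⟩
      · intro x hx; rwa [geom_one_apply]
      · intro x _ y _; rw [geom_one_apply, geom_one_apply]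
      · intro γ _ h0 _; rwa [geom_one_apply]
    · obtain ⟨b, ω', h1, h2, h3, h4, h5, h6, h7⟩ := ih ha'.2 hp
      refine ⟨b, ω', h1, h2, h3, h4, fun x hx => supp_mono (List.subset_cons_self _ _) (h5 x hx),
        fun x hx y hy => ?_, h7⟩
      rw [euler_cons_of_mem ha'.1 (h5 x hx) (h5 y hy), h6 x hx y hy]
  | @use s a ω L h hd ih =>
    obtain ⟨q, hq, rfl⟩ := List.mem_map.1 hp
    obtain ⟨b, ω', h1, h2, h3, h4, h5, h6, h7⟩ := ih (nodup_append_singleton.2 ha) hq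
    have hm : ∀ x ∈ supp (q.2 :: b), geom cs (shift cs s q).1 x ∈ supp (s :: a) := fun x hx => by
      rw [shift, geom_mul_apply]
      exact geom_simple_mem_supp cs List.mem_cons_self (mem_supp_append_singleton.1 (h5 x hx))
    refine ⟨b, ω', h1, h2, h3, ?_, hm, ?_, ?_⟩
    · rw [cs.wordProd_cons, h4, shift, mul_assoc]
    · intro x hx y hy
      rw [← euler_rotate cs ha (hm x hx) (hm y hy), shift, geom_mul_apply, geom_mul_apply,
        geom_simple_simple, geom_simple_simple]
      exact h6 x hx y hy
    · intro γ hγ h0 hinv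
      rw [shift, geom_mul_apply]
      -- The simple reflection could only spoil positivity if the earlier prefix took `γ` to `e s`;
      -- as `γ` is an inversion of the rest, `s` would then be a left descent.
      refine (hγ.geom _).simple_nonneg (h7 γ hγ h0 hinv) fun heq => hd ?_
      rw [isLeftDescent_iff_geom_inv_nonpos, h4, ← heq, mul_inv_rev, geom_mul_apply,
        geom_inv_apply_self]
      exact hinv

/-- With `ω = b₁ ⋯ bₖ`, the difference `ω(e r) - e r` is the sum of the inversion roots `b₁ ⋯ bᵢ₋₁(e
bᵢ)` with coefficients `-form M (e r) (e bᵢ)`. These are nonnegative since `r` is not a letter, and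
`u` keeps inversions positive. -/
theorem geom_sub_nonneg {ω : List B} (hω : cs.IsReduced ω) {r : B} (hr : r ∉ ω) {u : W}
    (hu : ∀ γ, IsRoot cs γ → 0 ≤ γ → geom cs (cs.wordProd ω)⁻¹ γ ≤ 0 → 0 ≤ geom cs u γ) :
    0 ≤ geom cs u (geom cs (cs.wordProd ω) (e r) - e r) := by
  induction ω generalizing u with
  | nil => simp
  | cons b ω ih =>
    simp only [List.mem_cons, not_or] at hr
    have hω' : cs.IsReduced ω := by simpa using hω.drop 1
    have hb : 0 ≤ geom cs (cs.wordProd ω)⁻¹ (e b) := by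
      rw [← not_isLeftDescent_iff_geom_inv_nonneg, cs.not_isLeftDescent_iff, ← cs.wordProd_cons,
        hω.eq, hω'.eq, List.length_cons]
    have h1 := ih hω' hr.2 (u := u * cs.simple b) fun γ hγ h0 hinv => by
      rw [geom_mul_apply]
      refine hu _ (hγ.geom _) (hγ.simple_nonneg h0 ?_) ?_
      · rintro rfl
        exact (hγ.geom _).ne_zero (le_antisymm hinv hb)
      · rwa [cs.wordProd_cons, mul_inv_rev, geom_mul_apply, cs.inv_simple, geom_simple_simple]
    have h2 : 0 ≤ geom cs u (e b) := by
      refine hu _ (isRoot_e b) (e_nonneg b) ?_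
      rw [cs.wordProd_cons, mul_inv_rev, geom_mul_apply, cs.inv_simple, geom_simple_e, map_neg]
      exact neg_nonpos.2 hb
    have h3 : geom cs (cs.wordProd (b :: ω)) (e r) - e r =
        geom cs (cs.simple b) (geom cs (cs.wordProd ω) (e r) - e r) +
          (-form M (e r) (e b)) • e b := by
      rw [cs.wordProd_cons, geom_mul_apply, map_sub, geom_simple_apply cs b (e r)]
      module
    rw [h3, map_add, map_smul, ← geom_mul_apply]
    exact add_nonneg h1 (smul_nonneg (neg_nonneg.2 (form_e_nonpos hr.1)) h2)

/-- If `s` is the last letter and is not a left descent, then the simple root of `s` is a skip if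
and only if the sorting word takes some simple root to it. -/
theorem Sorting.e_mem_skipRoots_iff [Finite W] {a ω : List B} {s : B} {L : List (W × B)}
    (h : Sorting cs (a ++ [s]) ω L) (ha : (s :: a).Nodup)
    (hd : ¬ cs.IsLeftDescent (cs.wordProd ω) s) :
    e s ∈ skipRoots cs L ↔ ∃ r, geom cs (cs.wordProd ω) (e r) = e s := by
  have ha' := nodup_append_singleton.2 ha
  have hs := (List.nodup_cons.1 ha).1
  constructor
  · rintro ⟨p, hp, hps⟩
    obtain ⟨b, ω', h1, h2, h3, h4, h5, h6, h7⟩ := h.exists_rest ha' hp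
    have hrb := (List.nodup_cons.1 h1).1
    have hrω : p.2 ∉ ω' := fun hr => hrb (h2 hr)
    have hrmem : e p.2 ∈ supp (p.2 :: b) := e_mem_supp List.mem_cons_self
    set y := geom cs (cs.wordProd ω') (e p.2) with hy
    have hymem : y ∈ supp (p.2 :: b) :=
      geom_wordProd_mem_supp cs (fun j hj => List.mem_cons_of_mem _ (h2 hj)) hrmem
    have hyr : y p.2 = 1 := by rw [hy, geom_wordProd_apply_of_notMem hrω, e_same]
    have hy0 : 0 ≤ y - e p.2 := by
      have := geom_sub_nonneg (cs := cs) h3 hrω (u := 1) fun γ _ h0 _ => by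
        rwa [geom_one_apply]
      rwa [geom_one_apply] at this
    have hρ : form M (y - e p.2) (e p.2) ≤ 0 :=
      form_e_nonpos_of_nonneg hy0 (by simp [hyr, e_same])
    have hpρ := geom_sub_nonneg (cs := cs) h3 hrω h7 s
    change geom cs p.1 (e p.2) = e s at hps
    -- With `u = p.1` and `r = p.2`, the Euler form gives `form M y (e r) = (u y) s + 1`. This is at
    -- least `2` because `u y - e s` is nonnegative, and at most `2` because `y - e r` is
    -- nonnegative off `r`. Two vectors of square length `2` with product `2` coincide, so `y = e
    -- r`.
    have hE := h6 y hymem _ hrmem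
    rw [hps, euler_append_e hs (h5 y hymem)] at hE
    have hE2 := euler_add_euler (M := M) h1 hymem hrmem
    rw [euler_cons_e, hyr] at hE2
    rw [map_sub, hps] at hpρ
    simp only [Pi.zero_apply, Pi.sub_apply, e_same, map_sub, LinearMap.sub_apply,
      form_e_self] at hpρ hρ
    have hform : form M y (e p.2) = 2 := by linarith
    have hzero : form M (y - e p.2) (y - e p.2) = 0 := by
      have hyy : form M y y = 2 := form_geom_e_self cs _ _
      simp only [map_sub, LinearMap.sub_apply, form_e_self, hform, hyy, form_symm (e p.2) y]
      norm_num
    have := sub_eq_zero.1 (form_self_eq_zero cs hzero)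
    exact ⟨p.2, by rw [h4, geom_mul_apply, ← hy, this, hps]⟩
  · rintro ⟨r, hr⟩
    have hra : r ∈ a ++ [s] := by
      by_contra hra
      have h1 := geom_wordProd_apply_of_notMem (cs := cs) (fun h' => hra (h.subset h')) (e r)
      rw [hr, e_same] at h1
      by_cases hrs : r = s
      · simp [hrs] at hra
      · rw [e_ne hrs] at h1; norm_num at h1
    obtain ⟨u, hp⟩ := h.exists_mem hra
    obtain ⟨b, ω', h1, h2, h3, h4, h5, h6, h7⟩ := h.exists_rest ha' hp
    simp only at h1 h4 h5 h6 h7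
    have hrb := (List.nodup_cons.1 h1).1
    have hrω : r ∉ ω' := fun hr => hrb (h2 hr)
    have hrmem : e r ∈ supp (r :: b) := e_mem_supp List.mem_cons_self
    set y := geom cs (cs.wordProd ω') (e r) with hy
    have hymem : y ∈ supp (r :: b) :=
      geom_wordProd_mem_supp cs (fun j hj => List.mem_cons_of_mem _ (h2 hj)) hrmem
    have hyr : y r = 1 := by rw [hy, geom_wordProd_apply_of_notMem hrω, e_same]
    have huy : geom cs u y = e s := by rw [hy, ← geom_mul_apply, ← h4, hr]
    -- Here `u y = e s`, so the coordinate of `u(e r)` at `s` is `y r = 1`. Thus `u(e r)` is a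
    -- positive root, and it is at most `u y = e s`, which forces equality.
    have hE := h6 _ hrmem y hymem
    rw [huy, euler_append_e hs (h5 _ hrmem), euler_cons_e, hyr] at hE
    have hpos : 0 ≤ geom cs u (e r) := by
      rw [← ((isRoot_e r).geom u).not_nonpos_iff]
      intro h0
      have := h0 s
      rw [hE] at this
      norm_num at this
    have hpρ := geom_sub_nonneg (cs := cs) h3 hrω h7
    rw [← hy, map_sub, huy] at hpρ
    refine ⟨(u, r), hp, ?_⟩
    refine le_antisymm (sub_nonneg.1 hpρ) fun j => ?_
    by_cases hj : j = s
    · subst hj; rw [e_same]; exact hE.ge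
    · rw [e_ne hj]; exact hpos j

theorem mem_skipRoots_map_shift {s : B} {L : List (W × B)} {x : B → ℝ} :
    x ∈ skipRoots cs (L.map (shift cs s)) ↔ geom cs (cs.simple s) x ∈ skipRoots cs L := by
  constructor
  · rintro ⟨_, hp, rfl⟩
    obtain ⟨q, hq, rfl⟩ := List.mem_map.1 hp
    exact ⟨q, hq, by rw [skipRoot_shift, geom_simple_simple]⟩
  · rintro ⟨q, hq, hx⟩
    exact ⟨_, List.mem_map_of_mem hq, by rw [skipRoot_shift, hx, geom_simple_simple]⟩

theorem isRoot_of_mem_skipRoots {L : List (W × B)} {x : B → ℝ} (h : x ∈ skipRoots cs L) :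
    IsRoot cs x := by
  obtain ⟨p, _, rfl⟩ := h
  exact isRoot_skipRoot p

/-- The negative skips are the cover roots. -/
theorem Sorting.mem_skipRoots_iff [Finite W] {a ω : List B} {L : List (W × B)}
    (h : Sorting cs a ω L) (ha : a.Nodup) {x : B → ℝ} (hx : x ≤ 0) :
    x ∈ skipRoots cs L ↔ ∃ r, geom cs (cs.wordProd ω) (e r) = x := by
  induction h generalizing x with
  | nil =>
    refine ⟨fun h => by simp [skipRoots] at h, ?_⟩
    rintro ⟨r, rfl⟩
    rw [cs.wordProd_nil, geom_one_apply] at hx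
    exact absurd hx (not_e_nonpos r)
  | @skip s a ω L h ih =>
    rw [← ih (List.nodup_cons.1 ha).2 hx]
    constructor
    · rintro ⟨p, hp, rfl⟩
      rcases List.mem_cons.1 hp with rfl | hp
      · rw [skipRoot_one] at hx
        exact absurd hx (not_e_nonpos s)
      · exact ⟨p, hp, rfl⟩
    · rintro ⟨p, hp, rfl⟩
      exact ⟨p, List.mem_cons_of_mem _ hp, rfl⟩
  | @use s a ω L h hd ih =>
    rw [mem_skipRoots_map_shift, cs.wordProd_cons]
    have hiff : (∃ r, geom cs (cs.simple s * cs.wordProd ω) (e r) = x) ↔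
        ∃ r, geom cs (cs.wordProd ω) (e r) = geom cs (cs.simple s) x := by
      simp only [geom_mul_apply]
      refine exists_congr fun r => ⟨fun h => ?_, fun h => ?_⟩
      · rw [← h, geom_simple_simple]
      · rw [h, geom_simple_simple]
    rw [hiff]
    -- The only nonpositive root whose sign `s` changes is `-e s`; for all others the induction
    -- hypothesis applies to the rotated root.
    by_cases hxs : x = -e s
    · rw [hxs, map_neg, geom_simple_e, neg_neg]
      exact h.e_mem_skipRoots_iff ha hd
    · constructor
      · intro hm
        have hroot : IsRoot cs x := by
          have := (isRoot_of_mem_skipRoots hm).geom (cs.simple s)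
          rwa [geom_simple_simple] at this
        exact (ih (nodup_append_singleton.2 ha) (hroot.simple_nonpos hx hxs)).1 hm
      · rintro ⟨r, hr⟩
        have hroot : IsRoot cs x := by
          have := ((isRoot_e (cs := cs) r).geom (cs.wordProd ω)).geom (cs.simple s)
          rwa [hr, geom_simple_simple] at this
        exact (ih (nodup_append_singleton.2 ha) (hroot.simple_nonpos hx hxs)).2 ⟨r, hr⟩

theorem Sorting.neg_e_notMem [Finite W] {a ω : List B} {s : B} {L : List (W × B)}
    (h : Sorting cs a ω L) (ha : a.Nodup) (hd : ¬ cs.IsLeftDescent (cs.wordProd ω) s) :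
    -e s ∉ skipRoots cs L := by
  rw [h.mem_skipRoots_iff ha (neg_e_nonpos s)]
  rintro ⟨r, hr⟩
  apply hd
  have : e s = geom cs (cs.wordProd ω) (-e r) := by rw [map_neg, hr, neg_neg]
  rw [isLeftDescent_iff_geom_inv_nonpos, this, geom_inv_apply_self]
  exact neg_e_nonpos r

/-- A positive skip comes from a positive skip in the rotation. -/
theorem Sorting.nonneg_of_simple_nonneg [Finite W] {a ω : List B} {s : B} {L : List (W × B)}
    (h : Sorting cs a ω L) (ha : a.Nodup) (hd : ¬ cs.IsLeftDescent (cs.wordProd ω) s)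
    {x : B → ℝ} (hx : x ∈ skipRoots cs L) (h0 : 0 ≤ geom cs (cs.simple s) x) : 0 ≤ x := by
  have hr := isRoot_of_mem_skipRoots hx
  rw [← hr.not_nonpos_iff]
  intro hneg
  refine (hr.geom _).not_nonneg_iff.2 (hr.simple_nonpos hneg ?_) h0
  rintro rfl
  exact h.neg_e_notMem ha hd hx

theorem Sorting.mem_supp_of_mem_skipRoots {a ω : List B} {L : List (W × B)}
    (h : Sorting cs a ω L) {x : B → ℝ} (hx : x ∈ skipRoots cs L) : x ∈ supp a := by
  obtain ⟨p, hp, rfl⟩ := hx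
  exact h.skipRoot_mem_supp p hp

theorem Sorting.euler_eq_zero_or {a ω : List B} {L : List (W × B)} (h : Sorting cs a ω L)
    (ha : a.Nodup) {x y : B → ℝ} (hx : x ∈ skipRoots cs L) (hy : y ∈ skipRoots cs L)
    (hxy : x ≠ y) : euler M a x y = 0 ∨ euler M a y x = 0 := by
  obtain ⟨p, hp, rfl⟩ := hx
  obtain ⟨q, hq, rfl⟩ := hy
  have key : ∀ p ∈ L, ∀ q ∈ L, skipRoot cs p ≠ skipRoot cs q →
      euler M a (skipRoot cs p) (skipRoot cs q) = 0 ∨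
        euler M a (skipRoot cs q) (skipRoot cs p) = 0 := by
    intro p hp q hq
    let R : W × B → W × B → Prop := fun p q => skipRoot cs p ≠ skipRoot cs q →
      euler M a (skipRoot cs p) (skipRoot cs q) = 0 ∨
        euler M a (skipRoot cs q) (skipRoot cs p) = 0
    have hsymm : Std.Symm R := ⟨fun p q hpq hne => (hpq hne.symm).symm⟩
    exact List.Pairwise.forall_of_forall (R := R) (fun p _ hne => absurd rfl hne)
      ((h.pairwise_euler ha).imp fun hpq _ => Or.inl hpq) hp hq
  exact key p hp q hq hxy

/-- A new skip root `e s` meets nonnegative roots supported off `s`. At a use, positive skips come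
from positive skips of the rotated word, since `-e s` is not among those. -/
theorem Sorting.form_nonpos_of_nonneg [Finite W] {a ω : List B} {L : List (W × B)}
    (h : Sorting cs a ω L) (ha : a.Nodup) {x y : B → ℝ} (hx : x ∈ skipRoots cs L)
    (hy : y ∈ skipRoots cs L) (hxy : x ≠ y) (hx0 : 0 ≤ x) (hy0 : 0 ≤ y) : form M x y ≤ 0 := by
  induction h generalizing x y with
  | nil => simp [skipRoots] at hx
  | @skip s a ω L h ih =>
    have ha' := List.nodup_cons.1 ha
    have hcase : ∀ z ∈ skipRoots cs ((1, s) :: L), z = e s ∨ z ∈ skipRoots cs L := by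
      rintro z ⟨p, hp, rfl⟩
      rcases List.mem_cons.1 hp with rfl | hp
      · exact Or.inl (skipRoot_one s)
      · exact Or.inr ⟨p, hp, rfl⟩
    have hs : ∀ z ∈ skipRoots cs L, 0 ≤ z → form M z (e s) ≤ 0 := fun z hz hz0 =>
      form_e_nonpos_of_nonneg hz0 (h.mem_supp_of_mem_skipRoots hz s ha'.1)
    rcases hcase x hx with rfl | hx <;> rcases hcase y hy with rfl | hy
    · exact absurd rfl hxy
    · rw [form_symm]; exact hs y hy hy0
    · exact hs x hx hx0
    · exact ih ha'.2 hx hy hxy hx0 hy0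
  | @use s a ω L h hd ih =>
    have ha' := nodup_append_singleton.2 ha
    rw [mem_skipRoots_map_shift] at hx hy
    rw [← form_simple cs s]
    refine ih ha' hx hy (fun h => hxy ((geom cs (cs.simple s)).injective h)) ?_ ?_
    · exact h.nonneg_of_simple_nonneg ha' hd hx (by rwa [geom_simple_simple])
    · exact h.nonneg_of_simple_nonneg ha' hd hy (by rwa [geom_simple_simple])

theorem Sorting.form_nonpos_of_nonpos [Finite W] {a ω : List B} {L : List (W × B)}
    (h : Sorting cs a ω L) (ha : a.Nodup) {x y : B → ℝ} (hx : x ∈ skipRoots cs L)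
    (hy : y ∈ skipRoots cs L) (hxy : x ≠ y) (hx0 : x ≤ 0) (hy0 : y ≤ 0) : form M x y ≤ 0 := by
  rw [h.mem_skipRoots_iff ha hx0] at hx
  rw [h.mem_skipRoots_iff ha hy0] at hy
  obtain ⟨i, rfl⟩ := hx
  obtain ⟨j, rfl⟩ := hy
  rw [form_geom]
  exact form_e_nonpos fun hij => hxy (by rw [hij])

/-- The Euler form of a positive skip with a negative one vanishes. -/
theorem Sorting.euler_eq_zero [Finite W] {a ω : List B} {L : List (W × B)}
    (h : Sorting cs a ω L) (ha : a.Nodup) {x y : B → ℝ} (hx : x ∈ skipRoots cs L)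
    (hy : y ∈ skipRoots cs L) (hx0 : 0 ≤ x) (hy0 : y ≤ 0) : euler M a x y = 0 := by
  induction h generalizing x y with
  | nil => simp [skipRoots] at hx
  | @skip s a ω L h ih =>
    have ha' := List.nodup_cons.1 ha
    have hcase : ∀ z ∈ skipRoots cs ((1, s) :: L), z = e s ∨ z ∈ skipRoots cs L := by
      rintro z ⟨p, hp, rfl⟩
      rcases List.mem_cons.1 hp with rfl | hp
      · exact Or.inl (skipRoot_one s)
      · exact Or.inr ⟨p, hp, rfl⟩
    rcases hcase y hy with rfl | hy
    · exact absurd hy0 (not_e_nonpos s)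
    have hys := h.mem_supp_of_mem_skipRoots hy
    rcases hcase x hx with rfl | hx
    · rw [euler_cons_e]; exact hys s ha'.1
    · rw [euler_cons_of_mem ha'.1 (h.mem_supp_of_mem_skipRoots hx) hys]
      exact ih ha'.2 hx hy hx0 hy0
  | @use s a ω L h hd ih =>
    have ha' := nodup_append_singleton.2 ha
    have hxr := (h.use hd).mem_supp_of_mem_skipRoots hx
    have hyr := (h.use hd).mem_supp_of_mem_skipRoots hy
    have hyroot := isRoot_of_mem_skipRoots hy
    rw [mem_skipRoots_map_shift] at hx hy
    have hx1 := h.nonneg_of_simple_nonneg ha' hd hx (by rwa [geom_simple_simple])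
    rw [← euler_rotate cs ha hxr hyr]
    by_cases hys : y = -e s
    · have hys' : geom cs (cs.simple s) y = e s := by rw [hys, map_neg, geom_simple_e, neg_neg]
      rw [hys'] at hy ⊢
      have hne : geom cs (cs.simple s) x ≠ e s := by
        intro heq
        have : x = -e s := by rw [← geom_simple_simple cs s x, heq, geom_simple_e]
        rw [this] at hx0
        exact not_e_nonpos s (neg_nonneg.1 hx0)
      rcases h.euler_eq_zero_or ha' hx hy hne with h0 | h0
      · exact h0
      -- Now `E(e s, x') = 0` for the rotated root `x'`, so `E(x', e s)` equals `form M x' (e s) ≤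
      -- 0`. It also equals the coordinate `x' s ≥ 0`, so it vanishes.
      · have hxs := h.mem_supp_of_mem_skipRoots hx
        have h1 := euler_add_euler (M := M) ha' hxs (h.mem_supp_of_mem_skipRoots hy)
        have h2 := h.form_nonpos_of_nonneg ha' hx hy hne hx1 (e_nonneg s)
        have h3 := euler_append_e (M := M) (List.nodup_cons.1 ha).1 hxs
        have h4 := hx1 s
        simp only [Pi.zero_apply] at h4
        linarith
    · exact ih ha' hx hy hx1 (hyroot.simple_nonpos hy0 hys)

theorem Sorting.euler_nonpos [Finite W] {a ω : List B} {L : List (W × B)}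
    (h : Sorting cs a ω L) (ha : a.Nodup) {x y : B → ℝ} (hx : x ∈ skipRoots cs L)
    (hy : y ∈ skipRoots cs L) (hxy : x ≠ y) (h0 : 0 ≤ x ∧ 0 ≤ y ∨ x ≤ 0 ∧ y ≤ 0) :
    euler M a x y ≤ 0 := by
  rcases h.euler_eq_zero_or ha hx hy hxy with h1 | h1
  · exact h1.le
  · have h2 := euler_add_euler (M := M) ha (h.mem_supp_of_mem_skipRoots hx)
      (h.mem_supp_of_mem_skipRoots hy)
    rw [h1, add_zero] at h2
    rw [h2]
    rcases h0 with h0 | h0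
    · exact h.form_nonpos_of_nonneg ha hx hy hxy h0.1 h0.2
    · exact h.form_nonpos_of_nonpos ha hx hy hxy h0.1 h0.2

/-- A negative skip before a positive one is orthogonal to it. -/
theorem Sorting.pairwise_form_eq_zero [Finite W] {a ω : List B} {L : List (W × B)}
    (h : Sorting cs a ω L) (ha : a.Nodup) : L.Pairwise fun p q =>
      skipRoot cs p ≤ 0 → 0 ≤ skipRoot cs q → form M (skipRoot cs p) (skipRoot cs q) = 0 := by
  refine (h.pairwise_euler ha).imp_of_mem fun {p q} hp hq hpq hp0 hq0 => ?_
  rw [← euler_add_euler ha (h.skipRoot_mem_supp p hp) (h.skipRoot_mem_supp q hq), hpq,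
    h.euler_eq_zero ha ⟨q, hq, rfl⟩ ⟨p, hp, rfl⟩ hq0 hp0, add_zero]

end SkipSigns
end CoxeterSortable

namespace CoxeterSortable

variable {B W : Type*} [Group W] {M : CoxeterMatrix B} {cs : CoxeterSystem M W}

/-! ### The cone of the skip roots contains the negatives of the inversions. -/

section SkipCone

variable [Fintype B] [DecidableEq B]

/-- Used to discard negative coefficients. Write `∑ f x • x` as (terms outside `D`) minus `d`, where
`d` is the dropped part with its sign changed. Pairing with `d` bounds `E(d, d)` by the pairing of
`d` with the terms outside `D`. When `E` is half a positive definite form on the diagonal, `d = 0`.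
-/
theorem form_le_zero_of_dropped {V : Type*} [AddCommGroup V] [Module ℝ V]
    (E : LinearMap.BilinForm ℝ V) (R D : Finset V) [DecidableEq V] (hD : D ⊆ R) (f : V → ℝ)
    (hf : ∀ d ∈ D, f d ≤ 0) (h : ∀ d ∈ D, ∀ x ∈ R \ D, f x * E d x ≤ 0)
    (h0 : 0 ≤ E (∑ d ∈ D, (-f d) • d) (∑ x ∈ R, f x • x)) :
    E (∑ d ∈ D, (-f d) • d) (∑ d ∈ D, (-f d) • d) ≤ 0 := by
  have h1 : ∑ x ∈ R, f x • x = ∑ x ∈ R \ D, f x • x - ∑ d ∈ D, (-f d) • d := by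
    rw [← Finset.sum_sdiff hD]
    simp
  rw [h1, map_sub] at h0
  have h2 : E (∑ d ∈ D, (-f d) • d) (∑ x ∈ R \ D, f x • x) ≤ 0 := by
    simp only [map_sum, LinearMap.sum_apply, map_smul, LinearMap.smul_apply, smul_eq_mul]
    refine Finset.sum_nonpos fun x hx => ?_
    rw [Finset.mul_sum]
    refine Finset.sum_nonpos fun d hd => ?_
    have := mul_nonneg_of_nonpos_of_nonpos (hf d hd) (h d hd x hx)
    linarith
  linarith

theorem sum_smul_mem_supp {a : List B} {D : Finset (B → ℝ)} (f : (B → ℝ) → ℝ)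
    (h : ∀ d ∈ D, d ∈ supp a) : ∑ d ∈ D, f d • d ∈ supp a :=
  sum_mem fun d hd => Submodule.smul_mem _ _ (h d hd)

/-- The roots of the skips as a finite set. -/
noncomputable def skipFinset (cs : CoxeterSystem M W) (L : List (W × B)) : Finset (B → ℝ) :=
  (L.map (skipRoot cs)).toFinset

theorem mem_skipFinset {L : List (W × B)} {x : B → ℝ} :
    x ∈ skipFinset cs L ↔ x ∈ skipRoots cs L := by
  simp [skipFinset, skipRoots]

theorem coe_skipFinset (L : List (W × B)) :
    (skipFinset cs L : Set (B → ℝ)) = skipRoots cs L := by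
  ext x
  rw [Finset.mem_coe, mem_skipFinset]

/-- If `s` is the last letter and is not a left descent, then its simple root lies in the cone of
the skips. -/
theorem Sorting.e_mem_cone [Finite W] {a ω : List B} {s : B} {L : List (W × B)}
    (h : Sorting cs (a ++ [s]) ω L) (ha : (s :: a).Nodup)
    (hd : ¬ cs.IsLeftDescent (cs.wordProd ω) s) :
    e s ∈ Submodule.span NNReal (skipRoots cs L) := by
  have ha' := nodup_append_singleton.2 ha
  have hs := (List.nodup_cons.1 ha).1
  have hmem := e_mem_supp (List.mem_append_right a (List.mem_singleton_self s))
  have h1 := h.supp_le_span hmem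
  rw [← coe_skipFinset, Submodule.mem_span_finset] at h1
  obtain ⟨f, -, hf⟩ := h1
  set R := skipFinset cs L
  have hR : ∀ x ∈ R, x ∈ skipRoots cs L := fun x hx => mem_skipFinset.1 hx
  have hRs : ∀ x ∈ R, x ∈ supp (a ++ [s]) := fun x hx => h.mem_supp_of_mem_skipRoots (hR x hx)
  have hsign : ∀ x ∈ R, 0 ≤ x ∨ x ≤ 0 := fun x hx =>
    (isRoot_of_mem_skipRoots (hR x hx)).nonneg_or_nonpos
  classical
  set D := R.filter fun x => 0 ≤ x ∧ f x < 0 with hD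
  set D' := R.filter fun x => x ≤ 0 ∧ f x < 0 with hD'
  have hzero : ∀ D'' : Finset (B → ℝ), D'' ⊆ R →
      euler M (a ++ [s]) (∑ d ∈ D'', (-f d) • d) (∑ d ∈ D'', (-f d) • d) ≤ 0 →
      ∑ d ∈ D'', f d • d = 0 := by
    intro D'' hsub hle
    rw [euler_self ha' (sum_smul_mem_supp _ fun d hd => hRs d (hsub hd))] at hle
    have : ∑ d ∈ D'', (-f d) • d = 0 := by
      by_contra hne
      have := form_self_pos cs hne
      linarith
    simpa using this
  -- Positive roots with a negative coefficient: `E(d, e s)` is the coordinate `d s ≥ 0`, while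
  -- `E(d, x)` vanishes for negative `x` and is nonpositive for the other positive `x`.
  have hDz : ∑ d ∈ D, f d • d = 0 := by
    refine hzero D (Finset.filter_subset _ _) ?_
    refine form_le_zero_of_dropped _ R D (Finset.filter_subset _ _) f ?_ ?_ ?_
    · intro d hd; exact (Finset.mem_filter.1 hd).2.2.le
    · intro d hd x hx
      obtain ⟨hdR, hd0, hdf⟩ := Finset.mem_filter.1 hd
      obtain ⟨hxR, hxD⟩ := Finset.mem_sdiff.1 hx
      rcases hsign x hxR with hx0 | hx0
      · have hfx : 0 ≤ f x := by
          by_contra hneg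
          exact hxD (Finset.mem_filter.2 ⟨hxR, hx0, not_le.1 hneg⟩)
        refine mul_nonpos_of_nonneg_of_nonpos hfx ?_
        exact h.euler_nonpos ha' (hR d hdR) (hR x hxR) (fun heq => hxD (heq ▸ hd))
          (Or.inl ⟨hd0, hx0⟩)
      · rw [h.euler_eq_zero ha' (hR d hdR) (hR x hxR) hd0 hx0, mul_zero]
    · rw [hf, euler_append_e hs (sum_smul_mem_supp _ fun d hd =>
        hRs d (Finset.filter_subset _ _ hd)), Finset.sum_apply]
      refine Finset.sum_nonneg fun d hd => ?_
      obtain ⟨hdR, hd0, hdf⟩ := Finset.mem_filter.1 hd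
      exact mul_nonneg (neg_nonneg.2 hdf.le) (hd0 s)
  -- For negative roots the arguments of `E` are exchanged, since `E` vanishes only on (positive,
  -- negative). Here `E(e s, d) = form M d (e s) - d s` is minus the coordinate at `s` of the root
  -- `s d`, which stays nonpositive as `d ≠ -e s`.
  have hDz' : ∑ d ∈ D', f d • d = 0 := by
    refine hzero D' (Finset.filter_subset _ _) ?_
    refine form_le_zero_of_dropped (LinearMap.flip (euler M (a ++ [s]))) R D' (Finset.filter_subset _ _) f
      ?_ ?_ ?_
    · intro d hd; exact (Finset.mem_filter.1 hd).2.2.le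
    · intro d hd x hx
      obtain ⟨hdR, hd0, hdf⟩ := Finset.mem_filter.1 hd
      obtain ⟨hxR, hxD⟩ := Finset.mem_sdiff.1 hx
      rw [LinearMap.flip_apply]
      rcases hsign x hxR with hx0 | hx0
      · rw [h.euler_eq_zero ha' (hR x hxR) (hR d hdR) hx0 hd0, mul_zero]
      · have hfx : 0 ≤ f x := by
          by_contra hneg
          exact hxD (Finset.mem_filter.2 ⟨hxR, hx0, not_le.1 hneg⟩)
        refine mul_nonpos_of_nonneg_of_nonpos hfx ?_
        exact h.euler_nonpos ha' (hR x hxR) (hR d hdR) (fun heq => hxD (heq ▸ hd))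
          (Or.inr ⟨hx0, hd0⟩)
    · rw [LinearMap.flip_apply, hf, map_sum]
      refine Finset.sum_nonneg fun d hdD => ?_
      obtain ⟨hdR, hd0, hdf⟩ := Finset.mem_filter.1 hdD
      rw [map_smul, smul_eq_mul]
      refine mul_nonneg (neg_nonneg.2 hdf.le) ?_
      have h2 := euler_add_euler (M := M) ha' (hRs d hdR) hmem
      rw [euler_append_e hs (hRs d hdR)] at h2
      have hne : d ≠ -e s := by
        rintro rfl
        exact h.neg_e_notMem ha' hd (hR _ hdR)
      have h3 := (isRoot_of_mem_skipRoots (hR d hdR)).simple_nonpos hd0 hne s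
      rw [geom_simple_apply] at h3
      simp [e_same] at h3
      linarith
  have hsplit : e s = ∑ x ∈ R.filter (fun x => 0 ≤ f x), f x • x := by
    rw [← hf, ← Finset.sum_filter_add_sum_filter_not R (fun x => 0 ≤ f x)]
    have hneg : R.filter (fun x => ¬ 0 ≤ f x) = D ∪ D' := by
      ext x
      simp only [Finset.mem_filter, Finset.mem_union, not_le, hD, hD']
      constructor
      · rintro ⟨hx, hfx⟩
        rcases hsign x hx with hx0 | hx0
        · exact Or.inl ⟨hx, hx0, hfx⟩
        · exact Or.inr ⟨hx, hx0, hfx⟩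
      · rintro (⟨hx, _, hfx⟩ | ⟨hx, _, hfx⟩) <;> exact ⟨hx, hfx⟩
    have hdisj : Disjoint D D' := by
      rw [Finset.disjoint_left]
      intro x hx hx'
      obtain ⟨hxR, hx0, -⟩ := Finset.mem_filter.1 hx
      obtain ⟨-, hx0', -⟩ := Finset.mem_filter.1 hx'
      exact (isRoot_of_mem_skipRoots (hR x hxR)).ne_zero (le_antisymm hx0' hx0)
    rw [hneg, Finset.sum_union hdisj, hDz, hDz', add_zero, add_zero]
  rw [hsplit]
  refine sum_mem fun x hx => ?_
  obtain ⟨hxR, hfx⟩ := Finset.mem_filter.1 hx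
  have := Submodule.smul_mem (Submodule.span NNReal (skipRoots cs L)) ⟨f x, hfx⟩
    (Submodule.subset_span (hR x hxR))
  exact this

theorem map_mem_cone {s : B} {L : List (W × B)} {x : B → ℝ}
    (hx : x ∈ Submodule.span NNReal (skipRoots cs L)) :
    geom cs (cs.simple s) x ∈ Submodule.span NNReal (skipRoots cs (L.map (shift cs s))) := by
  have h2 := Submodule.mem_map_of_mem
    (f := (geom cs (cs.simple s)).toLinearMap.restrictScalars NNReal) hx
  rw [Submodule.map_span] at h2
  refine Submodule.span_mono ?_ h2
  rintro _ ⟨_, ⟨p, hp, rfl⟩, rfl⟩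
  exact ⟨shift cs s p, List.mem_map_of_mem hp, skipRoot_shift s p⟩

/-- The negatives of the inversions lie in the cone of the skips. -/
theorem Sorting.neg_mem_cone [Finite W] {a ω : List B} {L : List (W × B)}
    (h : Sorting cs a ω L) (ha : a.Nodup) {x : B → ℝ} (hx : IsRoot cs x) (hx0 : 0 ≤ x)
    (hinv : geom cs (cs.wordProd ω)⁻¹ x ≤ 0) :
    -x ∈ Submodule.span NNReal (skipRoots cs L) := by
  induction h generalizing x with
  | nil =>
    rw [cs.wordProd_nil, inv_one, geom_one_apply] at hinv
    exact absurd (le_antisymm hinv hx0) hx.ne_zero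
  | @skip s a ω L h ih =>
    refine Submodule.span_mono ?_ (ih (List.nodup_cons.1 ha).2 hx hx0 hinv)
    rintro y ⟨p, hp, rfl⟩
    exact ⟨p, List.mem_cons_of_mem _ hp, rfl⟩
  | @use s a ω L h hd ih =>
    rw [← geom_simple_simple cs s (-x)]
    apply map_mem_cone
    by_cases hxs : x = e s
    · rw [hxs, map_neg, geom_simple_e, neg_neg]
      exact h.e_mem_cone ha hd
    · rw [map_neg]
      refine ih (nodup_append_singleton.2 ha) (hx.geom _) (hx.simple_nonneg hx0 hxs) ?_
      rwa [cs.wordProd_cons, mul_inv_rev, geom_mul_apply, cs.inv_simple] at hinv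

theorem exists_nonneg_of_mem_cone {L : List (W × B)} {x : B → ℝ}
    (hx : x ∈ Submodule.span NNReal (skipRoots cs L)) :
    ∃ f : (B → ℝ) → ℝ, (∀ y, 0 ≤ f y) ∧ ∑ y ∈ skipFinset cs L, f y • y = x := by
  rw [← coe_skipFinset, Submodule.mem_span_finset] at hx
  obtain ⟨f, -, hf⟩ := hx
  exact ⟨fun y => f y, fun y => (f y).2, hf⟩

/-- The negative of a simple root which is a nonnegative combination of negative roots is one of
them. -/
theorem neg_e_mem_of_sum {R : Finset (B → ℝ)} (hR : ∀ x ∈ R, IsRoot cs x ∧ x ≤ 0) {f : (B → ℝ) → ℝ}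
    (hf : ∀ x ∈ R, 0 ≤ f x) {s : B} (h : ∑ x ∈ R, f x • x = -e s) : -e s ∈ R := by
  have hs := congrFun h s
  rw [Finset.sum_apply, Pi.neg_apply, e_same] at hs
  obtain ⟨x, hx, hne⟩ := Finset.exists_ne_zero_of_sum_ne_zero (hs.trans_ne (by norm_num))
  have hfx : f x ≠ 0 := fun h0 => hne (by simp [h0])
  have hxs : ∀ j, j ≠ s → (-x) j = 0 := by
    intro j hj
    have hj' := congrFun h j
    rw [Finset.sum_apply, Pi.neg_apply, e_ne hj, neg_zero] at hj'
    have := (Finset.sum_eq_zero_iff_of_nonpos fun y hy =>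
      mul_nonpos_of_nonneg_of_nonpos (hf y hy) ((hR y hy).2 j)).1 hj' x hx
    simpa using (mul_eq_zero.1 this).resolve_left hfx
  have := (hR x hx).1.neg.eq_e (neg_nonneg.2 (hR x hx).2) hxs
  rw [← this, neg_neg]
  exact hx

/-- If the last letter `s` is a left descent, then it is a cover reflection. -/
theorem Sorting.neg_e_mem_skipRoots [Finite W] {a ω : List B} {s : B} {L : List (W × B)}
    (h : Sorting cs (a ++ [s]) ω L) (ha : (s :: a).Nodup)
    (hd : cs.IsLeftDescent (cs.wordProd ω) s) : -e s ∈ skipRoots cs L := by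
  have ha' := nodup_append_singleton.2 ha
  have hs := (List.nodup_cons.1 ha).1
  obtain ⟨f, hf0, hf⟩ := exists_nonneg_of_mem_cone
    (h.neg_mem_cone ha' (isRoot_e s) (e_nonneg s) (isLeftDescent_iff_geom_inv_nonpos.1 hd))
  set R := skipFinset cs L
  have hR : ∀ x ∈ R, x ∈ skipRoots cs L := fun x hx => mem_skipFinset.1 hx
  have hRs : ∀ x ∈ R, x ∈ supp (a ++ [s]) := fun x hx => h.mem_supp_of_mem_skipRoots (hR x hx)
  classical
  rw [← Finset.sum_filter_add_sum_filter_not R (fun x => 0 ≤ x)] at hf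
  set y := ∑ x ∈ R.filter (fun x => 0 ≤ x), f x • x with hy
  have hN : ∀ x ∈ R.filter (fun x => ¬ 0 ≤ x), IsRoot cs x ∧ x ≤ 0 := by
    intro x hx
    obtain ⟨hxR, hx0⟩ := Finset.mem_filter.1 hx
    have hr := isRoot_of_mem_skipRoots (hR x hxR)
    exact ⟨hr, hr.not_nonneg_iff.1 hx0⟩
  have hysupp : y ∈ supp (a ++ [s]) :=
    sum_smul_mem_supp _ fun d hd => hRs d (Finset.filter_subset _ _ hd)
  -- Let `y` be the positive part of the cone expression for `-e s`. The negative part is killed by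
  -- `E(y, ·)`, so `E(y, y) = -y s ≤ 0` and `y = 0`: only negative skips contribute.
  have h1 : euler M (a ++ [s]) y (∑ x ∈ R.filter (fun x => ¬ 0 ≤ x), f x • x) = 0 := by
    simp only [hy, map_sum, LinearMap.sum_apply, map_smul, LinearMap.smul_apply, smul_eq_mul]
    refine Finset.sum_eq_zero fun x hx => ?_
    rw [Finset.sum_eq_zero, mul_zero]
    intro d hd
    obtain ⟨hdR, hd0⟩ := Finset.mem_filter.1 hd
    rw [h.euler_eq_zero ha' (hR d hdR) (hR x (Finset.filter_subset _ _ hx)) hd0 (hN x hx).2,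
      mul_zero]
  have h2 := congrArg (euler M (a ++ [s]) y) hf
  rw [map_add, h1, add_zero, map_neg, euler_append_e hs hysupp, euler_self ha' hysupp] at h2
  have h3 : 0 ≤ y s := by
    rw [hy, Finset.sum_apply]
    exact Finset.sum_nonneg fun d hd => mul_nonneg (hf0 d) ((Finset.mem_filter.1 hd).2 s)
  have hy0 : y = 0 := by
    by_contra hne
    have := form_self_pos cs hne
    linarith
  rw [hy0, zero_add] at hf
  exact hR _ (Finset.filter_subset _ _ (neg_e_mem_of_sum hN (fun x _ => hf0 x) hf))

end SkipCone
end CoxeterSortable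

namespace CoxeterSortable

variable {B W : Type*} [Group W] {M : CoxeterMatrix B} {cs : CoxeterSystem M W}

/-! ### The product of the negative skips equals `nc` and is a right factor of `c`. -/

section NegSkips

variable [Fintype B] [DecidableEq B]

open Classical in
/-- The skips with a negative root. -/
noncomputable def negSkips (cs : CoxeterSystem M W) (L : List (W × B)) : List (W × B) :=
  L.filter fun p => decide (skipRoot cs p ≤ 0)

/-- The product of the reflections of the negative skips. -/
noncomputable def ncProd (cs : CoxeterSystem M W) (L : List (W × B)) : W :=
  ((negSkips cs L).map (skipRefl cs)).prod

theorem mem_negSkips {L : List (W × B)} {p : W × B} :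
    p ∈ negSkips cs L ↔ p ∈ L ∧ skipRoot cs p ≤ 0 := by
  simp [negSkips]

theorem negSkips_append (L L' : List (W × B)) :
    negSkips cs (L ++ L') = negSkips cs L ++ negSkips cs L' := by
  simp [negSkips]

theorem negSkips_cons_of_nonpos {p : W × B} (L : List (W × B)) (h : skipRoot cs p ≤ 0) :
    negSkips cs (p :: L) = p :: negSkips cs L := by
  simp [negSkips, h]

theorem negSkips_cons_of_not_nonpos {p : W × B} (L : List (W × B)) (h : ¬ skipRoot cs p ≤ 0) :
    negSkips cs (p :: L) = negSkips cs L := by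
  simp [negSkips, h]

theorem negSkips_cons_one (s : B) (L : List (W × B)) :
    negSkips cs ((1, s) :: L) = negSkips cs L :=
  negSkips_cons_of_not_nonpos L (by rw [skipRoot_one]; exact not_e_nonpos s)

theorem negSkips_map_shift {s : B} {L : List (W × B)}
    (h : ∀ p ∈ L, skipRoot cs p ≠ e s ∧ skipRoot cs p ≠ -e s) :
    negSkips cs (L.map (shift cs s)) = (negSkips cs L).map (shift cs s) := by
  classical
  rw [negSkips, negSkips, List.filter_map]
  congr 1
  refine List.filter_congr fun p hp => ?_
  simp only [Function.comp, skipRoot_shift, decide_eq_decide]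
  have hr := isRoot_skipRoot (cs := cs) p
  constructor
  · intro h0
    rw [← hr.not_nonneg_iff]
    intro h1
    exact (hr.geom _).not_nonneg_iff.2 h0 (hr.simple_nonneg h1 (h p hp).1)
  · exact fun h0 => hr.simple_nonpos h0 (h p hp).2

theorem prod_map_skipRefl_shift (s : B) (L : List (W × B)) :
    ((L.map (shift cs s)).map (skipRefl cs)).prod =
      cs.simple s * (L.map (skipRefl cs)).prod * cs.simple s := by
  have : skipRefl cs ∘ shift cs s = (fun t => cs.simple s * t * cs.simple s) ∘ skipRefl cs := by
    ext p; exact skipRefl_shift cs s p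
  rw [List.map_map, this, ← List.map_map, prod_map_conj]

theorem skipRefl_mul_comm {p : W × B} {s : B} (h : form M (e s) (skipRoot cs p) = 0) :
    Commute (skipRefl cs p) (cs.simple s) := by
  have h1 : geom cs (skipRefl cs p) (e s) = e s := by
    rw [geom_skipRefl, h]; module
  have := conj_simple_eq_of_geom_eq (cs := cs) (v := skipRefl cs p) (w := 1) (i := s) (j := s)
    (by rw [h1, geom_one_apply])
  rw [one_mul, inv_one, mul_one, mul_inv_eq_iff_eq_mul] at this
  exact this

theorem Sorting.negSkips_map_shift_of_notMem [Finite W] {a ω : List B} {s : B}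
    {L : List (W × B)} (h : Sorting cs a ω L) (ha : a.Nodup)
    (hd : ¬ cs.IsLeftDescent (cs.wordProd ω) s) (hs : e s ∉ skipRoots cs L) :
    negSkips cs (L.map (shift cs s)) = (negSkips cs L).map (shift cs s) := by
  refine negSkips_map_shift fun p hp => ⟨?_, ?_⟩
  · exact fun heq => hs ⟨p, hp, heq⟩
  · exact fun heq => h.neg_e_notMem ha hd ⟨p, hp, heq⟩

theorem Sorting.ncProd_map_shift_of_notMem [Finite W] {a ω : List B} {s : B}
    {L : List (W × B)} (h : Sorting cs a ω L) (ha : a.Nodup)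
    (hd : ¬ cs.IsLeftDescent (cs.wordProd ω) s) (hs : e s ∉ skipRoots cs L) :
    ncProd cs (L.map (shift cs s)) = cs.simple s * ncProd cs L * cs.simple s := by
  rw [ncProd, h.negSkips_map_shift_of_notMem ha hd hs, prod_map_skipRefl_shift, ncProd]

/-- Using `s` turns the skip root `e s` into the negative root `-e s`. If `P₁` and `P₂` are the
products of the negative skips before and after it, the new product is `(s P₁ s) s (s P₂ s)`. Since
`P₁` commutes with `s`, this is `P₁ P₂ s`. -/
theorem Sorting.negSkips_map_shift_of_mem [Finite W] {a ω : List B} {s : B}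
    {L : List (W × B)} (h : Sorting cs (a ++ [s]) ω L) (ha : (s :: a).Nodup)
    (hd : ¬ cs.IsLeftDescent (cs.wordProd ω) s) (hs : e s ∈ skipRoots cs L) :
    (negSkips cs (L.map (shift cs s))).length = (negSkips cs L).length + 1 ∧
      ncProd cs (L.map (shift cs s)) = ncProd cs L * cs.simple s := by
  have ha' := nodup_append_singleton.2 ha
  have hsa := (List.nodup_cons.1 ha).1
  obtain ⟨r, hr⟩ := (h.e_mem_skipRoots_iff ha hd).1 hs
  obtain ⟨q, hq, hqs⟩ := hs
  obtain ⟨L₁, L₂, rfl⟩ := List.append_of_mem hq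
  have hnd := h.nodup_skipRoot ha'
  have hpw := h.pairwise_euler ha'
  rw [List.map_append, List.map_cons, List.nodup_append] at hnd
  obtain ⟨hnd1, hnd2, hnd3⟩ := hnd
  rw [List.nodup_cons] at hnd2
  have h1 : negSkips cs (L₁.map (shift cs s)) = (negSkips cs L₁).map (shift cs s) := by
    refine negSkips_map_shift fun p hp => ⟨fun heq => ?_, fun heq => ?_⟩
    · exact hnd3 _ (List.mem_map_of_mem hp) _ List.mem_cons_self (heq.trans hqs.symm)
    · exact h.neg_e_notMem ha' hd ⟨p, by simp [hp], heq⟩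
  have h2 : negSkips cs (L₂.map (shift cs s)) = (negSkips cs L₂).map (shift cs s) := by
    refine negSkips_map_shift fun p hp => ⟨fun heq => ?_, fun heq => ?_⟩
    · exact hnd2.1 (List.mem_map.2 ⟨p, hp, heq.trans hqs.symm⟩)
    · exact h.neg_e_notMem ha' hd ⟨p, by simp [hp], heq⟩
  have hshift : skipRoot cs (shift cs s q) = -e s := by
    rw [skipRoot_shift, hqs, geom_simple_e]
  have hneg : negSkips cs ((L₁ ++ q :: L₂).map (shift cs s)) =
      (negSkips cs L₁).map (shift cs s) ++ shift cs s q :: (negSkips cs L₂).map (shift cs s) := by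
    rw [List.map_append, List.map_cons, negSkips_append, negSkips_cons_of_nonpos, h1, h2]
    rw [hshift]; exact neg_e_nonpos s
  have hneg' : negSkips cs (L₁ ++ q :: L₂) = negSkips cs L₁ ++ negSkips cs L₂ := by
    rw [negSkips_append, negSkips_cons_of_not_nonpos]
    rw [hqs]; exact not_e_nonpos s
  refine ⟨?_, ?_⟩
  · rw [hneg, hneg']; simp; omega
  have hcomm : Commute ((negSkips cs L₁).map (skipRefl cs)).prod (cs.simple s) := by
    refine Commute.list_prod_left _ _ ?_
    intro t ht
    obtain ⟨p, hp, rfl⟩ := List.mem_map.1 ht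
    obtain ⟨hp, hp0⟩ := mem_negSkips.1 hp
    have hpL : p ∈ L₁ ++ q :: L₂ := by simp [hp]
    apply skipRefl_mul_comm
    -- `E(p, e s) = 0` says that the nonpositive root of `p` has coordinate `0` at `s`, so its
    -- product with `e s` is nonnegative. It is also nonpositive, since both roots are images of
    -- distinct simple roots under the same element.
    have hE := (List.pairwise_append.1 hpw).2.2 p hp q List.mem_cons_self
    rw [hqs, euler_append_e hsa (h.skipRoot_mem_supp p hpL)] at hE
    apply le_antisymm
    · obtain ⟨r', hr'⟩ := (h.mem_skipRoots_iff ha' hp0).1 ⟨p, hpL, rfl⟩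
      rw [← hr', ← hr, form_geom]
      refine form_e_nonpos ?_
      rintro rfl
      rw [hr] at hr'
      rw [← hr'] at hp0
      exact not_e_nonpos s hp0
    · have := form_e_nonpos_of_nonneg (M := M) (neg_nonneg.2 hp0) (s := s) (by simp [hE])
      rw [map_neg, LinearMap.neg_apply, form_symm] at this
      linarith
  rw [ncProd, hneg, ncProd, hneg', List.map_append, List.map_append, List.map_cons,
    List.prod_append, List.prod_append, List.prod_cons, prod_map_skipRefl_shift,
    prod_map_skipRefl_shift, skipRefl_eq_simple (Or.inr hshift), ← hcomm.eq]
  simp [mul_assoc]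

theorem leftInvSeq_cons (s : B) (ω : List B) : cs.leftInvSeq (s :: ω) =
    cs.simple s :: (cs.leftInvSeq ω).map fun t => cs.simple s * t * cs.simple s := by
  rw [CoxeterSystem.leftInvSeq]
  congr 1
  refine List.map_congr_left fun t _ => ?_
  simp

theorem Sorting.isCoverReflection_simple_iff [Finite W] {a ω : List B} {s : B}
    {L : List (W × B)} (h : Sorting cs (a ++ [s]) ω L) (ha : (s :: a).Nodup)
    (hd : ¬ cs.IsLeftDescent (cs.wordProd ω) s) :
    IsCoverReflection cs (cs.wordProd (s :: ω)) (cs.simple s) ↔ e s ∈ skipRoots cs L := by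
  rw [h.e_mem_skipRoots_iff ha hd, cs.wordProd_cons]
  constructor
  · rintro ⟨-, r, hr, heq⟩
    rw [cs.simple_mul_simple_cancel_left, mul_assoc] at heq
    refine ⟨r, ?_⟩
    have h1 : cs.wordProd ω * cs.simple r * (cs.wordProd ω)⁻¹ = 1 * cs.simple s * 1⁻¹ := by
      rw [mul_inv_eq_iff_eq_mul, inv_one, mul_one, one_mul]
      nth_rw 2 [heq]
      rw [cs.simple_mul_simple_cancel_left]
    rcases geom_eq_or_eq_neg_of_conj_simple_eq h1 with h2 | h2
    · rwa [geom_one_apply] at h2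
    · exfalso
      rw [geom_one_apply] at h2
      refine h.neg_e_notMem (nodup_append_singleton.2 ha) hd ?_
      rw [h.mem_skipRoots_iff (nodup_append_singleton.2 ha) (neg_e_nonpos s)]
      exact ⟨r, h2⟩
  · rintro ⟨r, hr⟩
    refine ⟨cs.isReflection_simple s, r, ?_, ?_⟩
    · rw [isRightDescent_iff_geom_nonpos, geom_mul_apply, hr, geom_simple_e]
      exact neg_e_nonpos s
    · have := conj_simple_eq_of_geom_eq (cs := cs) (v := cs.wordProd ω) (w := 1) (i := r) (j := s)
        (by rw [hr, geom_one_apply])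
      rw [mul_inv_eq_iff_eq_mul, inv_one, mul_one, one_mul] at this
      rw [mul_assoc (cs.simple s), this]

theorem isCoverReflection_conj_iff {ω : List B} {s : B} (hω : cs.IsReduced ω)
    (hd : ¬ cs.IsLeftDescent (cs.wordProd ω) s) {t : W} (ht : t ∈ cs.leftInvSeq ω) :
    IsCoverReflection cs (cs.wordProd (s :: ω)) (cs.simple s * t * cs.simple s) ↔
      IsCoverReflection cs (cs.wordProd ω) t := by
  have hinv := cs.isLeftInversion_of_mem_leftInvSeq hω ht
  rw [cs.wordProd_cons]
  have heqv : ∀ r, cs.simple s * t * cs.simple s * (cs.simple s * cs.wordProd ω) =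
      cs.simple s * cs.wordProd ω * cs.simple r ↔ t * cs.wordProd ω = cs.wordProd ω * cs.simple r := by
    intro r
    rw [mul_assoc (cs.simple s) (cs.wordProd ω), mul_assoc, cs.simple_mul_simple_cancel_left,
      mul_assoc]
    exact mul_right_inj _
  constructor
  · rintro ⟨-, r, -, heq⟩
    rw [heqv] at heq
    exact ⟨hinv.1, r, by rw [CoxeterSystem.IsRightDescent, ← heq]; exact hinv.2, heq⟩
  · rintro ⟨-, r, hr, heq⟩
    refine ⟨?_, r, ?_, (heqv r).2 heq⟩
    · have := hinv.1.conj (cs.simple s)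
      rwa [cs.inv_simple] at this
    · rw [isRightDescent_iff_geom_nonpos] at hr ⊢
      rw [geom_mul_apply]
      refine ((isRoot_e r).geom _).simple_nonpos hr fun h0 => hd ?_
      have : e s = geom cs (cs.wordProd ω) (-e r) := by rw [map_neg, h0, neg_neg]
      rw [isLeftDescent_iff_geom_inv_nonpos, this, geom_inv_apply_self]
      exact neg_e_nonpos r

open Classical in
/-- The product of the cover reflections in the order of the inversions is the product of the
reflections of the negative skips. -/
theorem Sorting.prod_filter_leftInvSeq [Finite W] {a ω : List B} {L : List (W × B)}
    (h : Sorting cs a ω L) (ha : a.Nodup) :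
    ((cs.leftInvSeq ω).filter
      fun t => decide (IsCoverReflection cs (cs.wordProd ω) t)).prod = ncProd cs L := by
  induction h with
  | nil => simp [ncProd, negSkips]
  | @skip s a ω L h ih =>
    rw [ih (List.nodup_cons.1 ha).2, ncProd, ncProd, negSkips_cons_one]
  | @use s a ω L h hd ih =>
    have ha' := nodup_append_singleton.2 ha
    have hfilter : ((cs.leftInvSeq ω).map fun t => cs.simple s * t * cs.simple s).filter
        (fun t => decide (IsCoverReflection cs (cs.wordProd (s :: ω)) t)) =
        ((cs.leftInvSeq ω).filter fun t => decide (IsCoverReflection cs (cs.wordProd ω) t)).map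
          fun t => cs.simple s * t * cs.simple s := by
      rw [List.filter_map]
      congr 1
      refine List.filter_congr fun t ht => ?_
      simp only [Function.comp, decide_eq_decide]
      exact isCoverReflection_conj_iff h.isReduced hd ht
    rw [leftInvSeq_cons]
    by_cases hs : e s ∈ skipRoots cs L
    · rw [List.filter_cons_of_pos (by
        simpa using (h.isCoverReflection_simple_iff ha hd).2 hs), hfilter, List.prod_cons,
        prod_map_conj, ih ha', (h.negSkips_map_shift_of_mem ha hd hs).2, mul_assoc,
        cs.simple_mul_simple_cancel_left]
    · rw [List.filter_cons_of_neg (by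
        simpa using fun h' => hs ((h.isCoverReflection_simple_iff ha hd).1 h')), hfilter,
        prod_map_conj, ih ha', h.ncProd_map_shift_of_notMem ha' hd hs]

/-- Each negative skip is commuted to the right past the positive skips that follow it. -/
theorem prod_filter_eq_mul_ncProd {L : List (W × B)}
    (h : L.Pairwise fun p q => skipRoot cs p ≤ 0 → ¬ skipRoot cs q ≤ 0 →
      Commute (skipRefl cs p) (skipRefl cs q)) :
    ∃ l : List W, (∀ t ∈ l, cs.IsReflection t) ∧ l.length + (negSkips cs L).length = L.length ∧
      (L.map (skipRefl cs)).prod = l.prod * ncProd cs L := by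
  suffices ∃ l : List (W × B), (∀ p ∈ l, p ∈ L ∧ ¬ skipRoot cs p ≤ 0) ∧
      l.length + (negSkips cs L).length = L.length ∧
      (L.map (skipRefl cs)).prod = (l.map (skipRefl cs)).prod * ncProd cs L by
    obtain ⟨l, -, h2, h3⟩ := this
    refine ⟨l.map (skipRefl cs), ?_, by simpa using h2, h3⟩
    intro t ht
    obtain ⟨p, -, rfl⟩ := List.mem_map.1 ht
    exact isReflection_skipRefl cs p
  induction L with
  | nil => exact ⟨[], by simp [ncProd, negSkips]⟩
  | cons p L ih =>
    rw [List.pairwise_cons] at h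
    obtain ⟨l, h1, h2, h3⟩ := ih h.2
    by_cases hp : skipRoot cs p ≤ 0
    · refine ⟨l, fun q hq => ⟨List.mem_cons_of_mem _ (h1 q hq).1, (h1 q hq).2⟩, ?_, ?_⟩
      · rw [negSkips_cons_of_nonpos _ hp]; simp; omega
      · have hcomm : Commute (l.map (skipRefl cs)).prod (skipRefl cs p) := by
          refine Commute.list_prod_left _ _ fun t ht => ?_
          obtain ⟨q, hq, rfl⟩ := List.mem_map.1 ht
          exact (h.1 q (h1 q hq).1 hp (h1 q hq).2).symm
        have hn : ncProd cs (p :: L) = skipRefl cs p * ncProd cs L := by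
          rw [ncProd, negSkips_cons_of_nonpos _ hp, List.map_cons, List.prod_cons, ncProd]
        rw [List.map_cons, List.prod_cons, h3, hn, ← mul_assoc, ← hcomm.eq, mul_assoc]
    · refine ⟨p :: l, ?_, ?_, ?_⟩
      · intro q hq
        rcases List.mem_cons.1 hq with rfl | hq
        · exact ⟨List.mem_cons_self, hp⟩
        · exact ⟨List.mem_cons_of_mem _ (h1 q hq).1, (h1 q hq).2⟩
      · rw [negSkips_cons_of_not_nonpos _ hp]; simp; omega
      · rw [ncProd, negSkips_cons_of_not_nonpos _ hp, List.map_cons, List.map_cons, List.prod_cons,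
          List.prod_cons, h3, ncProd, mul_assoc]

theorem commute_skipRefl {p q : W × B} (h : form M (skipRoot cs p) (skipRoot cs q) = 0) :
    Commute (skipRefl cs p) (skipRefl cs q) := by
  apply geom_injective cs
  ext1 x
  have h' := (form_symm (skipRoot cs q) (skipRoot cs p)).trans h
  simp only [geom_mul_apply, geom_skipRefl, map_sub, map_smul, h, h']
  module

/-- Negative skips are orthogonal to later positive ones. As there is one skip per letter, this
exhibits `nc` as part of a factorization of `c` into as many reflections as there are letters. -/
theorem Sorting.wordProd_eq_mul_ncProd [Finite W] {a ω : List B} {L : List (W × B)}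
    (h : Sorting cs a ω L) (ha : a.Nodup) :
    ∃ l : List W, (∀ t ∈ l, cs.IsReflection t) ∧
      l.length + (negSkips cs L).length = a.length ∧ cs.wordProd a = l.prod * ncProd cs L := by
  obtain ⟨l, h1, h2, h3⟩ := prod_filter_eq_mul_ncProd (cs := cs) (L := L)
    ((h.pairwise_form_eq_zero ha).imp fun hpq hp hq =>
      commute_skipRefl (hpq hp ((isRoot_skipRoot _).not_nonpos_iff.1 hq)))
  exact ⟨l, h1, by rw [h2, h.length_eq], by rw [← h.prod_skipRefl, h3]⟩

end NegSkips
end CoxeterSortable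

namespace CoxeterSortable

variable {B W : Type*} [Group W] {M : CoxeterMatrix B} {cs : CoxeterSystem M W}

/-! ### Factorizations into reflections -/

/-- `x` is a product of `k` reflections. -/
def HasTLength (cs : CoxeterSystem M W) (x : W) (k : ℕ) : Prop :=
  ∃ l : List W, IsTWord cs x l ∧ l.length = k

theorem HasTLength.mul {x y : W} {k m : ℕ} (hx : HasTLength cs x k) (hy : HasTLength cs y m) :
    HasTLength cs (x * y) (k + m) := by
  obtain ⟨l, ⟨h1, h2⟩, h3⟩ := hx
  obtain ⟨l', ⟨h1', h2'⟩, h3'⟩ := hy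
  refine ⟨l ++ l', ⟨?_, by rw [List.prod_append, h2, h2']⟩, by rw [List.length_append, h3, h3']⟩
  intro t ht
  rcases List.mem_append.1 ht with ht | ht
  · exact h1 t ht
  · exact h1' t ht

theorem HasTLength.conj {x : W} {k : ℕ} (hx : HasTLength cs x k) (g : W) :
    HasTLength cs (g * x * g⁻¹) k := by
  obtain ⟨l, ⟨h1, h2⟩, h3⟩ := hx
  refine ⟨l.map (MulAut.conj g), ⟨?_, ?_⟩, by simpa using h3⟩
  · intro t ht
    obtain ⟨u, hu, rfl⟩ := List.mem_map.1 ht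
    exact (h1 u hu).conj g
  · rw [← map_list_prod, h2, MulAut.conj_apply]

theorem HasTLength.conj_simple {x : W} {k : ℕ} (hx : HasTLength cs x k) (s : B) :
    HasTLength cs (cs.simple s * x * cs.simple s) k := by
  have := hx.conj (cs.simple s)
  rwa [cs.inv_simple] at this

theorem hasTLength_one : HasTLength cs 1 0 := ⟨[], ⟨by simp, rfl⟩, rfl⟩

theorem _root_.CoxeterSystem.IsReflection.hasTLength {t : W} (ht : cs.IsReflection t) :
    HasTLength cs t 1 := ⟨[t], ⟨by simpa using ht, by simp⟩, rfl⟩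

theorem hasTLength_simple (s : B) : HasTLength cs (cs.simple s) 1 :=
  (cs.isReflection_simple s).hasTLength

theorem hasTLength_wordProd (a : List B) : HasTLength cs (cs.wordProd a) a.length := by
  refine ⟨a.map cs.simple, ⟨?_, rfl⟩, by simp⟩
  intro t ht
  obtain ⟨i, _, rfl⟩ := List.mem_map.1 ht
  exact cs.isReflection_simple i

theorem exists_map_skipRefl {l : List W} (h : ∀ t ∈ l, cs.IsReflection t) :
    ∃ ps : List (W × B), ps.map (skipRefl cs) = l := by
  induction l with
  | nil => exact ⟨[], rfl⟩
  | cons t l ih =>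
    obtain ⟨ps, hps⟩ := ih fun t ht => h t (List.mem_cons_of_mem _ ht)
    obtain ⟨w, i, hw⟩ := h t List.mem_cons_self
    exact ⟨(w, i) :: ps, by rw [List.map_cons, hps, skipRefl, ← hw]⟩

/-- The skips of the identity have the simple roots of `a` as their roots, so results on triangular
lists of skips apply to `a` itself. -/
theorem sorting_nil (a : List B) : Sorting cs a [] (a.map fun i => (1, i)) := by
  induction a with
  | nil => exact Sorting.nil
  | cons s a ih => exact ih.skip

/-! ### Fixed spaces and spans of roots. -/

section Span

variable [Fintype B] [DecidableEq B]

/-- For a positive definite form a subspace is its own double orthogonal complement. -/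
theorem mem_span_of_form_eq_zero (cs : CoxeterSystem M W) [Finite W] {S : Set (B → ℝ)} {x : B → ℝ}
    (h : ∀ y, (∀ z ∈ S, form M y z = 0) → form M y x = 0) : x ∈ Submodule.span ℝ S := by
  have hnd : (form M).Nondegenerate := by
    constructor
    · exact fun x hx => form_self_eq_zero cs (hx x)
    · exact fun x hx => form_self_eq_zero cs (hx x)
  have hrefl : (form M).IsRefl := fun x y hxy => by rw [form_symm, hxy]
  rw [← LinearMap.BilinForm.orthogonal_orthogonal hnd hrefl (Submodule.span ℝ S)]
  intro y hy
  refine h y fun z hz => ?_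
  rw [form_symm]
  exact hy z (Submodule.subset_span hz)

theorem geom_prod_skipRefl_of_orthogonal {ps : List (W × B)} {y : B → ℝ}
    (h : ∀ p ∈ ps, form M y (skipRoot cs p) = 0) :
    geom cs (ps.map (skipRefl cs)).prod y = y := by
  induction ps with
  | nil => simp
  | cons p ps ih =>
    rw [List.map_cons, List.prod_cons, geom_mul_apply, ih fun q hq => h q (List.mem_cons_of_mem _ hq),
      geom_skipRefl, h p List.mem_cons_self]
    module

theorem geom_prod_skipRefl_sub_mem (ps : List (W × B)) (y : B → ℝ) :
    geom cs (ps.map (skipRefl cs)).prod y - y ∈ Submodule.span ℝ (skipRoots cs ps) := by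
  induction ps with
  | nil => simp
  | cons p ps ih =>
    rw [List.map_cons, List.prod_cons, geom_mul_apply, geom_skipRefl]
    set z := geom cs (ps.map (skipRefl cs)).prod y
    have h1 : z - y ∈ Submodule.span ℝ (skipRoots cs (p :: ps)) := by
      refine Submodule.span_mono ?_ ih
      rintro _ ⟨q, hq, rfl⟩
      exact ⟨q, List.mem_cons_of_mem _ hq, rfl⟩
    have h2 : skipRoot cs p ∈ Submodule.span ℝ (skipRoots cs (p :: ps)) :=
      Submodule.subset_span ⟨p, List.mem_cons_self, rfl⟩
    rw [sub_right_comm]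
    exact sub_mem h1 (Submodule.smul_mem _ _ h2)

/-- The fixed vectors of a product of reflections which is triangular for the Euler form. -/
theorem form_eq_zero_of_fixed {a : List B} (ha : a.Nodup) {ps : List (W × B)}
    (hsupp : ∀ p ∈ ps, skipRoot cs p ∈ supp a)
    (hpw : ps.Pairwise fun p q => euler M a (skipRoot cs p) (skipRoot cs q) = 0) {y : B → ℝ}
    (hy : geom cs (ps.map (skipRefl cs)).prod y = y) :
    ∀ p ∈ ps, form M y (skipRoot cs p) = 0 := by
  induction ps with
  | nil => simp
  | cons p ps ih =>
    rw [List.pairwise_cons] at hpw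
    rw [List.map_cons, List.prod_cons, geom_mul_apply] at hy
    set z := geom cs (ps.map (skipRefl cs)).prod y with hz
    have h1 : z = geom cs (skipRefl cs p) y := by
      rw [← hy, ← geom_mul_apply]
      have : skipRefl cs p * skipRefl cs p = 1 := (isReflection_skipRefl cs p).mul_self
      rw [this, geom_one_apply]
    -- Put `z` for the image of `y` under the later factors. Then `z` is also the reflection of `y`
    -- in `p`, so `z - y` is a multiple of the root of `p`. It lies in the span of the later roots
    -- too, which `E(p, ·)` kills, while `E(p, p) = 1`.
    have h2 : euler M a (skipRoot cs p) (z - y) = 0 := by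
      have hle : Submodule.span ℝ (skipRoots cs ps) ≤
          LinearMap.ker (euler M a (skipRoot cs p)) := by
        rw [Submodule.span_le]
        rintro _ ⟨q, hq, rfl⟩
        exact hpw.1 q hq
      exact hle (geom_prod_skipRefl_sub_mem ps y)
    rw [h1, geom_skipRefl] at h2
    have hself : euler M a (skipRoot cs p) (skipRoot cs p) = 1 := by
      rw [euler_self ha (hsupp p List.mem_cons_self), (isRoot_skipRoot p).form_self]
      norm_num
    have h3 : form M y (skipRoot cs p) = 0 := by
      rw [sub_sub_cancel_left, map_neg, map_smul, hself] at h2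
      simpa using h2
    intro q hq
    rcases List.mem_cons.1 hq with rfl | hq
    · exact h3
    · refine ih (fun q hq => hsupp q (List.mem_cons_of_mem _ hq)) hpw.2 ?_ q hq
      rw [h1, geom_skipRefl, h3]
      module

theorem form_e_eq_zero_of_fixed {a : List B} (ha : a.Nodup) {y : B → ℝ}
    (hy : geom cs (cs.wordProd a) y = y) : ∀ i ∈ a, form M y (e i) = 0 := by
  have h := sorting_nil (cs := cs) a
  intro i hi
  have := form_eq_zero_of_fixed ha h.skipRoot_mem_supp (h.pairwise_euler ha)
    (by rwa [h.prod_skipRefl]) (1, i) (List.mem_map.2 ⟨i, hi, rfl⟩)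
  rwa [skipRoot_one] at this

theorem supp_eq_span (a : List B) : supp a = Submodule.span ℝ (e '' {i | i ∈ a}) := by
  apply le_antisymm
  · intro x hx
    rw [← sum_smul_e x]
    refine sum_mem fun i _ => ?_
    by_cases hi : i ∈ a
    · exact Submodule.smul_mem _ _ (Submodule.subset_span ⟨i, hi, rfl⟩)
    · rw [hx i hi, zero_smul]; exact zero_mem _
  · rw [Submodule.span_le]
    rintro _ ⟨i, hi, rfl⟩
    exact e_mem_supp hi

theorem finrank_supp {a : List B} (ha : a.Nodup) : Module.finrank ℝ (supp a) = a.length := by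
  have hli : LinearIndependent ℝ (fun i : B => (e i : B → ℝ)) := by
    have := (Pi.basisFun ℝ B).linearIndependent
    convert this using 2
    simp [e]
  have hli' : LinearIndependent ℝ (fun i : a.toFinset => (e i.1 : B → ℝ)) :=
    hli.comp _ Subtype.val_injective
  have h := finrank_span_eq_card hli'
  rw [Fintype.card_coe, List.toFinset_card_of_nodup ha] at h
  have hset : e '' {i | i ∈ a} = Set.range fun i : a.toFinset => (e i.1 : B → ℝ) := by
    ext x
    simp
  rw [supp_eq_span, hset, h]

/-- A vector orthogonal to all roots of the factorization is fixed by the product, hence orthogonal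
to the simple roots of the letters of `a`. -/
theorem supp_le_span_skipRoots [Finite W] {a : List B} (ha : a.Nodup) {ps : List (W × B)}
    (h : (ps.map (skipRefl cs)).prod = cs.wordProd a) :
    supp a ≤ Submodule.span ℝ (skipRoots cs ps) := by
  rw [supp_eq_span, Submodule.span_le]
  rintro _ ⟨i, hi, rfl⟩
  refine mem_span_of_form_eq_zero cs fun y hy => ?_
  refine form_e_eq_zero_of_fixed ha (cs := cs) ?_ i hi
  rw [← h]
  exact geom_prod_skipRefl_of_orthogonal fun p hp => hy _ ⟨p, hp, rfl⟩

theorem finrank_span_skipRoots_le (ps : List (W × B)) :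
    Module.finrank ℝ (Submodule.span ℝ (skipRoots cs ps)) ≤ ps.length := by
  rw [← coe_skipFinset]
  refine (finrank_span_finset_le_card _).trans ?_
  refine (List.toFinset_card_le _).trans ?_
  simp

/-- The product of a word of distinct letters is not a product of fewer reflections. -/
theorem HasTLength.length_le [Finite W] {a : List B} (ha : a.Nodup) {k : ℕ}
    (h : HasTLength cs (cs.wordProd a) k) : a.length ≤ k := by
  obtain ⟨l, ⟨h1, h2⟩, rfl⟩ := h
  obtain ⟨ps, rfl⟩ := exists_map_skipRefl h1
  rw [← finrank_supp ha, List.length_map]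
  exact (Submodule.finrank_mono (supp_le_span_skipRoots ha h2)).trans (finrank_span_skipRoots_le ps)

/-- In a factorization with as many reflections as letters, the span of the roots contains `supp a`
and has no larger dimension, so it equals `supp a`. -/
theorem skipRoot_mem_supp_of_prod_eq [Finite W] {a : List B} (ha : a.Nodup) {ps : List (W × B)}
    (h : (ps.map (skipRefl cs)).prod = cs.wordProd a) (hlen : ps.length = a.length) :
    ∀ p ∈ ps, skipRoot cs p ∈ supp a := by
  have heq : supp a = Submodule.span ℝ (skipRoots cs ps) := by
    refine Submodule.eq_of_le_of_finrank_le (supp_le_span_skipRoots ha h) ?_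
    rw [finrank_supp ha, ← hlen]
    exact finrank_span_skipRoots_le ps
  intro p hp
  rw [heq]
  exact Submodule.subset_span ⟨p, hp, rfl⟩

/-! ### Injectivity -/

/-- The negative skips are triangular for the Euler form, so vectors fixed by their product are
orthogonal to their roots. Thus `ncProd` determines the span of the cover roots. -/
theorem Sorting.mem_span_negSkips [Finite W] {a ω : List B} {L L' : List (W × B)}
    (h : Sorting cs a ω L) (ha : a.Nodup) (heq : ncProd cs L = ncProd cs L') :
    ∀ p ∈ negSkips cs L, skipRoot cs p ∈ Submodule.span ℝ (skipRoots cs (negSkips cs L')) := by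
  intro p hp
  refine mem_span_of_form_eq_zero cs fun y hy => ?_
  refine form_eq_zero_of_fixed ha (ps := negSkips cs L) ?_ ?_ ?_ p hp
  · exact fun q hq => h.skipRoot_mem_supp q (mem_negSkips.1 hq).1
  · exact (h.pairwise_euler ha).sublist List.filter_sublist
  · change geom cs (ncProd cs L) y = y
    rw [heq]
    exact geom_prod_skipRefl_of_orthogonal fun p hp => hy _ ⟨p, hp, rfl⟩

/-- A simple left descent whose root is a combination of cover roots is a cover reflection. -/
theorem Sorting.neg_e_mem_of_mem_span [Finite W] {a ω : List B} {s : B} {L : List (W × B)}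
    (h : Sorting cs a ω L) (ha : a.Nodup) (hd : cs.IsLeftDescent (cs.wordProd ω) s)
    (hs : -e s ∈ Submodule.span ℝ (skipRoots cs (negSkips cs L))) : -e s ∈ skipRoots cs L := by
  rw [← coe_skipFinset, Submodule.mem_span_finset] at hs
  obtain ⟨f, -, hf⟩ := hs
  have hN : ∀ x ∈ skipFinset cs (negSkips cs L), x ∈ skipRoots cs L ∧ x ≤ 0 := by
    intro x hx
    obtain ⟨p, hp, rfl⟩ := mem_skipFinset.1 hx
    exact ⟨⟨p, (mem_negSkips.1 hp).1, rfl⟩, (mem_negSkips.1 hp).2⟩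
  refine (hN _ (neg_e_mem_of_sum (cs := cs) (R := skipFinset cs (negSkips cs L)) (f := f) ?_ ?_ hf)).1
  · exact fun x hx => ⟨isRoot_of_mem_skipRoots (hN x hx).1, (hN x hx).2⟩
  · intro x hx
    obtain ⟨hx1, hx0⟩ := hN x hx
    obtain ⟨r, hr⟩ := (h.mem_skipRoots_iff ha hx0).1 hx1
    -- Applying `w⁻¹`, where `w` is the product of `ω`, turns the cover roots into distinct simple
    -- roots. The coefficient of `x = w(e r)` is therefore the coordinate at `r` of `w⁻¹(-e s)`,
    -- nonnegative because `s` is a left descent.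
    have h1 := congrFun (congrArg (geom cs (cs.wordProd ω)⁻¹) hf) r
    rw [map_sum, Finset.sum_apply, Finset.sum_eq_single x] at h1
    · rw [map_smul, ← hr, geom_inv_apply_self, Pi.smul_apply, e_same, smul_eq_mul, mul_one, hr] at h1
      rw [h1, map_neg, Pi.neg_apply]
      exact neg_nonneg.2 (isLeftDescent_iff_geom_inv_nonpos.1 hd r)
    · intro y hy hyx
      obtain ⟨hy1, hy0⟩ := hN y hy
      obtain ⟨r', hr'⟩ := (h.mem_skipRoots_iff ha hy0).1 hy1
      have hrr : r ≠ r' := by rintro rfl; exact hyx (hr'.symm.trans hr)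
      rw [map_smul, ← hr', geom_inv_apply_self, Pi.smul_apply, e_ne hrr, smul_zero]
    · exact fun hx' => absurd hx hx'

/-- A simple left descent occurs in some cover root. -/
theorem Sorting.exists_negSkip_of_isLeftDescent [Finite W] {a ω : List B} {s : B}
    {L : List (W × B)} (h : Sorting cs a ω L) (ha : a.Nodup)
    (hd : cs.IsLeftDescent (cs.wordProd ω) s) : ∃ p ∈ negSkips cs L, skipRoot cs p s ≠ 0 := by
  by_contra! hcon
  obtain ⟨f, hf0, hf⟩ := exists_nonneg_of_mem_cone
    (h.neg_mem_cone ha (isRoot_e s) (e_nonneg s) (isLeftDescent_iff_geom_inv_nonpos.1 hd))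
  have h1 := congrFun hf s
  rw [Finset.sum_apply, Pi.neg_apply, e_same] at h1
  have h2 : 0 ≤ ∑ x ∈ skipFinset cs L, (f x • x) s := by
    refine Finset.sum_nonneg fun x hx => ?_
    obtain ⟨p, hp, rfl⟩ := mem_skipFinset.1 hx
    rcases (isRoot_skipRoot (cs := cs) p).nonneg_or_nonpos with h0 | h0
    · exact mul_nonneg (hf0 _) (h0 s)
    · rw [Pi.smul_apply, hcon p (mem_negSkips.2 ⟨hp, h0⟩), smul_zero]
  linarith

/-- If `s` is skipped, all cover roots are supported off `s`; if `s` is a left descent, some cover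
root involves `s`. The two spans cannot agree. -/
theorem Sorting.ncProd_skip_ne_use [Finite W] {a ω ω' : List B} {s : B} {L L' : List (W × B)}
    (h : Sorting cs a ω L) (h' : Sorting cs (s :: a) ω' L') (ha : (s :: a).Nodup)
    (hd : cs.IsLeftDescent (cs.wordProd ω') s) : ncProd cs L ≠ ncProd cs L' := by
  intro heq
  obtain ⟨p, hp, hps⟩ := h'.exists_negSkip_of_isLeftDescent ha hd
  apply hps
  have h1 := h'.mem_span_negSkips ha heq.symm p hp
  have h2 : Submodule.span ℝ (skipRoots cs (negSkips cs L)) ≤ supp a := by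
    rw [Submodule.span_le]
    rintro _ ⟨q, hq, rfl⟩
    exact h.skipRoot_mem_supp q (mem_negSkips.1 hq).1
  exact h2 h1 s (List.nodup_cons.1 ha).1

theorem Sorting.isLeftDescent_cons {ω : List B} {s : B}
    (hd : ¬ cs.IsLeftDescent (cs.wordProd ω) s) :
    cs.IsLeftDescent (cs.wordProd (s :: ω)) s := by
  rw [cs.isLeftDescent_iff_not_isLeftDescent_mul, cs.wordProd_cons,
    cs.simple_mul_simple_cancel_left]
  exact hd

/-- Whether `-e s` is a cover root after using `s` can be read off from the span of the cover roots,
which `ncProd` determines. -/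
theorem Sorting.e_mem_of_ncProd_eq [Finite W] {a ω ω' : List B} {s : B} {L L' : List (W × B)}
    (h : Sorting cs (a ++ [s]) ω L) (hd : ¬ cs.IsLeftDescent (cs.wordProd ω) s)
    (h' : Sorting cs (a ++ [s]) ω' L') (hd' : ¬ cs.IsLeftDescent (cs.wordProd ω') s)
    (ha : (s :: a).Nodup)
    (heq : ncProd cs (L.map (shift cs s)) = ncProd cs (L'.map (shift cs s)))
    (hs : e s ∈ skipRoots cs L) : e s ∈ skipRoots cs L' := by
  have hm : ∀ L : List (W × B), -e s ∈ skipRoots cs (L.map (shift cs s)) ↔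
      e s ∈ skipRoots cs L := by
    intro L
    rw [mem_skipRoots_map_shift, map_neg, geom_simple_e, neg_neg]
  rw [← hm] at hs ⊢
  obtain ⟨p, hp, hps⟩ := hs
  refine (h'.use hd').neg_e_mem_of_mem_span ha (Sorting.isLeftDescent_cons hd') ?_
  rw [← hps]
  refine (h.use hd).mem_span_negSkips ha heq p (mem_negSkips.2 ⟨hp, ?_⟩)
  rw [hps]
  exact neg_e_nonpos s

/-- The product of the cover reflections determines a sortable element. -/
theorem Sorting.eq_of_ncProd_eq [Finite W] {a ω ω' : List B} {L L' : List (W × B)}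
    (h : Sorting cs a ω L) (h' : Sorting cs a ω' L') (ha : a.Nodup)
    (heq : ncProd cs L = ncProd cs L') : ω = ω' := by
  induction h generalizing ω' L' with
  | nil => cases h'; rfl
  | @skip s a ω L h ih =>
    have hn : ∀ L, ncProd cs ((1, s) :: L) = ncProd cs L := fun L => by
      rw [ncProd, negSkips_cons_one, ncProd]
    rw [hn] at heq
    cases h' with
    | skip h' =>
      rw [hn] at heq
      exact ih h' (List.nodup_cons.1 ha).2 heq
    | use h' hd' =>
      exact absurd heq (h.ncProd_skip_ne_use (h'.use hd') ha (Sorting.isLeftDescent_cons hd'))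
  | @use s a ω L h hd ih =>
    have ha' := nodup_append_singleton.2 ha
    cases h' with
    | @skip _ _ _ L' h' =>
      have hn : ncProd cs ((1, s) :: L') = ncProd cs L' := by
        rw [ncProd, negSkips_cons_one, ncProd]
      rw [hn] at heq
      exact absurd heq.symm (h'.ncProd_skip_ne_use (h.use hd) ha (Sorting.isLeftDescent_cons hd))
    | @use _ _ ω' L' h' hd' =>
      congr 1
      refine ih h' ha' ?_
      by_cases hs : e s ∈ skipRoots cs L
      · have hs' := h.e_mem_of_ncProd_eq hd h' hd' ha heq hs
        rw [(h.negSkips_map_shift_of_mem ha hd hs).2,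
          (h'.negSkips_map_shift_of_mem ha hd' hs').2] at heq
        exact mul_right_cancel heq
      · have hs' : e s ∉ skipRoots cs L' := fun hs' =>
          hs (h'.e_mem_of_ncProd_eq hd' h hd ha heq.symm hs')
        rw [h.ncProd_map_shift_of_notMem ha' hd hs,
          h'.ncProd_map_shift_of_notMem ha' hd' hs'] at heq
        exact mul_left_cancel (mul_right_cancel heq)

end Span
end CoxeterSortable

namespace CoxeterSortable

variable {B W : Type*} [Group W] {M : CoxeterMatrix B} {cs : CoxeterSystem M W}

/-! ### Surjectivity -/

section Surjectivity

variable [Fintype B] [DecidableEq B]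

/-- Under repeated rotation of the word, the root becomes the simple root of the first letter. -/
inductive Reach (cs : CoxeterSystem M W) : List B → (B → ℝ) → Prop
  | base (s : B) (a : List B) : Reach cs (s :: a) (e s)
  | step {s : B} {a : List B} {x : B → ℝ} :
      Reach cs (a ++ [s]) (geom cs (cs.simple s) x) → Reach cs (s :: a) x

/-- As long as the root differs from the simple root of the current first letter, that reflection
keeps it positive; this is iterated along `b`. -/
theorem not_reach_rotate {b a : List B} {x : B → ℝ} (hx : IsRoot cs x) (h0 : 0 ≤ x)
    (h : ¬ Reach cs (b ++ a) x) :
    ¬ Reach cs (a ++ b) (geom cs (cs.wordProd b)⁻¹ x) ∧ 0 ≤ geom cs (cs.wordProd b)⁻¹ x := by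
  induction b generalizing a x with
  | nil =>
    rw [cs.wordProd_nil, inv_one, geom_one_apply]
    simpa using ⟨h, h0⟩
  | cons s b ih =>
    rw [List.cons_append] at h
    have hne : x ≠ e s := by rintro rfl; exact h (Reach.base s _)
    have h1 : ¬ Reach cs (b ++ (a ++ [s])) (geom cs (cs.simple s) x) := fun h' => h (by
      rw [← List.append_assoc] at h'
      exact Reach.step h')
    have h2 := ih (hx.geom (cs.simple s)) (hx.simple_nonneg h0 hne) h1
    rw [cs.wordProd_cons, mul_inv_rev, geom_mul_apply, cs.inv_simple]
    rwa [List.append_assoc, List.singleton_append] at h2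

theorem form_self_eq_zero_of_fixed {a : List B} (ha : a.Nodup) {y : B → ℝ} (hsupp : y ∈ supp a)
    (hy : geom cs (cs.wordProd a) y = y) : form M y y = 0 := by
  have h := form_e_eq_zero_of_fixed ha hy
  nth_rw 2 [← sum_smul_e y]
  rw [map_sum]
  refine Finset.sum_eq_zero fun i _ => ?_
  rw [map_smul]
  by_cases hi : i ∈ a
  · rw [h i hi, smul_zero]
  · rw [hsupp i hi, zero_smul]

/-- Every positive root reaches the front of the word, since the product of the word has no nonzero
fixed vector in its support. -/
theorem reach_of_nonneg [Finite W] {a : List B} (ha : a.Nodup) {x : B → ℝ} (hx : IsRoot cs x)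
    (h0 : 0 ≤ x) (hsupp : x ∈ supp a) : Reach cs a x := by
  by_contra hcon
  set c := cs.wordProd a with hc
  have hiter : ∀ j : ℕ, ¬ Reach cs a (geom cs (c⁻¹ ^ j) x) ∧ 0 ≤ geom cs (c⁻¹ ^ j) x := by
    intro j
    induction j with
    | zero => rw [pow_zero, geom_one_apply]; exact ⟨hcon, h0⟩
    | succ j ih =>
      have := not_reach_rotate (b := a) (a := []) (hx.geom (c⁻¹ ^ j)) ih.2 (by simpa using ih.1)
      rw [pow_succ', geom_mul_apply]
      simpa using this
  have hm : 0 < orderOf c⁻¹ := orderOf_pos c⁻¹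
  obtain ⟨m, hm'⟩ : ∃ m, orderOf c⁻¹ = m + 1 := ⟨orderOf c⁻¹ - 1, by omega⟩
  -- The sum over a full period of powers of `c⁻¹` is fixed by `c`, and it is at least `x` because
  -- all its terms are nonnegative.
  set y := ∑ j ∈ Finset.range (m + 1), geom cs (c⁻¹ ^ j) x with hy
  have hfix : geom cs c⁻¹ y = y := by
    have h1 : geom cs c⁻¹ y = ∑ j ∈ Finset.range (m + 1), geom cs (c⁻¹ ^ (j + 1)) x := by
      rw [hy, map_sum]
      exact Finset.sum_congr rfl fun j _ => by rw [pow_succ', geom_mul_apply]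
    have h2 : geom cs (c⁻¹ ^ (m + 1)) x = geom cs (c⁻¹ ^ 0) x := by
      rw [← hm', pow_orderOf_eq_one, pow_zero]
    rw [h1, Finset.sum_range_succ, h2, hy, Finset.sum_range_succ' _ m]
  have hfix' : geom cs c y = y := by
    conv_lhs => rw [← hfix]
    rw [geom_apply_inv_self]
  have hinv : ∀ j : ℕ, geom cs (c⁻¹ ^ j) x ∈ supp a := by
    intro j
    induction j with
    | zero => rwa [pow_zero, geom_one_apply]
    | succ j ih =>
      rw [pow_succ', geom_mul_apply]
      generalize geom cs (c⁻¹ ^ j) x = z at ih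
      rw [hc, ← cs.wordProd_reverse]
      exact geom_wordProd_mem_supp cs (by simp) ih
  have hy0 : y = 0 := form_self_eq_zero cs
    (form_self_eq_zero_of_fixed ha (sum_mem fun j _ => hinv j) hfix')
  have hle : x ≤ y := by
    rw [hy, Finset.sum_range_succ', pow_zero, geom_one_apply]
    exact le_add_of_nonneg_left (Finset.sum_nonneg fun j _ => (hiter _).2)
  rw [hy0] at hle
  exact hx.ne_zero (le_antisymm hle h0)

/-- `x` has a factorization into `k` reflections which extends to a factorization of the product
of `a` into as many reflections as `a` has letters. -/
def IsBelow (cs : CoxeterSystem M W) (a : List B) (k : ℕ) (x : W) : Prop :=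
  ∃ m, HasTLength cs x k ∧ HasTLength cs (x⁻¹ * cs.wordProd a) m ∧ k + m = a.length

theorem IsBelow.le [Finite W] {a : List B} (ha : a.Nodup) {k m : ℕ} {x : W}
    (h : IsBelow cs a k x) (hm : HasTLength cs x m) : k ≤ m := by
  obtain ⟨k', -, h2, h3⟩ := h
  have := hm.mul h2
  rw [mul_inv_cancel_left] at this
  have := this.length_le ha
  omega

theorem hasTLength_ncProd (L : List (W × B)) :
    HasTLength cs (ncProd cs L) (negSkips cs L).length := by
  refine ⟨(negSkips cs L).map (skipRefl cs), ⟨?_, rfl⟩, by simp⟩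
  intro t ht
  obtain ⟨p, -, rfl⟩ := List.mem_map.1 ht
  exact isReflection_skipRefl cs p

theorem Sorting.isBelow [Finite W] {a ω : List B} {L : List (W × B)} (h : Sorting cs a ω L)
    (ha : a.Nodup) : IsBelow cs a (negSkips cs L).length (ncProd cs L) := by
  obtain ⟨l, h1, h2, h3⟩ := h.wordProd_eq_mul_ncProd ha
  refine ⟨l.length, hasTLength_ncProd L, ?_, by omega⟩
  have : HasTLength cs l.prod l.length := ⟨l, ⟨h1, rfl⟩, rfl⟩
  have := this.conj (ncProd cs L)⁻¹
  rwa [inv_inv, mul_assoc, ← h3] at this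

/-- One factor of `ncProd` is `s`. Moving it to the front conjugates the factors before it, and
there it cancels. -/
theorem hasTLength_simple_mul_ncProd {s : B} {L : List (W × B)} (h : -e s ∈ skipRoots cs L) :
    ∃ m, HasTLength cs (cs.simple s * ncProd cs L) m ∧ m + 1 = (negSkips cs L).length := by
  obtain ⟨p, hp, hps⟩ := h
  have hp' : p ∈ negSkips cs L := mem_negSkips.2 ⟨hp, by rw [hps]; exact neg_e_nonpos s⟩
  obtain ⟨l₁, l₂, hl⟩ := List.append_of_mem hp'
  have hT : ∀ l : List (W × B), HasTLength cs (l.map (skipRefl cs)).prod l.length := by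
    intro l
    refine ⟨l.map (skipRefl cs), ⟨?_, rfl⟩, by simp⟩
    intro t ht
    obtain ⟨p, -, rfl⟩ := List.mem_map.1 ht
    exact isReflection_skipRefl cs p
  refine ⟨l₁.length + l₂.length, ?_, by rw [hl]; simp; omega⟩
  have := ((hT l₁).conj_simple s).mul (hT l₂)
  rw [ncProd, hl, List.map_append, List.prod_append, List.map_cons, List.prod_cons,
    skipRefl_eq_simple (Or.inr hps), ← mul_assoc, ← mul_assoc]
  exact this

/-- The elements coming from sortable elements. -/
def IsNC (cs : CoxeterSystem M W) (a : List B) (x : W) : Prop :=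
  ∃ ω L, Sorting cs a ω L ∧ ncProd cs L = x

theorem IsNC.cons {a : List B} {x : W} (h : IsNC cs a x) (s : B) : IsNC cs (s :: a) x := by
  obtain ⟨ω, L, h1, h2⟩ := h
  exact ⟨ω, _, h1.skip, by rw [ncProd, negSkips_cons_one, ← h2, ncProd]⟩

theorem wordProd_rotate (s : B) (a : List B) :
    cs.wordProd (a ++ [s]) = cs.simple s * cs.wordProd (s :: a) * cs.simple s := by
  rw [cs.wordProd_append, cs.wordProd_singleton, cs.wordProd_cons,
    cs.simple_mul_simple_cancel_left]

/-- The case of an element having the initial simple reflection as a factor. -/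
theorem isNC_of_isBelow_simple_mul [Finite W] {a : List B} {s : B} (ha : (s :: a).Nodup) {y : W}
    {k m : ℕ} (hy : HasTLength cs y k) (hz : HasTLength cs (y⁻¹ * cs.wordProd a) m)
    (hkm : k + m = a.length) (ih₁ : ∀ x k, IsBelow cs a k x → IsNC cs a x)
    (ih₂ : ∀ x, IsBelow cs (a ++ [s]) k x → IsNC cs (a ++ [s]) x) :
    IsNC cs (s :: a) (cs.simple s * y) := by
  have ha' := nodup_append_singleton.2 ha
  have hbelow : IsBelow cs (a ++ [s]) k (cs.simple s * y * cs.simple s) := by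
    refine ⟨1 + m, hy.conj_simple s, ?_, by simp; omega⟩
    have h1 := ((((hasTLength_simple (cs := cs) s).conj y⁻¹).mul hz).conj_simple s)
    rw [cs.wordProd_append, cs.wordProd_singleton]
    have h2 : (cs.simple s * y * cs.simple s)⁻¹ * (cs.wordProd a * cs.simple s) =
        cs.simple s * (y⁻¹ * cs.simple s * y⁻¹⁻¹ * (y⁻¹ * cs.wordProd a)) * cs.simple s := by
      simp [mul_assoc]
    rw [h2]
    exact h1
  obtain ⟨ω, L, h, hL⟩ := ih₂ _ hbelow
  have hlen : (negSkips cs L).length ≤ k := by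
    refine (h.isBelow ha').le ha' ?_
    rw [hL]; exact hy.conj_simple s
  -- A left descent `s` would be a factor of `s y s`, giving `s y`, and then the product of `s ::
  -- a`, too few reflections.
  have hd : ¬ cs.IsLeftDescent (cs.wordProd ω) s := by
    intro hd
    obtain ⟨j, hj, hjl⟩ := hasTLength_simple_mul_ncProd (h.neg_e_mem_skipRoots ha hd)
    rw [hL, mul_assoc (cs.simple s) y, cs.simple_mul_simple_cancel_left] at hj
    have h1 := (hj.conj_simple s).mul hz
    have h2 : cs.simple s * (y * cs.simple s) * cs.simple s * (y⁻¹ * cs.wordProd a) =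
        cs.wordProd (s :: a) := by
      rw [cs.wordProd_cons]; simp [mul_assoc]
    rw [h2] at h1
    have := h1.length_le ha
    simp at this
    omega
  by_cases hs : e s ∈ skipRoots cs L
  · refine ⟨_, _, h.use hd, ?_⟩
    rw [(h.negSkips_map_shift_of_mem ha hd hs).2, hL, cs.simple_mul_simple_cancel_right]
  -- If `e s` were not a skip, using `s` would produce `y`. But `y` also comes from an element that
  -- skips `s`, which is impossible.
  · have h1 := h.ncProd_map_shift_of_notMem ha' hd hs
    rw [hL, mul_assoc (cs.simple s) y, cs.simple_mul_simple_cancel_left,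
      cs.simple_mul_simple_cancel_right] at h1
    obtain ⟨ω', L', h', hL'⟩ := ih₁ y k ⟨m, hy, hz, hkm⟩
    exact absurd (hL'.trans h1.symm)
      (h'.ncProd_skip_ne_use (h.use hd) ha (Sorting.isLeftDescent_cons hd))

/-- The case of an element which neither has the initial simple reflection as a factor nor lies
below the word without it. -/
theorem isNC_of_isNC_rotate [Finite W] {a : List B} {s : B} (ha : (s :: a).Nodup) {x : W} {k : ℕ}
    (hx : IsBelow cs (s :: a) k x) (h₁ : ¬ IsBelow cs a k x)
    (h₂ : ∀ j, j + 1 = k → ¬ HasTLength cs (cs.simple s * x) j)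
    (hnc : IsNC cs (a ++ [s]) (cs.simple s * x * cs.simple s)) : IsNC cs (s :: a) x := by
  have ha' := nodup_append_singleton.2 ha
  obtain ⟨ω, L, h, hL⟩ := hnc
  have hxk : HasTLength cs x k := by obtain ⟨m, h1, -, -⟩ := hx; exact h1
  have hlen : (negSkips cs L).length = k := by
    apply le_antisymm
    · refine (h.isBelow ha').le ha' ?_
      rw [hL]; exact hxk.conj_simple s
    · refine hx.le ha ?_
      have := (hasTLength_ncProd (cs := cs) L).conj_simple s
      rw [hL] at this
      simpa [mul_assoc] using this
  have hd : ¬ cs.IsLeftDescent (cs.wordProd ω) s := by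
    -- A left descent `s` would be a factor of `s x s`, hence of `x`, which `h₂` excludes.
    intro hd
    obtain ⟨j, hj, hjl⟩ := hasTLength_simple_mul_ncProd (h.neg_e_mem_skipRoots ha hd)
    refine h₂ j (by omega) ?_
    have := hj.conj_simple s
    rw [hL] at this
    simpa [mul_assoc] using this
  by_cases hs : e s ∈ skipRoots cs L
  -- If `e s` is a skip, using `s` produces `s x`, with rank one more than `x`. Its complement is
  -- then also a complement of `x` in the product of `a`, against `h₁`.
  · exfalso
    obtain ⟨h3, h4⟩ := h.negSkips_map_shift_of_mem ha hd hs
    rw [hL, cs.simple_mul_simple_cancel_right] at h4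
    obtain ⟨m, -, h5, h6⟩ := (h.use hd).isBelow ha
    refine h₁ ⟨m, hxk, ?_, ?_⟩
    · rw [h4, cs.wordProd_cons] at h5
      simpa [mul_assoc] using h5
    · rw [h3, hlen] at h6; simp at h6; omega
  · refine ⟨_, _, h.use hd, ?_⟩
    rw [h.ncProd_map_shift_of_notMem ha' hd hs, hL]
    simp [mul_assoc]

/-- Three cases: `x` lies below the word without `s`; or `s` splits off from `x`, leaving an element
of smaller rank; or `x` is conjugated to the rotated word, which is what `hrot` provides. -/
theorem isNC_step [Finite W] {n : ℕ} (ih₁ : ∀ a : List B, a.Nodup → a.length = n →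
      ∀ x k, IsBelow cs a k x → IsNC cs a x) {k : ℕ}
    (ih₂ : ∀ j < k, ∀ a : List B, a.Nodup → a.length = n + 1 →
      ∀ x, IsBelow cs a j x → IsNC cs a x)
    {a : List B} {s : B} (ha : (s :: a).Nodup) (hlen : (s :: a).length = n + 1) {x : W}
    (hx : IsBelow cs (s :: a) k x)
    (hrot : ¬ IsBelow cs a k x → IsNC cs (a ++ [s]) (cs.simple s * x * cs.simple s)) :
    IsNC cs (s :: a) x := by
  have ha' := nodup_append_singleton.2 ha
  have hlen' : a.length = n := by simpa using hlen
  by_cases h₁ : IsBelow cs a k x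
  · exact (ih₁ a (List.nodup_cons.1 ha).2 hlen' x k h₁).cons s
  by_cases h₂ : ∀ j, j + 1 = k → ¬ HasTLength cs (cs.simple s * x) j
  · exact isNC_of_isNC_rotate ha hx h₁ h₂ (hrot h₁)
  push Not at h₂
  obtain ⟨j, hj, hjT⟩ := h₂
  obtain ⟨m, h3, h4, h5⟩ := hx
  have := isNC_of_isBelow_simple_mul ha hjT (m := m) ?_ ?_ (ih₁ a (List.nodup_cons.1 ha).2 hlen')
    (ih₂ j (by omega) _ ha' (by simpa using hlen'))
  · rwa [cs.simple_mul_simple_cancel_left] at this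
  · rw [cs.wordProd_cons] at h4
    simpa [mul_assoc] using h4
  · simp at h5; omega

/-- The reflection `t` in `β` is a factor of the product of `a` complementary to `x`, and it may be
placed first. Rotation follows `β` until it is the simple root of the first letter `s`; then `t = s`
cancels, `x` lies below the word without `s`, and no further rotation is needed. -/
theorem isNC_of_reach [Finite W] {n : ℕ} (ih₁ : ∀ a : List B, a.Nodup → a.length = n →
      ∀ x k, IsBelow cs a k x → IsNC cs a x) {k : ℕ}
    (ih₂ : ∀ j < k, ∀ a : List B, a.Nodup → a.length = n + 1 →
      ∀ x, IsBelow cs a j x → IsNC cs a x)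
    {a : List B} {β : B → ℝ} (hβ : Reach cs a β) (ha : a.Nodup) (hlen : a.length = n + 1) {x t : W}
    (ht : cs.IsReflection t) (hgeom : ∀ y, geom cs t y = y - form M y β • β)
    (hx : HasTLength cs x k) {m : ℕ} (hm : HasTLength cs (x⁻¹ * (t * cs.wordProd a)) m)
    (hkm : k + m + 1 = n + 1) : IsNC cs a x := by
  have hbelow : ∀ {a : List B} {x t : W}, cs.IsReflection t → HasTLength cs x k →
      HasTLength cs (x⁻¹ * (t * cs.wordProd a)) m → a.length = n + 1 → IsBelow cs a k x := by
    intro a x t ht hx hm hlen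
    refine ⟨1 + m, hx, ?_, by omega⟩
    have := (ht.hasTLength.conj x⁻¹).mul hm
    have h2 : x⁻¹ * t * x⁻¹⁻¹ * (x⁻¹ * (t * cs.wordProd a)) = x⁻¹ * cs.wordProd a := by
      have := ht.mul_self
      calc _ = x⁻¹ * (t * t) * cs.wordProd a := by group
        _ = _ := by rw [this, mul_one]
    rwa [h2] at this
  induction hβ generalizing x t with
  | base s a =>
    refine isNC_step ih₁ ih₂ ha hlen (hbelow ht hx hm hlen) fun h => absurd ?_ h
    have hts : t = cs.simple s := by
      apply geom_injective cs
      ext1 y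
      rw [hgeom, geom_simple_apply]
    refine ⟨m, hx, ?_, by simp at hlen; omega⟩
    rwa [hts, cs.wordProd_cons, cs.simple_mul_simple_cancel_left] at hm
  | @step s a β _ ih =>
    refine isNC_step ih₁ ih₂ ha hlen (hbelow ht hx hm hlen) fun _ => ?_
    refine ih (nodup_append_singleton.2 ha) (by simpa using hlen) (t := cs.simple s * t * cs.simple s)
      ?_ ?_ (hx.conj_simple s) ?_
    · have := ht.conj (cs.simple s)
      rwa [cs.inv_simple] at this
    · intro y
      rw [geom_mul_apply, geom_mul_apply, hgeom, map_sub, map_smul, geom_simple_simple,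
        ← form_simple cs s _ β, geom_simple_simple]
    · have := hm.conj_simple s
      rw [wordProd_rotate]
      simpa [mul_assoc] using this

theorem isNC_of_isBelow [Finite W] (n : ℕ) : ∀ a : List B, a.Nodup → a.length = n →
    ∀ x k, IsBelow cs a k x → IsNC cs a x := by
  induction n with
  | zero =>
    rintro a ha hlen x k ⟨m, ⟨l, ⟨-, h2⟩, h3⟩, -, h4⟩
    have ha0 : a = [] := List.length_eq_zero_iff.1 hlen
    have hl : l = [] := List.length_eq_zero_iff.1 (by omega)
    subst ha0 hl
    exact ⟨[], [], Sorting.nil, by simp [ncProd, negSkips, ← h2]⟩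
  | succ n ih₁ =>
    intro a ha hlen x k
    induction k using Nat.strong_induction_on generalizing a x with
    | _ k ih₂ =>
    have ih₂' : ∀ j < k, ∀ a : List B, a.Nodup → a.length = n + 1 →
      ∀ x, IsBelow cs a j x → IsNC cs a x := fun j hj a ha hlen x hx => ih₂ j hj a ha hlen x hx
    rintro ⟨m, hx, ⟨l, ⟨hl1, hl2⟩, hl3⟩, hkm⟩
    cases l with
    -- With an empty complement, `x` is the whole product and its first letter splits off.
    | nil =>
      obtain ⟨s, b, rfl⟩ := List.exists_cons_of_length_eq_add_one hlen
      have hxc : x = cs.simple s * cs.wordProd b := by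
        rw [List.prod_nil, eq_comm, inv_mul_eq_one, cs.wordProd_cons] at hl2
        exact hl2
      have hb : b.length = n := by simpa using hlen
      rw [hxc]
      refine isNC_of_isBelow_simple_mul ha (hasTLength_wordProd b) (m := 0) ?_ rfl
        (ih₁ b (List.nodup_cons.1 ha).2 hb) (ih₂' _ ?_ _ (nodup_append_singleton.2 ha) ?_)
      · rw [inv_mul_cancel]; exact hasTLength_one
      · simp at hl3; simp at hkm; omega
      · simpa using hb
    | cons t l =>
      have ht := hl1 t List.mem_cons_self
      have ht' : cs.IsReflection (x * t * x⁻¹) := ht.conj x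
      have hl1' : ∀ u ∈ l, cs.IsReflection u := fun u hu => hl1 u (List.mem_cons_of_mem _ hu)
      -- Conjugating the first complementary reflection by `x` moves it to the front. Its root lies
      -- in `supp a` because the factorization is as short as possible.
      have hc : cs.wordProd a = x * t * x⁻¹ * (x * l.prod) := by
        rw [List.prod_cons] at hl2
        calc cs.wordProd a = x * (t * l.prod) := by rw [hl2]; group
          _ = _ := by group
      obtain ⟨lx, ⟨hlx1, hlx2⟩, hlx3⟩ := id hx
      obtain ⟨ps, hps⟩ := exists_map_skipRefl (cs := cs) (l := x * t * x⁻¹ :: (lx ++ l)) (by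
        intro u hu
        rcases List.mem_cons.1 hu with rfl | hu
        · exact ht'
        · rcases List.mem_append.1 hu with hu | hu
          · exact hlx1 u hu
          · exact hl1' u hu)
      have hpslen : ps.length = a.length := by
        rw [← List.length_map (f := skipRefl cs), hps]
        simp at hl3 ⊢
        omega
      cases ps with
      | nil => simp at hps
      | cons p ps =>
      rw [List.map_cons, List.cons_eq_cons] at hps
      have hsupp := skipRoot_mem_supp_of_prod_eq ha (ps := p :: ps) (by
        rw [List.map_cons, hps.1, hps.2, hc, List.prod_cons, List.prod_append, hlx2]) hpslen p
        List.mem_cons_self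
      have hm : HasTLength cs (x⁻¹ * (x * t * x⁻¹ * cs.wordProd a)) l.length := by
        have : x⁻¹ * (x * t * x⁻¹ * cs.wordProd a) = l.prod := by
          rw [hc]
          have := ht'.mul_self
          calc _ = x⁻¹ * ((x * t * x⁻¹) * (x * t * x⁻¹)) * (x * l.prod) := by group
            _ = _ := by rw [this]; group
        rw [this]
        exact ⟨l, ⟨hl1', rfl⟩, rfl⟩
      simp only [List.length_cons] at hl3
      have hr := isRoot_skipRoot (cs := cs) p
      rcases hr.nonneg_or_nonpos with h0 | h0
      · refine isNC_of_reach ih₁ ih₂' (reach_of_nonneg ha hr h0 hsupp) ha hlen ht' (fun y => ?_)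
          hx hm (by omega)
        rw [← hps.1, geom_skipRefl]
      · refine isNC_of_reach ih₁ ih₂' (reach_of_nonneg ha hr.neg (neg_nonneg.2 h0)
          (neg_mem hsupp)) ha hlen ht' (fun y => ?_) hx hm (by omega)
        rw [← hps.1, geom_skipRefl]
        simp

end Surjectivity
end CoxeterSortable

namespace CoxeterSortable

variable {B W : Type*} [Group W] {M : CoxeterMatrix B} {cs : CoxeterSystem M W}

/-! ### Sorting sequences and the recursive description of sortable elements -/

theorem map_lt_map_iff {α β : Type*} [LinearOrder α] [LinearOrder β] {f : α → β}
    (hf : StrictMono f) {l l' : List α} : l.map f < l'.map f ↔ l < l' := by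
  induction l generalizing l' with
  | nil => cases l' <;> simp
  | cons x l ih =>
    cases l' with
    | nil => simp
    | cons y l' =>
      rw [List.map_cons, List.map_cons, List.cons_lt_cons_iff, List.cons_lt_cons_iff, ih,
        hf.lt_iff_lt, hf.injective.eq_iff]

theorem cons_le_cons_iff {α : Type*} [LinearOrder α] {x y : α} {l l' : List α} :
    x :: l ≤ y :: l' ↔ x < y ∨ x = y ∧ l ≤ l' := by
  rw [← not_lt, List.cons_lt_cons_iff, ← not_lt (a := l')]
  rcases lt_trichotomy x y with h | rfl | h
  · simp [h, h.not_gt, h.ne']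
  · simp
  · simp [h, h.not_gt, h.ne']

theorem map_le_map_iff {α β : Type*} [LinearOrder α] [LinearOrder β] {f : α → β}
    (hf : StrictMono f) {l l' : List α} : l.map f ≤ l'.map f ↔ l ≤ l' := by
  rw [← not_lt, ← not_lt, map_lt_map_iff hf]

theorem isReducedSubword_map {a b : List B} {f : Position a → Position b} (hf : StrictMono f)
    (hl : ∀ p, letter b (f p) = letter a p) {w : W} {ps : List (Position a)} :
    IsReducedSubword cs b w (ps.map f) ↔ IsReducedSubword cs a w ps := by
  have hword : wordAt b (ps.map f) = wordAt a ps := by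
    rw [wordAt, wordAt, List.map_map]
    exact List.map_congr_left fun p _ => hl p
  constructor
  · rintro ⟨h1, h2, h3⟩
    rw [hword] at h2 h3
    rw [List.pairwise_map] at h1
    exact ⟨h1.imp fun h => hf.lt_iff_lt.1 h, h2, h3⟩
  · rintro ⟨h1, h2, h3⟩
    refine ⟨?_, by rwa [hword], by rwa [hword]⟩
    rw [List.pairwise_map]
    exact h1.imp fun h => hf h

/-- The first position. -/
def firstPos (s : B) (a : List B) : Position (s :: a) := toLex (0, ⟨0, Nat.succ_pos _⟩)

/-- The positions of the rotated word, as positions other than the first one. -/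
def rotPos (s : B) (a : List B) (p : Position (a ++ [s])) : Position (s :: a) :=
  if h : (ofLex p).2.1 < a.length then toLex ((ofLex p).1, ⟨(ofLex p).2.1 + 1, by simpa using h⟩)
  else toLex ((ofLex p).1 + 1, ⟨0, Nat.succ_pos _⟩)

/-- The positions of a word without its first letter. -/
def tailPos (s : B) (a : List B) (p : Position a) : Position (s :: a) :=
  toLex ((ofLex p).1, (ofLex p).2.succ)

theorem pos_lt_iff {a : List B} {p q : Position a} :
    p < q ↔ (ofLex p).1 < (ofLex q).1 ∨
      (ofLex p).1 = (ofLex q).1 ∧ (ofLex p).2.1 < (ofLex q).2.1 := Prod.Lex.lt_iff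

theorem pos_ext {a : List B} {p q : Position a} (h1 : (ofLex p).1 = (ofLex q).1)
    (h2 : (ofLex p).2.1 = (ofLex q).2.1) : p = q :=
  ofLex.injective (Prod.ext h1 (Fin.ext h2))

theorem rotPos_of_lt {s : B} {a : List B} {p : Position (a ++ [s])}
    (h : (ofLex p).2.1 < a.length) : (ofLex (rotPos s a p)).1 = (ofLex p).1 ∧
      (ofLex (rotPos s a p)).2.1 = (ofLex p).2.1 + 1 := by
  rw [rotPos, dif_pos h]
  exact ⟨rfl, rfl⟩

theorem rotPos_of_not_lt {s : B} {a : List B} {p : Position (a ++ [s])}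
    (h : ¬ (ofLex p).2.1 < a.length) : (ofLex (rotPos s a p)).1 = (ofLex p).1 + 1 ∧
      (ofLex (rotPos s a p)).2.1 = 0 := by
  rw [rotPos, dif_neg h]
  exact ⟨rfl, rfl⟩

theorem pos_append_le {s : B} {a : List B} (p : Position (a ++ [s])) :
    (ofLex p).2.1 ≤ a.length := by
  have := (ofLex p).2.2
  simp at this
  omega

theorem strictMono_rotPos (s : B) (a : List B) : StrictMono (rotPos s a) := by
  intro p q hpq
  rw [pos_lt_iff] at hpq ⊢
  have hp := pos_append_le p
  have hq := pos_append_le q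
  by_cases h1 : (ofLex p).2.1 < a.length <;> by_cases h2 : (ofLex q).2.1 < a.length
  · rw [(rotPos_of_lt h1).1, (rotPos_of_lt h1).2, (rotPos_of_lt h2).1, (rotPos_of_lt h2).2]
    omega
  · rw [(rotPos_of_lt h1).1, (rotPos_of_lt h1).2, (rotPos_of_not_lt h2).1,
      (rotPos_of_not_lt h2).2]
    omega
  · rw [(rotPos_of_not_lt h1).1, (rotPos_of_not_lt h1).2, (rotPos_of_lt h2).1,
      (rotPos_of_lt h2).2]
    omega
  · rw [(rotPos_of_not_lt h1).1, (rotPos_of_not_lt h1).2, (rotPos_of_not_lt h2).1,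
      (rotPos_of_not_lt h2).2]
    omega

theorem letter_eq {a : List B} (p : Position a) : letter a p = a[(ofLex p).2.1] := rfl

theorem letter_rotPos (s : B) (a : List B) (p : Position (a ++ [s])) :
    letter (s :: a) (rotPos s a p) = letter (a ++ [s]) p := by
  by_cases h : (ofLex p).2.1 < a.length
  · rw [letter_eq, letter_eq]
    simp [(rotPos_of_lt h).2, List.getElem_append_left h]
  · have hp : (ofLex p).2.1 = a.length := le_antisymm (pos_append_le p) (not_lt.1 h)
    rw [letter_eq, letter_eq]
    simp [(rotPos_of_not_lt h).2, hp]

theorem firstPos_lt_rotPos (s : B) (a : List B) (p : Position (a ++ [s])) :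
    firstPos s a < rotPos s a p := by
  rw [pos_lt_iff]
  simp only [firstPos, ofLex_toLex]
  by_cases h : (ofLex p).2.1 < a.length
  · rw [(rotPos_of_lt h).1, (rotPos_of_lt h).2]; omega
  · rw [(rotPos_of_not_lt h).1, (rotPos_of_not_lt h).2]; omega

theorem exists_rotPos {s : B} {a : List B} {p : Position (s :: a)} (h : p ≠ firstPos s a) :
    ∃ q, rotPos s a q = p := by
  have hp2 : (ofLex p).2.1 < a.length + 1 := (ofLex p).2.2
  by_cases h0 : (ofLex p).2.1 = 0
  · have h1 : (ofLex p).1 ≠ 0 := fun h1 => h (pos_ext h1 h0)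
    let q : Position (a ++ [s]) := toLex ((ofLex p).1 - 1, ⟨a.length, by simp⟩)
    have hlt : ¬ (ofLex q).2.1 < a.length := lt_irrefl _
    refine ⟨q, pos_ext ?_ ?_⟩
    · rw [(rotPos_of_not_lt hlt).1]; exact Nat.sub_add_cancel (Nat.pos_of_ne_zero h1)
    · rw [(rotPos_of_not_lt hlt).2, h0]
  · let q : Position (a ++ [s]) :=
      toLex ((ofLex p).1, ⟨(ofLex p).2.1 - 1, by rw [List.length_append]; omega⟩)
    have hlt : (ofLex q).2.1 < a.length := by
      change (ofLex p).2.1 - 1 < a.length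
      omega
    refine ⟨q, pos_ext ?_ ?_⟩
    · rw [(rotPos_of_lt hlt).1]; rfl
    · rw [(rotPos_of_lt hlt).2]; exact Nat.sub_add_cancel (Nat.pos_of_ne_zero h0)

theorem strictMono_tailPos (s : B) (a : List B) : StrictMono (tailPos s a) := by
  intro p q hpq
  rw [pos_lt_iff] at hpq ⊢
  simpa [tailPos] using hpq

theorem letter_tailPos (s : B) (a : List B) (p : Position a) :
    letter (s :: a) (tailPos s a p) = letter a p := by
  simp [letter, tailPos]

theorem exists_tailPos {s : B} {a : List B} {p : Position (s :: a)} (h : (ofLex p).2.1 ≠ 0) :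
    ∃ q, tailPos s a q = p := by
  have hp2 : (ofLex p).2.1 < a.length + 1 := (ofLex p).2.2
  refine ⟨toLex ((ofLex p).1, ⟨(ofLex p).2.1 - 1, by omega⟩), pos_ext rfl ?_⟩
  simp [tailPos]
  omega

theorem exists_map_eq {α β : Type*} {f : α → β} {l : List β} (h : ∀ y ∈ l, ∃ x, f x = y) :
    ∃ l' : List α, l'.map f = l := by
  have : l ∈ Set.range (List.map f) := by
    rw [Set.range_list_map]
    exact h
  exact this

/-- With each position, all positions of the same letter to the left belong to the sequence. -/
def IsSegmental {a : List B} (ps : List (Position a)) : Prop :=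
  ∀ p ∈ ps, ∀ q : Position a, (ofLex p).1 = (ofLex q).1 + 1 → (ofLex p).2.1 = (ofLex q).2.1 → q ∈ ps

theorem antitone_block_iff {a : List B} (ha : a.Nodup) (w : W) :
    Antitone (block cs a w) ↔ IsSegmental (sortingSequence cs a w) := by
  constructor
  · intro h p hp q h1 h2
    have h3 : letter a p ∈ block cs a w ((ofLex q).1 + 1) := by
      refine ⟨(ofLex p).2, ?_, rfl⟩
      rw [← h1]; exact hp
    obtain ⟨i, hi, hip⟩ := h (Nat.le_succ _) h3
    have hi2 : i = (ofLex p).2 := (List.nodup_iff_injective_get.1 ha) hip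
    have : q = toLex ((ofLex q).1, i) := by
      refine pos_ext rfl ?_
      rw [hi2]; exact h2.symm
    rw [this]
    exact hi
  · intro h
    refine antitone_nat_of_succ_le fun k => ?_
    rintro r ⟨i, hi, rfl⟩
    exact ⟨i, h _ hi (toLex (k, i)) rfl rfl, rfl⟩

theorem isReduced_cons_iff {s : B} {ω : List B} : cs.IsReduced (s :: ω) ↔
    cs.IsReduced ω ∧ ¬ cs.IsLeftDescent (cs.wordProd ω) s := by
  constructor
  · intro h
    have h1 : cs.IsReduced ω := by simpa using h.drop 1
    refine ⟨h1, ?_⟩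
    rw [cs.not_isLeftDescent_iff, ← cs.wordProd_cons, h.eq, h1.eq, List.length_cons]
  · rintro ⟨h1, h2⟩
    rw [CoxeterSystem.IsReduced, cs.wordProd_cons, cs.not_isLeftDescent_iff.1 h2, h1.eq,
      List.length_cons]

theorem wordAt_rotPos (s : B) (a : List B) (ps : List (Position (a ++ [s]))) :
    wordAt (s :: a) (firstPos s a :: ps.map (rotPos s a)) = s :: wordAt (a ++ [s]) ps := by
  rw [wordAt, wordAt, List.map_cons, List.map_map]
  congr 1
  exact List.map_congr_left fun p _ => letter_rotPos s a p

theorem isReducedSubword_firstPos_cons {s : B} {a : List B} {w : W}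
    {ps : List (Position (a ++ [s]))} :
    IsReducedSubword cs (s :: a) w (firstPos s a :: ps.map (rotPos s a)) ↔
      IsReducedSubword cs (a ++ [s]) (cs.simple s * w) ps ∧
        ¬ cs.IsLeftDescent (cs.simple s * w) s := by
  constructor
  · rintro ⟨h1, h2, h3⟩
    rw [wordAt_rotPos] at h2 h3
    rw [isReduced_cons_iff] at h2
    have h4 : cs.wordProd (wordAt (a ++ [s]) ps) = cs.simple s * w := by
      rw [← h3, cs.wordProd_cons, cs.simple_mul_simple_cancel_left]
    refine ⟨⟨?_, h2.1, h4⟩, by rw [← h4]; exact h2.2⟩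
    rw [List.pairwise_cons, List.pairwise_map] at h1
    exact h1.2.imp fun h => (strictMono_rotPos s a).lt_iff_lt.1 h
  · rintro ⟨⟨h1, h2, h3⟩, h4⟩
    refine ⟨?_, ?_, ?_⟩
    · rw [List.pairwise_cons, List.pairwise_map]
      refine ⟨?_, h1.imp fun h => strictMono_rotPos s a h⟩
      intro p hp
      obtain ⟨q, -, rfl⟩ := List.mem_map.1 hp
      exact firstPos_lt_rotPos s a q
    · rw [wordAt_rotPos, isReduced_cons_iff, h3]
      exact ⟨h2, h4⟩
    · rw [wordAt_rotPos, cs.wordProd_cons, h3, cs.simple_mul_simple_cancel_left]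

theorem firstPos_le {s : B} {a : List B} (p : Position (s :: a)) : firstPos s a ≤ p := by
  by_cases h : p = firstPos s a
  · exact h.ge
  · obtain ⟨q, rfl⟩ := exists_rotPos h
    exact (firstPos_lt_rotPos s a q).le

theorem exists_rotPos_of_increasing {s : B} {a : List B} {ps : List (Position (s :: a))}
    (h : (firstPos s a :: ps).Pairwise (· < ·)) :
    ∃ qs : List (Position (a ++ [s])), qs.map (rotPos s a) = ps := by
  refine exists_map_eq fun p hp => exists_rotPos ?_
  rintro rfl
  exact lt_irrefl _ ((List.pairwise_cons.1 h).1 _ hp)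

/-- If the first position is used, delete it and read the rest in the rotated word. If it is not, no
later copy of that letter is used either, and the letter can be dropped from the word. -/
theorem IsSortingSequence.exists_sorting {a : List B} {w : W}
    {ps : List (Position a)} (h : IsSortingSequence cs a w ps) (hseg : IsSegmental ps) :
    ∃ L, Sorting cs a (wordAt a ps) L := by
  induction hn : ps.length + a.length using Nat.strong_induction_on generalizing a w with
  | _ n ih =>
  cases a with
  | nil =>
    cases ps with
    | nil => exact ⟨[], Sorting.nil⟩
    | cons p ps => exact (ofLex p).2.elim0
  | cons s a =>
    by_cases hfirst : firstPos s a ∈ ps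
    · obtain ⟨qs, rfl⟩ : ∃ qs : List (Position (a ++ [s])), ps = firstPos s a :: qs.map (rotPos s a) := by
        cases ps with
        | nil => simp at hfirst
        | cons p ps =>
          have hp : p = firstPos s a := by
            rcases List.mem_cons.1 hfirst with h1 | h1
            · exact h1.symm
            · exact absurd ((List.pairwise_cons.1 h.1.increasing).1 _ h1) (firstPos_le p).not_gt
          subst hp
          obtain ⟨qs, rfl⟩ := exists_rotPos_of_increasing h.1.increasing
          exact ⟨qs, rfl⟩
      obtain ⟨h1, h2⟩ := isReducedSubword_firstPos_cons.1 h.1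
      have hsort : IsSortingSequence cs (a ++ [s]) (cs.simple s * w) qs := by
        refine ⟨h1, fun rs hrs => ?_⟩
        have := h.2 _ (isReducedSubword_firstPos_cons.2 ⟨hrs, h2⟩)
        rw [cons_le_cons_iff] at this
        rcases this with hlt | ⟨-, hle⟩
        · exact absurd hlt (lt_irrefl _)
        · exact (map_le_map_iff (strictMono_rotPos s a)).1 hle
      have hseg' : IsSegmental qs := by
        intro p hp q h3 h4
        have hmem : rotPos s a q ∈ firstPos s a :: qs.map (rotPos s a) := by
          refine hseg (rotPos s a p) (List.mem_cons_of_mem _ (List.mem_map_of_mem hp)) _ ?_ ?_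
          · by_cases hlt : (ofLex p).2.1 < a.length
            · rw [(rotPos_of_lt hlt).1, (rotPos_of_lt (h4 ▸ hlt)).1, h3]
            · rw [(rotPos_of_not_lt hlt).1, (rotPos_of_not_lt (h4 ▸ hlt)).1, h3]
          · by_cases hlt : (ofLex p).2.1 < a.length
            · rw [(rotPos_of_lt hlt).2, (rotPos_of_lt (h4 ▸ hlt)).2, h4]
            · rw [(rotPos_of_not_lt hlt).2, (rotPos_of_not_lt (h4 ▸ hlt)).2]
        rcases List.mem_cons.1 hmem with h5 | h5
        · exact absurd h5 (firstPos_lt_rotPos s a q).ne'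
        · obtain ⟨r, hr, hrq⟩ := List.mem_map.1 h5
          rwa [← (strictMono_rotPos s a).injective hrq]
      obtain ⟨L, hL⟩ := ih _ (by rw [← hn]; simp) hsort hseg' rfl
      refine ⟨L.map (shift cs s), ?_⟩
      rw [wordAt_rotPos]
      exact hL.use (by rw [h1.wordProd_eq]; exact h2)
    · have hno : ∀ k : ℕ, ∀ p ∈ ps, (ofLex p).1 = k → (ofLex p).2.1 ≠ 0 := by
        intro k
        induction k with
        | zero => exact fun p hp h1 h2 => hfirst (by rwa [← pos_ext (p := p) (q := firstPos s a) h1 h2])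
        | succ k ihk =>
          intro p hp h1 h2
          exact ihk (toLex (k, ⟨0, Nat.succ_pos _⟩)) (hseg p hp _ h1 h2) rfl rfl
      obtain ⟨qs, rfl⟩ := exists_map_eq (f := tailPos s a) (l := ps) fun p hp =>
        exists_tailPos (hno _ p hp rfl)
      have hword : wordAt (s :: a) (qs.map (tailPos s a)) = wordAt a qs := by
        rw [wordAt, wordAt, List.map_map]
        exact List.map_congr_left fun p _ => letter_tailPos s a p
      have hred := fun rs : List (Position a) => isReducedSubword_map (cs := cs) (w := w) (ps := rs)
        (strictMono_tailPos s a) (letter_tailPos s a)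
      have hsort : IsSortingSequence cs a w qs :=
        ⟨(hred qs).1 h.1, fun rs hrs =>
          (map_le_map_iff (strictMono_tailPos s a)).1 (h.2 _ ((hred rs).2 hrs))⟩
      have hseg' : IsSegmental qs := by
        intro p hp q h3 h4
        have hmem := hseg _ (List.mem_map_of_mem hp) (tailPos s a q) h3
          (by simpa [tailPos] using h4)
        obtain ⟨r, hr, hrq⟩ := List.mem_map.1 hmem
        rwa [← (strictMono_tailPos s a).injective hrq]
      obtain ⟨L, hL⟩ := ih _ (by rw [← hn]; simp) hsort hseg' rfl
      exact ⟨_, by rw [hword]; exact hL.skip⟩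

/-- At a skip, no reduced word of the element contains `s`, so all competitors live on the shorter
word. At a use, the first position is the least one, and only competitors that also start there need
to be compared, after rotation. -/
theorem Sorting.exists_isSortingSequence [Fintype B] [DecidableEq B] {a ω : List B}
    {L : List (W × B)} (h : Sorting cs a ω L) (ha : a.Nodup) : ∃ ps : List (Position a),
      IsSortingSequence cs a (cs.wordProd ω) ps ∧ IsSegmental ps ∧ wordAt a ps = ω := by
  induction h with
  | nil =>
    refine ⟨[], ⟨⟨List.Pairwise.nil, ?_, rfl⟩, fun qs _ => ?_⟩, ?_, rfl⟩
    · simp [wordAt, CoxeterSystem.IsReduced]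
    · exact not_lt.1 (by simp)
    · intro p hp; simp at hp
  | @skip s a ω L h ih =>
    have ha' := List.nodup_cons.1 ha
    obtain ⟨qs, h1, h2, h3⟩ := ih ha'.2
    have hred := fun rs : List (Position a) => isReducedSubword_map (cs := cs) (w := cs.wordProd ω)
      (ps := rs) (strictMono_tailPos s a) (letter_tailPos s a)
    refine ⟨qs.map (tailPos s a), ⟨(hred qs).2 h1.1, fun rs hrs => ?_⟩, ?_, ?_⟩
    · have hsub : wordAt (s :: a) rs ⊆ a :=
        fun j hj => h.subset (hrs.isReduced.subset hrs.wordProd_eq hj)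
      obtain ⟨ts, rfl⟩ := exists_map_eq (f := tailPos s a) (l := rs) fun p hp => by
        refine exists_tailPos fun h0 => ha'.1 (hsub (List.mem_map.2 ⟨p, hp, ?_⟩))
        rw [letter_eq]
        simp [h0]
      exact (map_le_map_iff (strictMono_tailPos s a)).2 (h1.2 _ ((hred ts).1 hrs))
    · intro p hp q h4 h5
      obtain ⟨p', hp', rfl⟩ := List.mem_map.1 hp
      obtain ⟨q', rfl⟩ := exists_tailPos (p := q) (by rw [← h5]; simp [tailPos])
      exact List.mem_map_of_mem (h2 p' hp' q' h4 (by simpa [tailPos] using h5))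
    · rw [← h3, wordAt, wordAt, List.map_map]
      exact List.map_congr_left fun p _ => letter_tailPos s a p
  | @use s a ω L h hd ih =>
    obtain ⟨qs, h1, h2, h3⟩ := ih (nodup_append_singleton.2 ha)
    have hw : cs.simple s * cs.wordProd (s :: ω) = cs.wordProd ω := by
      rw [cs.wordProd_cons, cs.simple_mul_simple_cancel_left]
    refine ⟨firstPos s a :: qs.map (rotPos s a), ⟨?_, fun rs hrs => ?_⟩, ?_, ?_⟩
    · rw [isReducedSubword_firstPos_cons, hw]
      exact ⟨h1.1, hd⟩
    · cases rs with
      | nil =>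
        exfalso
        have h4 := hrs.wordProd_eq
        simp only [wordAt, List.map_nil, cs.wordProd_nil] at h4
        have h5 := Sorting.isLeftDescent_cons hd
        rw [← h4] at h5
        exact cs.not_isLeftDescent_one s h5
      | cons p rs =>
        rw [cons_le_cons_iff]
        rcases (firstPos_le p).lt_or_eq with hlt | rfl
        · exact Or.inl hlt
        · obtain ⟨ts, rfl⟩ := exists_rotPos_of_increasing hrs.increasing
          rw [isReducedSubword_firstPos_cons, hw] at hrs
          exact Or.inr ⟨rfl, (map_le_map_iff (strictMono_rotPos s a)).2 (h1.2 _ hrs.1)⟩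
    · intro p hp q h4 h5
      by_cases hq : q = firstPos s a
      · rw [hq]; exact List.mem_cons_self
      obtain ⟨q', rfl⟩ := exists_rotPos hq
      refine List.mem_cons_of_mem _ (List.mem_map_of_mem ?_)
      rcases List.mem_cons.1 hp with rfl | hp
      · simp [firstPos] at h4
      obtain ⟨p', hp', rfl⟩ := List.mem_map.1 hp
      have hp'' := pos_append_le p'
      have hq'' := pos_append_le q'
      by_cases hlt : (ofLex p').2.1 < a.length <;> by_cases hlt' : (ofLex q').2.1 < a.length
      · rw [(rotPos_of_lt hlt).1, (rotPos_of_lt hlt').1] at h4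
        rw [(rotPos_of_lt hlt).2, (rotPos_of_lt hlt').2] at h5
        exact h2 p' hp' q' h4 (by omega)
      · rw [(rotPos_of_lt hlt).2, (rotPos_of_not_lt hlt').2] at h5
        omega
      · rw [(rotPos_of_not_lt hlt).2, (rotPos_of_lt hlt').2] at h5
        omega
      · rw [(rotPos_of_not_lt hlt).1, (rotPos_of_not_lt hlt').1] at h4
        exact h2 p' hp' q' (by omega) (by omega)
    · rw [wordAt_rotPos, h3]

theorem isSortable_iff [Fintype B] [DecidableEq B] {a : List B} (ha : a.Nodup)
    (hall : ∀ i, i ∈ a) (w : W) : IsSortable cs a w ↔ ∃ ω L, Sorting cs a ω L ∧ cs.wordProd ω = w := by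
  rw [IsSortable, antitone_block_iff ha]
  have hspec := sortingSequence_spec cs hall w
  constructor
  · intro h
    obtain ⟨L, hL⟩ := hspec.exists_sorting h
    exact ⟨_, L, hL, hspec.1.wordProd_eq⟩
  · rintro ⟨ω, L, h, rfl⟩
    obtain ⟨ps, h1, h2, -⟩ := h.exists_isSortingSequence ha
    rwa [hspec.unique cs h1]

theorem Sorting.sortingWord_eq [Fintype B] [DecidableEq B] {a ω : List B} {L : List (W × B)}
    (h : Sorting cs a ω L) (ha : a.Nodup) (hall : ∀ i, i ∈ a) :
    sortingWord cs a (cs.wordProd ω) = ω := by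
  obtain ⟨ps, h1, h2, h3⟩ := h.exists_isSortingSequence ha
  rw [sortingWord, (sortingSequence_spec cs hall _).unique cs h1, h3]

theorem Sorting.nc_eq [Finite W] [Fintype B] [DecidableEq B] {a ω : List B} {L : List (W × B)}
    (h : Sorting cs a ω L) (ha : a.Nodup) (hall : ∀ i, i ∈ a) :
    nc cs a (cs.wordProd ω) = ncProd cs L := by
  rw [nc, h.sortingWord_eq ha hall, h.prod_filter_leftInvSeq ha]

end CoxeterSortable

namespace CoxeterSortable

variable {B W : Type*} [Group W] {M : CoxeterMatrix B} {cs : CoxeterSystem M W}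

/-! ### Independence of the reduced word -/

section Independence

variable [Fintype B] [DecidableEq B]

/-- Two lists of skips have the same roots, up to swaps of adjacent orthogonal roots. -/
inductive SwapEquiv (cs : CoxeterSystem M W) : List (W × B) → List (W × B) → Prop
  | nil : SwapEquiv cs [] []
  | cons {p q : W × B} {L L' : List (W × B)} : skipRoot cs p = skipRoot cs q →
      SwapEquiv cs L L' → SwapEquiv cs (p :: L) (q :: L')
  | swap {p p' q q' : W × B} {L L' : List (W × B)} : skipRoot cs p = skipRoot cs p' →
      skipRoot cs q = skipRoot cs q' → form M (skipRoot cs p) (skipRoot cs q) = 0 →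
      SwapEquiv cs L L' → SwapEquiv cs (p :: q :: L) (q' :: p' :: L')

theorem SwapEquiv.refl (L : List (W × B)) : SwapEquiv cs L L := by
  induction L with
  | nil => exact .nil
  | cons p L ih => exact .cons rfl ih

theorem SwapEquiv.map_shift {L L' : List (W × B)} (h : SwapEquiv cs L L') (s : B) :
    SwapEquiv cs (L.map (shift cs s)) (L'.map (shift cs s)) := by
  induction h with
  | nil => exact .nil
  | cons h _ ih => exact .cons (by rw [skipRoot_shift, skipRoot_shift, h]) ih
  | swap h₁ h₂ h₃ _ ih =>
    refine .swap (by rw [skipRoot_shift, skipRoot_shift, h₁])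
      (by rw [skipRoot_shift, skipRoot_shift, h₂]) ?_ ih
    rw [skipRoot_shift, skipRoot_shift, form_geom, h₃]

theorem SwapEquiv.map_shift_comm {L L' : List (W × B)} (h : SwapEquiv cs L L') {s t : B}
    (hst : cs.simple s * cs.simple t = cs.simple t * cs.simple s) :
    SwapEquiv cs ((L.map (shift cs t)).map (shift cs s))
      ((L'.map (shift cs s)).map (shift cs t)) := by
  have h1 : ∀ p : W × B, shift cs s (shift cs t p) = shift cs t (shift cs s p) := fun p => by
    rw [shift, shift, shift, shift, ← mul_assoc, ← mul_assoc, hst]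
  have h2 : (L.map (shift cs t)).map (shift cs s) = (L.map (shift cs s)).map (shift cs t) := by
    rw [List.map_map, List.map_map]
    exact List.map_congr_left fun p _ => h1 p
  rw [h2]
  exact (h.map_shift s).map_shift t

theorem skipRefl_eq_of_skipRoot_eq {p q : W × B} (h : skipRoot cs p = skipRoot cs q) :
    skipRefl cs p = skipRefl cs q := conj_simple_eq_of_geom_eq h

theorem ncProd_cons (p : W × B) (L : List (W × B)) : ncProd cs (p :: L) =
    (open Classical in if skipRoot cs p ≤ 0 then skipRefl cs p else 1) * ncProd cs L := by
  split_ifs with h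
  · rw [ncProd, negSkips_cons_of_nonpos _ h, List.map_cons, List.prod_cons, ncProd]
  · rw [ncProd, negSkips_cons_of_not_nonpos _ h, one_mul, ncProd]

theorem SwapEquiv.ncProd_eq {L L' : List (W × B)} (h : SwapEquiv cs L L') :
    ncProd cs L = ncProd cs L' := by
  induction h with
  | nil => rfl
  | cons h _ ih => rw [ncProd_cons, ncProd_cons, ih, h, skipRefl_eq_of_skipRoot_eq h]
  | swap h₁ h₂ h₃ _ ih =>
    have hc := (commute_skipRefl h₃).eq
    rw [ncProd_cons, ncProd_cons, ncProd_cons, ncProd_cons, ih, ← h₁, ← h₂,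
      ← skipRefl_eq_of_skipRoot_eq h₁, ← skipRefl_eq_of_skipRoot_eq h₂, ← mul_assoc, ← mul_assoc]
    split_ifs <;> simp [hc]

theorem isLeftDescent_simple_mul_iff {s t : B} (hst : form M (e s) (e t) = 0) {w : W} :
    cs.IsLeftDescent (cs.simple t * w) s ↔ cs.IsLeftDescent w s := by
  rw [isLeftDescent_iff_geom_inv_nonpos, isLeftDescent_iff_geom_inv_nonpos, mul_inv_rev,
    cs.inv_simple, geom_mul_apply, geom_simple_apply cs t, hst, zero_smul, sub_zero]

/-- Sortable elements do not change under a commutation of two adjacent letters. -/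
theorem Sorting.exists_swap {s t : B} (hst : form M (e s) (e t) = 0) {p q ω : List B}
    {L : List (W × B)} (h : Sorting cs (p ++ s :: t :: q) ω L) :
    ∃ ω' L', Sorting cs (p ++ t :: s :: q) ω' L' ∧ cs.wordProd ω' = cs.wordProd ω ∧
      SwapEquiv cs L L' := by
  have hts : form M (e t) (e s) = 0 := (form_symm _ _).trans hst
  have hcomm := mul_simple_comm_of_form_eq_zero (cs := cs) hst
  induction hn : ω.length + (p ++ s :: t :: q).length using Nat.strong_induction_on
    generalizing p q ω L with
  | _ n ih =>
  cases p with
  | cons r p =>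
    rw [List.cons_append] at h
    cases h with
    | @skip _ _ _ L h =>
      obtain ⟨ω', L', h1, h2, h3⟩ := ih _ (by rw [← hn]; simp) h rfl
      exact ⟨ω', _, h1.skip, h2, .cons rfl h3⟩
    | @use _ _ ω L h hd =>
      rw [List.append_assoc] at h
      obtain ⟨ω', L', h1, h2, h3⟩ := ih _ (by rw [← hn]; simp; omega) h rfl
      refine ⟨r :: ω', L'.map (shift cs r), ?_, by rw [cs.wordProd_cons, cs.wordProd_cons, h2],
        h3.map_shift r⟩
      refine Sorting.use ?_ (by rwa [h2])
      have happ : p ++ t :: s :: (q ++ [r]) = p ++ t :: s :: q ++ [r] := by simp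
      exact happ ▸ h1
  | nil =>
    rw [List.nil_append] at h
    cases h with
    | @skip _ _ _ L h =>
      cases h with
      | @skip _ _ _ L h =>
        refine ⟨ω, _, h.skip.skip, rfl, .swap rfl rfl ?_ (.refl _)⟩
        rw [skipRoot_one, skipRoot_one, hst]
      | @use _ _ ω L h hd =>
        -- In the other order `s` is skipped after `t` is used, with root `t(e s) = e s` by
        -- orthogonality.
        refine ⟨t :: ω, _, Sorting.use h.skip hd, rfl, .cons ?_ (.refl _)⟩
        rw [skipRoot_shift, skipRoot_one, geom_simple_apply, hst]
        module
    | @use _ _ ω L h hd =>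
      rw [List.cons_append] at h
      cases h with
      | @skip _ _ _ L h =>
        refine ⟨s :: ω, _, (Sorting.use h hd).skip, rfl, .cons ?_ (.refl _)⟩
        rw [skipRoot_shift, skipRoot_one, geom_simple_apply, hts]
        module
      | @use _ _ ω L h hd' =>
        rw [List.append_assoc] at h
        obtain ⟨ω', L', h1, h2, h3⟩ := ih _ (by rw [← hn]; simp) h rfl
        rw [cs.wordProd_cons, isLeftDescent_simple_mul_iff hst] at hd
        refine ⟨t :: s :: ω', _, Sorting.use (Sorting.use ?_ (by rwa [h2])) ?_, ?_,
          h3.map_shift_comm hcomm⟩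
        · have happ : q ++ [t, s] = q ++ [t] ++ [s] := by simp
          exact happ ▸ h1
        · rwa [cs.wordProd_cons, isLeftDescent_simple_mul_iff hts, h2]
        · simp only [cs.wordProd_cons, h2, ← mul_assoc, hcomm]

/-- The commutation of two adjacent letters with orthogonal simple roots. -/
inductive Swap (M : CoxeterMatrix B) : List B → List B → Prop
  | mk (p q : List B) {s t : B} : form M (e s) (e t) = 0 →
      Swap M (p ++ s :: t :: q) (p ++ t :: s :: q)

theorem Swap.cons {a b : List B} (h : Swap M a b) (r : B) : Swap M (r :: a) (r :: b) := by
  cases h with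
  | mk p q h => exact Swap.mk (r :: p) q h

open Relation in
theorem swap_cons_of_orthogonal {b q : List B} {s : B} (h : ∀ i ∈ b, form M (e s) (e i) = 0) :
    ReflTransGen (Swap M) (s :: (b ++ q)) (b ++ s :: q) := by
  induction b with
  | nil => exact .refl
  | cons i b ih =>
    refine .head (Swap.mk [] (b ++ q) (h i List.mem_cons_self)) ?_
    exact (ih fun j hj => h j (List.mem_cons_of_mem _ hj)).lift (i :: ·) fun _ _ h => h.cons i

/-- A letter of a word of distinct letters which can be moved to its beginning is orthogonal to
the preceding letters. -/
theorem form_e_eq_zero_of_isLeftDescent {b q : List B} {s : B} (hnd : (b ++ s :: q).Nodup)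
    (hd : cs.IsLeftDescent (cs.wordProd (b ++ s :: q)) s) : ∀ i ∈ b, form M (e s) (e i) = 0 := by
  obtain ⟨hb, -, hdisj⟩ := List.nodup_append.1 hnd
  have hs : s ∉ b := fun hs => hdisj s hs s List.mem_cons_self rfl
  rw [isLeftDescent_iff_geom_inv_nonpos, cs.wordProd_append, cs.wordProd_cons, mul_inv_rev,
    mul_inv_rev, geom_mul_apply, geom_mul_apply, cs.inv_simple] at hd
  have h0 := not_isLeftDescent_iff_geom_inv_nonneg.1 (not_isLeftDescent_of_notMem (cs := cs) hs)
  -- The root `b⁻¹(e s)` is nonnegative, but becomes nonpositive after applying `s` and the inverse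
  -- of `q`, neither of which touches the coordinates in `b`. These coordinates therefore vanish,
  -- and `b` fixes `e s`.
  have hfix : geom cs (cs.wordProd b)⁻¹ (e s) = e s := by
    ext j
    by_cases hj : j ∈ b
    · have hjs : j ≠ s := fun h => hs (h ▸ hj)
      have hjq : j ∉ q := fun h => hdisj j hj j (List.mem_cons_of_mem _ h) rfl
      have h1 := hd j
      rw [geom_wordProd_inv_apply_of_notMem hjq, geom_simple_apply_ne cs s _ hjs] at h1
      rw [e_ne hjs]
      exact le_antisymm h1 (h0 j)
    · exact geom_wordProd_inv_apply_of_notMem hj _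
  refine form_e_eq_zero_of_fixed (cs := cs) hb ?_
  conv_lhs => rw [← hfix]
  exact geom_apply_inv_self cs _ _

open Relation in
/-- Reduced words of distinct letters for the same element are related by commutations. -/
theorem reflTransGen_swap {a a' : List B} (ha : a.Nodup) (ha' : a'.Nodup) (hr : cs.IsReduced a)
    (hr' : cs.IsReduced a') (heq : cs.wordProd a = cs.wordProd a') :
    ReflTransGen (Swap M) a a' := by
  induction a generalizing a' with
  | nil =>
    have : a' ⊆ [] := hr'.subset heq.symm
    rw [List.subset_nil.1 this]
  | cons s a ih =>
    obtain ⟨b, q, rfl⟩ := List.append_of_mem (hr.subset heq List.mem_cons_self)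
    have hra := isReduced_cons_iff.1 hr
    have horth := form_e_eq_zero_of_isLeftDescent (cs := cs) ha' (by
      rw [← heq]; exact Sorting.isLeftDescent_cons hra.2)
    have hmove := swap_cons_of_orthogonal (q := q) horth
    have hprod : cs.wordProd (b ++ s :: q) = cs.wordProd (s :: (b ++ q)) := by
      have : ∀ b : List B, (∀ i ∈ b, form M (e s) (e i) = 0) →
          cs.wordProd (b ++ s :: q) = cs.wordProd (s :: (b ++ q)) := by
        intro b hb
        induction b with
        | nil => rfl
        | cons i b ihb =>
          rw [List.cons_append, cs.wordProd_cons, ihb fun j hj => hb j (List.mem_cons_of_mem _ hj),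
            List.cons_append, cs.wordProd_cons, cs.wordProd_cons, cs.wordProd_cons, ← mul_assoc,
            ← mul_assoc, mul_simple_comm_of_form_eq_zero (hb i List.mem_cons_self)]
      exact this b horth
    have heq' : cs.wordProd a = cs.wordProd (b ++ q) := by
      rw [hprod, cs.wordProd_cons, cs.wordProd_cons] at heq
      exact mul_left_cancel heq
    have hr'' : cs.IsReduced (b ++ q) := by
      have h1 := hr.eq
      rw [heq, hr'.eq] at h1
      rw [CoxeterSystem.IsReduced, ← heq', hra.1.eq]
      simp at h1 ⊢
      omega
    have hnd : (b ++ q).Nodup := by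
      refine ha'.sublist ?_
      exact (List.Sublist.refl b).append (List.sublist_cons_self s q)
    refine ReflTransGen.trans ?_ hmove
    exact (ih (List.nodup_cons.1 ha).2 hnd hra.1 hr'' heq').lift (s :: ·) fun _ _ h => h.cons s

theorem Sorting.exists_of_reflTransGen {a a' ω : List B} {L : List (W × B)}
    (h : Sorting cs a ω L) (haa' : Relation.ReflTransGen (Swap M) a a') :
    ∃ ω' L', Sorting cs a' ω' L' ∧ cs.wordProd ω' = cs.wordProd ω ∧
      ncProd cs L' = ncProd cs L := by
  induction haa' with
  | refl => exact ⟨ω, L, h, rfl, rfl⟩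
  | tail _ hs ih =>
    obtain ⟨ω₁, L₁, h1, h2, h3⟩ := ih
    cases hs with
    | mk p q hst =>
      obtain ⟨ω₂, L₂, h4, h5, h6⟩ := h1.exists_swap hst
      exact ⟨ω₂, L₂, h4, h5.trans h2, h6.ncProd_eq.symm.trans h3⟩

theorem IsCoxeterWord.isSortable_and_nc_eq [Finite W] {c : W} {a a' : List B}
    (ha : IsCoxeterWord cs c a) (ha' : IsCoxeterWord cs c a') {w : W} (h : IsSortable cs a w) :
    IsSortable cs a' w ∧ nc cs a' w = nc cs a w := by
  rw [isSortable_iff ha.nodup ha.mem] at h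
  obtain ⟨ω, L, h1, rfl⟩ := h
  obtain ⟨ω', L', h2, h3, h4⟩ := h1.exists_of_reflTransGen (reflTransGen_swap ha.nodup ha'.nodup
    ha.isReduced ha'.isReduced (ha.wordProd_eq.trans ha'.wordProd_eq.symm))
  refine ⟨(isSortable_iff ha'.nodup ha'.mem _).2 ⟨ω', L', h2, h3⟩, ?_⟩
  rw [h1.nc_eq ha.nodup ha.mem, ← h3, h2.nc_eq ha'.nodup ha'.mem, h4]

end Independence

/-! ### Noncrossing partitions -/

section Noncrossing

theorem HasTLength.exists_isReducedTWord {x : W} {k : ℕ} (h : HasTLength cs x k)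
    (hmin : ∀ m, HasTLength cs x m → k ≤ m) :
    ∃ l, IsReducedTWord cs x l ∧ l.length = k := by
  obtain ⟨l, hl, rfl⟩ := h
  exact ⟨l, ⟨hl, fun l' hl' => hmin _ ⟨l', hl', rfl⟩⟩, rfl⟩

theorem HasTLength.absLength_eq {x : W} {k : ℕ} (h : HasTLength cs x k)
    (hmin : ∀ m, HasTLength cs x m → k ≤ m) : absLength cs x = k :=
  le_antisymm (Nat.sInf_le h) (le_csInf ⟨k, h⟩ fun m hm => hmin m hm)

variable [Fintype B] [DecidableEq B]

theorem IsBelow.mem_noncrossingPartitions [Finite W] {a : List B} (ha : a.Nodup) {k : ℕ} {x : W}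
    (h : IsBelow cs a k x) : x ∈ noncrossingPartitions cs (cs.wordProd a) := by
  obtain ⟨m, hx, ⟨l', ⟨hl'1, hl'2⟩, hl'3⟩, hkm⟩ := id h
  obtain ⟨l, hl, hlk⟩ := hx.exists_isReducedTWord fun m => h.le ha
  refine ⟨⟨[], l, ⟨⟨by simp, rfl⟩, fun _ _ => by simp⟩, hl⟩, l, l', hl, ⟨?_, ?_⟩, ?_⟩
  · intro t ht
    rcases List.mem_append.1 ht with ht | ht
    · exact hl.1.1 t ht
    · exact hl'1 t ht
  · rw [List.prod_append, hl.1.2, hl'2, mul_inv_cancel_left]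
  · intro r hr
    rw [List.length_append, hlk, hl'3, hkm]
    exact HasTLength.length_le ha ⟨r, hr, rfl⟩

theorem exists_isBelow_of_absLE [Finite W] {a : List B} (ha : a.Nodup) {x : W}
    (h : AbsLE cs x (cs.wordProd a)) : ∃ k, IsBelow cs a k x := by
  obtain ⟨l, l', hl, hl'⟩ := h
  refine ⟨l.length, l'.length, ⟨l, hl.1, rfl⟩, ⟨l', ⟨?_, ?_⟩, rfl⟩, ?_⟩
  · exact fun t ht => hl'.1.1 t (List.mem_append_right _ ht)
  · rw [← hl'.1.2, List.prod_append, hl.1.2, inv_mul_cancel_left]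
  · rw [← List.length_append]
    refine le_antisymm ?_ (HasTLength.length_le ha ⟨_, hl'.1, rfl⟩)
    obtain ⟨r, hr, hra⟩ := hasTLength_wordProd (cs := cs) a
    rw [← hra]
    exact hl'.2 r hr

/-- The number of negative skips is the number of descents. -/
theorem Sorting.length_negSkips [Finite W] {a ω : List B} {L : List (W × B)}
    (h : Sorting cs a ω L) (ha : a.Nodup) :
    (negSkips cs L).length = {i : B | cs.IsRightDescent (cs.wordProd ω) i}.ncard := by
  classical
  have hnd : ((negSkips cs L).map (skipRoot cs)).Nodup :=
    (h.nodup_skipRoot ha).sublist (List.filter_sublist.map _)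
  have himg : (fun i => geom cs (cs.wordProd ω) (e i)) ''
      {i : B | cs.IsRightDescent (cs.wordProd ω) i} =
      (((negSkips cs L).map (skipRoot cs)).toFinset : Set (B → ℝ)) := by
    ext x
    simp only [Set.mem_image, Set.mem_ofPred_eq, List.coe_toFinset, List.mem_map, mem_negSkips]
    constructor
    · rintro ⟨i, hi, rfl⟩
      rw [isRightDescent_iff_geom_nonpos] at hi
      obtain ⟨p, hp, hpx⟩ := (h.mem_skipRoots_iff ha hi).2 ⟨i, rfl⟩
      exact ⟨p, ⟨hp, hpx ▸ hi⟩, hpx⟩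
    · rintro ⟨p, ⟨hp, hp0⟩, rfl⟩
      obtain ⟨r, hr⟩ := (h.mem_skipRoots_iff ha hp0).1 ⟨p, hp, rfl⟩
      exact ⟨r, by rwa [isRightDescent_iff_geom_nonpos, hr], hr⟩
  have hinj : Function.Injective fun i => geom cs (cs.wordProd ω) (e i) := fun i j hij => by
    have h1 : e i = e j := (geom cs (cs.wordProd ω)).injective hij
    by_contra hne
    have h2 := congrFun h1 i
    rw [e_same, e_ne hne] at h2
    exact one_ne_zero h2
  rw [← Set.ncard_image_of_injective _ hinj, himg, Set.ncard_coe_finset,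
    List.toFinset_card_of_nodup hnd, List.length_map]

end Noncrossing
end CoxeterSortable

theorem theorem6p1 {B W : Type*} [Group W] [Finite W] {M : CoxeterMatrix B}
    (cs : CoxeterSystem M W) (c : W) (a : List B)
    (ha : CoxeterSortable.IsCoxeterWord cs c a) :
    (∀ a' : List B, CoxeterSortable.IsCoxeterWord cs c a' → ∀ w : W,
      (CoxeterSortable.IsSortable cs a' w ↔ CoxeterSortable.IsSortable cs a w) ∧
      (CoxeterSortable.IsSortable cs a w →
        CoxeterSortable.nc cs a' w = CoxeterSortable.nc cs a w)) ∧
    Set.BijOn (CoxeterSortable.nc cs a) {w | CoxeterSortable.IsSortable cs a w}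
      (CoxeterSortable.noncrossingPartitions cs c) ∧
    ∀ w : W, CoxeterSortable.IsSortable cs a w →
      CoxeterSortable.absLength cs (CoxeterSortable.nc cs a w) =
        {i : B | cs.IsRightDescent w i}.ncard := by
  classical
  have : Fintype B := ⟨a.toFinset, fun i => List.mem_toFinset.2 (ha.mem i)⟩
  have hsort := CoxeterSortable.isSortable_iff (cs := cs) ha.nodup ha.mem
  refine ⟨fun a' ha' w => ⟨⟨fun h => (ha'.isSortable_and_nc_eq ha h).1,
    fun h => (ha.isSortable_and_nc_eq ha' h).1⟩, fun h => (ha.isSortable_and_nc_eq ha' h).2⟩,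
    ⟨?_, ?_, ?_⟩, ?_⟩
  · intro w hw
    obtain ⟨ω, L, h, rfl⟩ := (hsort w).1 hw
    rw [h.nc_eq ha.nodup ha.mem, ← ha.wordProd_eq]
    exact (h.isBelow ha.nodup).mem_noncrossingPartitions ha.nodup
  · intro w hw w' hw' heq
    obtain ⟨ω, L, h, rfl⟩ := (hsort w).1 hw
    obtain ⟨ω', L', h', rfl⟩ := (hsort w').1 hw'
    rw [h.nc_eq ha.nodup ha.mem, h'.nc_eq ha.nodup ha.mem] at heq
    rw [h.eq_of_ncProd_eq h' ha.nodup heq]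
  · intro x hx
    rw [← ha.wordProd_eq] at hx
    obtain ⟨k, hk⟩ := CoxeterSortable.exists_isBelow_of_absLE ha.nodup hx.2
    obtain ⟨ω, L, h, rfl⟩ := CoxeterSortable.isNC_of_isBelow _ a ha.nodup rfl x k hk
    exact ⟨cs.wordProd ω, (hsort _).2 ⟨ω, L, h, rfl⟩, h.nc_eq ha.nodup ha.mem⟩
  · intro w hw
    obtain ⟨ω, L, h, rfl⟩ := (hsort w).1 hw
    rw [h.nc_eq ha.nodup ha.mem, ← h.length_negSkips ha.nodup]
    have hb := h.isBelow ha.nodup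
    obtain ⟨m, hk, -⟩ := id hb
    exact hk.absLength_eq fun m => hb.le ha.nodup
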